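/- Let $d\in\mathbb N$ and write $|\cdot|$ for Euclidean norms. Let $\psi_0\in C_0^\infty(\mathbb R^d)$ be real-valued with $\psi_0(\xi)=1$ for $|\xi|\le1$ and $\psi_0(\xi)=0$ for $|\xi|\ge2$. Let $\varphi_0\in C_0^\infty(\mathbb R^{2d})$ be real-valued with $\varphi_0(x,\xi)=1$ for $|(x,\xi)|\le1$, $\varphi_0(x,\xi)=0$ for $|(x,\xi)|\ge2$, and $\varphi_0(x,-\xi)=\varphi_0(x,\xi)$. For $k\ge0$ put $\Phi_k(x,\xi)=\varphi_0(2^{-k}x,2^{-k}\xi)$, and for $k\geq 1$ put $\varphi_k=\Phi_k-\Phi_{k-1}$. Write $a(x,D)u(x)=(2\pi)^{-d}\int e^{ix\xi}a(x,\xi)\widehat u(\xi)\,d\xi$ with $\widehat u(\xi)=\int e^{-iy\xi}u(y)\,dy$; for $a(x,\cdot)\in C_0^\infty(\mathbb R^d)$ and bounded $u$ this means $a(x,D)u(x)=(2\pi)^{-d}\int\big(\int e^{i(x-y)\xi}a(x,\xi)\,d\xi\big)u(y)\,dy$. For $m\in\mathbb R$ and $0\le\delta\le\rho\le1$, let $\Gamma^m_{\rho,\delta}$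 be the set of $a\in C^\infty(\mathbb R^{2d})$ (complex-valued) such that for all $\alpha,\beta\in\mathbb N^d$ there is $C_{\alpha,\beta}$ with $|\partial_x^\beta\partial_\xi^\alpha a(x,\xi)|\le C_{\alpha,\beta}(1+|x|+|\xi|)^{m-\rho|\alpha|+\delta|\beta|}$ for all $x,\xi\in\mathbb R^d$. For $r>0$ let $C^r$ be the space of functions on $\mathbb R^d$ with continuous and bounded derivatives of all orders $\le\lfloor r\rfloor$ and, if $r\notin\mathbb N$, with derivatives of order $\lfloor r\rfloor$ that are globally Hölder continuous of exponent $r-\lfloor r\rfloor$. Let $F\in C^\infty(\mathbb R)$ be real-valued, $0<\delta<1$, $r>0$, and let $u\in C^r$ be real-valued. For $k\ge0$ put $$m_k(x)=\int_0^1F'\big(\Phi_k(x,D)u(x)+t\,\varphi_{k+1}(x,D)u(x)\big)\,dt,$$ $$M^\sharp(x,\xi)=\sum_{k=0}^\infty\big(\psi_0(2^{-k\delta}D)m_k\big)(x)\,\varphi_{k+1}(x,\xi),\qquad M^b(x,\xi)=\sum_{k=0}^\infty\big((I-\psi_0(2^{-k\delta}D))m_k\big)(x)\,\varphi_{k+1}(x,\xi).$$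 Then $M^\sharp\in\Gamma^0_{1,\delta}$ and, more precisely, for all $\alpha,\beta\in\mathbb N^d$ there is a constant $C_{\alpha,\beta}$ such that for all $x,\xi\in\mathbb R^d$ $$|\partial_x^\beta\partial_\xi^\alpha M^\sharp(x,\xi)|\le\begin{cases}C_{\alpha,\beta}(1+|x|+|\xi|)^{-|\alpha|}&\text{if }|\beta|\le r,\\ C_{\alpha,\beta}(1+|x|+|\xi|)^{-|\alpha|+\delta(|\beta|-r)}&\text{if }|\beta|>r.\end{cases}$$ Moreover $M^b\in\Gamma^{-\delta r}_{1,1}$. -/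

import Mathlib

open MeasureTheory
open scoped ContDiff

namespace Paradiff

noncomputable section

/-- The Euclidean space `ℝ^d`; the phase space `ℝ^{2d}` is `E d × E d`, with points `(x, ξ)`. -/
abbrev E (d : ℕ) : Type := EuclideanSpace ℝ (Fin d)

/-! ### Hölder spaces -/

/-- `u ∈ C^r(ℝ^d)`, `r ≥ 0`. With `n = ⌊r⌋`: `u` has continuous bounded derivatives up to order `n`,
and the derivatives of order `n` are Hölder continuous of exponent `r - n`. If `r = n` is an integer
the last condition is implied by boundedness (as `t ^ 0 = 1`), and `C^r` is the space
of functions with continuous and bounded derivatives up to order `r`. -/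
structure MemHolder {d : ℕ} (r : ℝ) (u : E d → ℝ) : Prop where
  contDiff : ContDiff ℝ (⌊r⌋₊ : ℕ) u
  bounded : ∀ j : ℕ, j ≤ ⌊r⌋₊ → ∃ C : ℝ, ∀ x, ‖iteratedFDeriv ℝ j u x‖ ≤ C
  holder : ∃ C : ℝ, ∀ x y,
    ‖iteratedFDeriv ℝ ⌊r⌋₊ u x - iteratedFDeriv ℝ ⌊r⌋₊ u y‖ ≤ C * ‖x - y‖ ^ (r - (⌊r⌋₊ : ℝ))

/-! ### Multi-index derivatives and symbol classes -/

/-- The length `|α| = α_1 + ⋯ + α_d` of a multi-index. -/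
def multiLen {d : ℕ} (α : Fin d → ℕ) : ℕ := ∑ i, α i

/-- The derivative of `f` in the direction `v`. -/
def dirDeriv {V : Type*} [NormedAddCommGroup V] [NormedSpace ℝ V] (v : V) (f : V → ℂ) : V → ℂ :=
  fun z => fderiv ℝ f z v

/-- `D_{v_1}^{α_1} ⋯ D_{v_d}^{α_d} f`, where `D_v` is the derivative in the direction `v`. -/
def multiDeriv {V : Type*} [NormedAddCommGroup V] [NormedSpace ℝ V] {d : ℕ} (v : Fin d → V)
    (α : Fin d → ℕ) (f : V → ℂ) : V → ℂ :=
  (List.finRange d).foldr (fun i g => (dirDeriv (v i))^[α i] g) f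

/-- `∂_x^β ∂_ξ^α a` for a function `a(x, ξ)` on phase space. -/
def symbolDeriv {d : ℕ} (β α : Fin d → ℕ) (a : E d × E d → ℂ) : E d × E d → ℂ :=
  multiDeriv (fun i => ((EuclideanSpace.single i 1, 0) : E d × E d)) β
    (multiDeriv (fun i => ((0, EuclideanSpace.single i 1) : E d × E d)) α a)

/-- `a ∈ Γ^m_{ρ,δ}`: `a ∈ C^∞(ℝ^{2d})` and
`|∂_x^β ∂_ξ^α a(x,ξ)| ≤ C_{α,β} (1 + |x| + |ξ|)^{m - ρ|α| + δ|β|}` for all `α, β ∈ ℕ^d`. -/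
structure MemGamma {d : ℕ} (m ρ δ : ℝ) (a : E d × E d → ℂ) : Prop where
  smooth : ContDiff ℝ ∞ a
  bound : ∀ α β : Fin d → ℕ, ∃ C : ℝ, ∀ x ξ : E d,
    ‖symbolDeriv β α a (x, ξ)‖ ≤
      C * (1 + ‖x‖ + ‖ξ‖) ^ (m - ρ * (multiLen α : ℝ) + δ * (multiLen β : ℝ))

/-! ### Pseudodifferential operators -/

/-- The function `a(x, D) u`, where `a(x, D) u = (2π)^{-d} ∫ e^{ixξ} a(x,ξ) û(ξ) dξ` and
`û(ξ) = ∫ e^{-iyξ} u(y) dy`. It is written through its integral kernel,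
`a(x, D) u (x) = (2π)^{-d} ∫ (∫ e^{i(x-y)ξ} a(x,ξ) dξ) u(y) dy`,
which for `a(x, ·) ∈ C_c^∞` and bounded `u` is the pairing of the tempered distribution `û` with
the test function `(2π)^{-d} e^{ix·} a(x, ·)`. -/
def pseudoDiff {d : ℕ} (a : E d → E d → ℂ) (u : E d → ℂ) (x : E d) : ℂ :=
  ((2 * Real.pi : ℂ) ^ d)⁻¹ *
    ∫ y : E d, (∫ ξ : E d, Complex.exp (Complex.I * (inner ℝ (x - y) ξ : ℝ)) * a x ξ) * u y

/-- For integrable `u` the kernel formula is the usual Fourier formula. -/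
theorem pseudoDiff_eq_fourier {d : ℕ} (a : E d → E d → ℂ) (u : E d → ℂ) (x : E d)
    (ha : Integrable (a x)) (hu : Integrable u) :
    pseudoDiff a u x = ((2 * Real.pi : ℂ) ^ d)⁻¹ *
      ∫ ξ : E d, Complex.exp (Complex.I * (inner ℝ x ξ : ℝ)) * a x ξ *
        ∫ y : E d, Complex.exp (-Complex.I * (inner ℝ y ξ : ℝ)) * u y := by
  unfold pseudoDiff
  congr 1
  simp_rw [← integral_const_mul, ← integral_mul_const]
  rw [integral_integral_swap]
  · refine integral_congr_ae (Filter.Eventually.of_forall fun ξ => ?_)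
    refine integral_congr_ae (Filter.Eventually.of_forall fun y => ?_)
    have h : Complex.exp (Complex.I * (inner ℝ (x - y) ξ : ℝ)) =
        Complex.exp (Complex.I * (inner ℝ x ξ : ℝ)) *
          Complex.exp (-Complex.I * (inner ℝ y ξ : ℝ)) := by
      rw [← Complex.exp_add, inner_sub_left]
      push_cast
      ring_nf
    simp only [h]
    ring
  · have h : Integrable (fun p : E d × E d => u p.1 * a x p.2) (volume.prod volume) :=
      hu.mul_prod ha
    have h2 := h.bdd_mul (c := 1)
      (f := fun p : E d × E d => Complex.exp (Complex.I * (inner ℝ (x - p.1) p.2 : ℝ)))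
      (by fun_prop) (Filter.Eventually.of_forall fun p => by
        rw [mul_comm, Complex.norm_exp_ofReal_mul_I])
    refine h2.congr (Filter.Eventually.of_forall fun p => ?_)
    simp only [Function.uncurry]
    ring

/-- If `a` is real-valued and even in `ξ`, then `a(x, D)` maps real functions to real functions. -/
theorem pseudoDiff_im {d : ℕ} (a : E d → E d → ℝ) (ha : ∀ x ξ, a x (-ξ) = a x ξ)
    (u : E d → ℝ) (x : E d) :
    (pseudoDiff (fun x ξ => (a x ξ : ℂ)) (fun y => (u y : ℂ)) x).im = 0 := by
  rw [← Complex.conj_eq_iff_im]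
  unfold pseudoDiff
  rw [map_mul, ← integral_conj]
  congr 1
  · rw [map_inv₀, map_pow, map_mul, map_ofNat, Complex.conj_ofReal]
  · refine integral_congr_ae (Filter.Eventually.of_forall fun y => ?_)
    simp only [map_mul, Complex.conj_ofReal]
    congr 1
    rw [← integral_conj, ← integral_neg_eq_self]
    refine integral_congr_ae (Filter.Eventually.of_forall fun ξ => ?_)
    simp [ha, ← Complex.exp_conj]

/-- The Fourier multiplier `p(D) u`. -/
def fourierMult {d : ℕ} (p : E d → ℂ) (u : E d → ℂ) : E d → ℂ :=
  pseudoDiff (fun _ ξ => p ξ) u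

/-! ### Littlewood-Paley partitions of unity -/

/-- `ψ₀ ∈ C_0^∞(ℝ^d)` is real-valued, `ψ₀(ξ) = 1` for `|ξ| ≤ 1` and `ψ₀(ξ) = 0` for `|ξ| ≥ 2`. -/
structure IsLPCutoff {d : ℕ} (ψ₀ : E d → ℝ) : Prop where
  smooth : ContDiff ℝ ∞ ψ₀
  eq_one : ∀ ξ, ‖ξ‖ ≤ 1 → ψ₀ ξ = 1
  eq_zero : ∀ ξ, 2 ≤ ‖ξ‖ → ψ₀ ξ = 0

/-- The same in phase space, `φ₀ ∈ C_0^∞(ℝ^{2d})` real-valued, equal to `1` on the Euclidean unit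
ball of `ℝ^{2d}` and to `0` outside the ball of radius `2`; moreover `φ₀` is even in `ξ`. -/
structure IsPhaseLPCutoff {d : ℕ} (φ₀ : E d × E d → ℝ) : Prop where
  smooth : ContDiff ℝ ∞ φ₀
  eq_one : ∀ x ξ, Real.sqrt (‖x‖ ^ 2 + ‖ξ‖ ^ 2) ≤ 1 → φ₀ (x, ξ) = 1
  eq_zero : ∀ x ξ, 2 ≤ Real.sqrt (‖x‖ ^ 2 + ‖ξ‖ ^ 2) → φ₀ (x, ξ) = 0
  even : ∀ x ξ, φ₀ (x, -ξ) = φ₀ (x, ξ)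

/-- `Φ_k(x, ξ) = φ₀(2^{-k} x, 2^{-k} ξ)`. -/
def bigPhi {d : ℕ} (φ₀ : E d × E d → ℝ) (k : ℕ) (z : E d × E d) : ℝ :=
  φ₀ (((2 : ℝ) ^ k)⁻¹ • z)

/-- The partition of unity: `φ_0` is the given cutoff and `φ_k = Φ_k - Φ_{k-1}` for `k ≥ 1`. -/
def smallPhi {d : ℕ} (φ₀ : E d × E d → ℝ) : ℕ → E d × E d → ℝ
  | 0 => φ₀
  | k + 1 => fun z => bigPhi φ₀ (k + 1) z - bigPhi φ₀ k z

theorem sum_smallPhi {d : ℕ} (φ₀ : E d × E d → ℝ) (k : ℕ) (z : E d × E d) :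
    ∑ j ∈ Finset.range (k + 1), smallPhi φ₀ j z = bigPhi φ₀ k z := by
  induction k with
  | zero => simp [smallPhi, bigPhi]
  | succ k ih => rw [Finset.sum_range_succ, ih]; simp [smallPhi]

/-- `b(x, D) u` for a real symbol `b` on phase space, even in `ξ`, and a real function `u`. It is
real-valued (`pseudoDiff_im`), and is recorded here as a real function. -/
def realOp {d : ℕ} (b : E d × E d → ℝ) (u : E d → ℝ) (x : E d) : ℝ :=
  (pseudoDiff (fun x ξ => (b (x, ξ) : ℂ)) (fun y => (u y : ℂ)) x).re

theorem realOp_bigPhi {d : ℕ} {φ₀ : E d × E d → ℝ} (h : IsPhaseLPCutoff φ₀) (k : ℕ)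
    (u : E d → ℝ) (x : E d) :
    (realOp (bigPhi φ₀ k) u x : ℂ) =
      pseudoDiff (fun x ξ => (bigPhi φ₀ k (x, ξ) : ℂ)) (fun y => (u y : ℂ)) x := by
  have := pseudoDiff_im (fun x ξ => bigPhi φ₀ k (x, ξ))
    (fun x ξ => by simp [bigPhi, h.even]) u x
  exact Complex.ext (by simp [realOp]) (by simpa using this.symm)

theorem realOp_smallPhi {d : ℕ} {φ₀ : E d × E d → ℝ} (h : IsPhaseLPCutoff φ₀) (k : ℕ)
    (u : E d → ℝ) (x : E d) :
    (realOp (smallPhi φ₀ k) u x : ℂ) =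
      pseudoDiff (fun x ξ => (smallPhi φ₀ k (x, ξ) : ℂ)) (fun y => (u y : ℂ)) x := by
  have := pseudoDiff_im (fun x ξ => smallPhi φ₀ k (x, ξ))
    (fun x ξ => by cases k <;> simp [smallPhi, bigPhi, h.even]) u x
  exact Complex.ext (by simp [realOp]) (by simpa using this.symm)

/-! ### The paralinearization symbols -/

/-- `m_k(x) = ∫_0^1 F'(Φ_k(x,D)u + t φ_{k+1}(x,D)u) dt`. -/
def mCoeff {d : ℕ} (φ₀ : E d × E d → ℝ) (F : ℝ → ℝ) (u : E d → ℝ) (k : ℕ) (x : E d) : ℝ :=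
  ∫ t in (0 : ℝ)..1,
    deriv F (realOp (bigPhi φ₀ k) u x + t * realOp (smallPhi φ₀ (k + 1)) u x)

/-- The smoothed coefficient `ψ₀(2^{-kδ} D) m_k`. -/
def mSmooth {d : ℕ} (ψ₀ : E d → ℝ) (φ₀ : E d × E d → ℝ) (δ : ℝ) (F : ℝ → ℝ) (u : E d → ℝ)
    (k : ℕ) : E d → ℂ :=
  fourierMult (fun ξ => (ψ₀ ((2 : ℝ) ^ (-((k : ℝ) * δ)) • ξ) : ℂ))
    (fun y => (mCoeff φ₀ F u k y : ℂ))

/-- `M^♯(x,ξ) = ∑_{k ≥ 0} (ψ₀(2^{-kδ} D) m_k)(x) φ_{k+1}(x,ξ)`; the sum is locally finite. -/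
def Msharp {d : ℕ} (ψ₀ : E d → ℝ) (φ₀ : E d × E d → ℝ) (δ : ℝ) (F : ℝ → ℝ) (u : E d → ℝ) :
    E d × E d → ℂ :=
  fun z => ∑' k : ℕ, mSmooth ψ₀ φ₀ δ F u k z.1 * (smallPhi φ₀ (k + 1) z : ℂ)

/-- `M^b(x,ξ) = ∑_{k ≥ 0} ((I - ψ₀(2^{-kδ} D)) m_k)(x) φ_{k+1}(x,ξ)`; the sum is locally finite. -/
def Mflat {d : ℕ} (ψ₀ : E d → ℝ) (φ₀ : E d × E d → ℝ) (δ : ℝ) (F : ℝ → ℝ) (u : E d → ℝ) :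
    E d × E d → ℂ :=
  fun z => ∑' k : ℕ, ((mCoeff φ₀ F u k z.1 : ℂ) - mSmooth ψ₀ φ₀ δ F u k z.1) *
    (smallPhi φ₀ (k + 1) z : ℂ)

end

end Paradiff

/-! The theorem reduces to two facts about the coefficients, uniform in `k`: derivatives of order
`i` of ψ₀(2^{-kδ}D)m_k are O(2^{kδ(i-r)_+}), and those of (I - ψ₀(2^{-kδ}D))m_k are O(2^{k(i-δr)}).
Indeed φ_{k+1} lives where 1+|x|+|ξ| is comparable to 2^k, each of its derivatives gains 2^{-k}, and
at most four terms contribute at a point (`exists_symbolDeriv_shellSum_bound`).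

Instead of a uniform C^r norm of m_k, the proof carries a splitting available at every scale 0 < ε ≤
1: m_k = a + b with |∂^i a| ≲ ε^{-(i-r)_+} and |b| ≲ ε^r, uniformly in `k` (`exists_mCoeff_split`).
For `u` itself it comes from ψ₀(εD), whose kernel has integral one and vanishing higher moments
because ψ₀ = 1 near 0 (`UnitKernel.smoothing`). The operators Φ_k(x,D) preserve it: after rescaling
they are integrals against a rapidly decaying kernel at scale 2^{-k}, and derivatives of the smooth
part can be left on the function. The mean of F' over the segment from Φ_k u to Φ_{k+1} u preserves
it too, by the chain rule for the smooth part and a Lipschitz bound for the small part. Integer and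
non-integer `r` are treated alike.

With ε = 2^{-kδ}, ψ₀(εD)a keeps the bounds of `a`, while `i` derivatives of ψ₀(εD)b cost ε^{-i}
against the gain ε^r (`exists_mSmooth_bound`). The remainder h = m_k - ψ₀(εD)m_k is O(ε^r) in
supremum norm, and its derivatives of high order are controlled at the natural scale τ = 2^{-k} of
m_k. Smoothing `h` once more, at scale τ, yields every order in between
(`UnitKernel.norm_iteratedFDeriv_sub_kernelOp_le`). -/

open scoped FourierTransform

namespace Paradiff

noncomputable section

/-! ### Differentiation of parametric integrals -/

section Calculus

variable {X Y G H : Type*} [NormedAddCommGroup X] [NormedSpace ℝ X] [NormedAddCommGroup Y]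
  [NormedSpace ℝ Y] [NormedAddCommGroup G] [NormedSpace ℝ G] [NormedAddCommGroup H]
  [NormedSpace ℝ H]

theorem natCast_le_infty (j : ℕ) : (j : WithTop ℕ∞) ≤ ∞ := by exact_mod_cast le_top

/-- Smoothness of a parametric integral, with differentiation under the integral sign. -/
theorem contDiff_integral_of_dominated {Ω : Type*} [MeasurableSpace Ω] {μ : Measure Ω}
    {f : X → Ω → G} (hf : ∀ p, ContDiff ℝ ∞ fun x => f x p)
    (hmeas : ∀ (j : ℕ) (x : X),
      AEStronglyMeasurable (fun p => iteratedFDeriv ℝ j (fun x => f x p) x) μ)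
    (hbound : ∀ (j : ℕ) (x₀ : X), ∃ b : Ω → ℝ, Integrable b μ ∧ ∃ s ∈ nhds x₀, ∀ᵐ p ∂μ, ∀ x ∈ s,
      ‖iteratedFDeriv ℝ j (fun x => f x p) x‖ ≤ b p) :
    ContDiff ℝ ∞ (fun x => ∫ p, f x p ∂μ) ∧ ∀ j x, iteratedFDeriv ℝ j (fun x => ∫ p, f x p ∂μ) x =
      ∫ p, iteratedFDeriv ℝ j (fun x => f x p) x ∂μ := by
  let L : ∀ j : ℕ, _ := fun j : ℕ =>
    (continuousMultilinearCurryLeftEquiv ℝ (fun _ : Fin (j + 1) => X) G).symm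
  have hL : ∀ (j : ℕ) (p : Ω) (x : X), iteratedFDeriv ℝ (j + 1) (fun x => f x p) x =
      L j (fderiv ℝ (iteratedFDeriv ℝ j (fun x => f x p)) x) := fun j p x => by
    rw [iteratedFDeriv_succ_eq_comp_left]; rfl
  have hder : ∀ (j : ℕ) (x : X),
      HasFDerivAt (fun x => ∫ p, iteratedFDeriv ℝ j (fun x => f x p) x ∂μ)
        (∫ p, fderiv ℝ (iteratedFDeriv ℝ j (fun x => f x p)) x ∂μ) x := by
    intro j x
    obtain ⟨b, hb, s, hs, hbs⟩ := hbound (j + 1) x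
    obtain ⟨b', hb', s', hs', hbs'⟩ := hbound j x
    refine hasFDerivAt_integral_of_dominated_of_fderiv_le hs
      (F' := fun x p => fderiv ℝ (iteratedFDeriv ℝ j (fun x => f x p)) x)
      (Filter.Eventually.of_forall fun y => hmeas j y) ?_ ?_ ?_ hb ?_
    · exact hb'.mono' (hmeas j x) (hbs'.mono fun p hp => hp x (mem_of_mem_nhds hs'))
    · have := (L j).symm.continuous.comp_aestronglyMeasurable (hmeas (j + 1) x)
      refine this.congr (Filter.Eventually.of_forall fun p => ?_)
      simp [hL]
    · filter_upwards [hbs] with p hp y hy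
      rw [norm_fderiv_iteratedFDeriv]
      exact hp y hy
    · refine Filter.Eventually.of_forall fun p y _ => ?_
      exact ((hf p).differentiable_iteratedFDeriv
        (by exact_mod_cast WithTop.coe_lt_top _) y).hasFDerivAt
  have key : ∀ j : ℕ, iteratedFDeriv ℝ j (fun x => ∫ p, f x p ∂μ) =
      fun x => ∫ p, iteratedFDeriv ℝ j (fun x => f x p) x ∂μ := by
    intro j
    induction j with
    | zero =>
      ext1 x
      have := (continuousMultilinearCurryFin0 ℝ X G).symm.toContinuousLinearEquiv.integral_comp_comm
        (fun p => f x p) (μ := μ)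
      simp only [iteratedFDeriv_zero_eq_comp]
      exact this.symm
    | succ j ih =>
      ext1 x
      rw [iteratedFDeriv_succ_eq_comp_left, ih, Function.comp_apply, (hder j x).fderiv]
      simp_rw [hL]
      exact (ContinuousLinearEquiv.integral_comp_comm (𝕜 := ℝ)
        (E := X →L[ℝ] ContinuousMultilinearMap ℝ (fun _ : Fin j => X) G)
        (F := ContinuousMultilinearMap ℝ (fun _ : Fin (j + 1) => X) G)
        (μ := μ) (L j).toContinuousLinearEquiv
        (fun p => fderiv ℝ (iteratedFDeriv ℝ j (fun x => f x p)) x)).symm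
  refine ⟨contDiff_of_differentiable_iteratedFDeriv fun j _ => ?_, fun j x => by rw [key]⟩
  rw [key]
  exact fun x => (hder j x).differentiableAt

theorem iteratedFDeriv_comp_affine {f : Y → G} (hf : ContDiff ℝ ∞ f) (A : X →L[ℝ] Y) (c : Y)
    (j : ℕ) (x : X) : iteratedFDeriv ℝ j (fun x => f (A x + c)) x =
      (iteratedFDeriv ℝ j f (A x + c)).compContinuousLinearMap fun _ => A := by
  have h : ContDiff ℝ ∞ fun y => f (y + c) := hf.comp (contDiff_id.add contDiff_const)
  have := A.iteratedFDeriv_comp_right h x (natCast_le_infty j)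
  rw [iteratedFDeriv_comp_add_right] at this
  exact this

theorem norm_iteratedFDeriv_comp_affine_le {f : Y → G} (hf : ContDiff ℝ ∞ f) (A : X →L[ℝ] Y)
    (c : Y) (j : ℕ) (x : X) : ‖iteratedFDeriv ℝ j (fun x => f (A x + c)) x‖ ≤
      ‖A‖ ^ j * ‖iteratedFDeriv ℝ j f (A x + c)‖ := by
  rw [iteratedFDeriv_comp_affine hf, mul_comm]
  refine (ContinuousMultilinearMap.norm_compContinuousLinearMap_le _ _).trans_eq ?_
  simp

/-- Partial derivatives of a jointly smooth function depend continuously on the parameter. -/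
theorem continuous_iteratedFDeriv_param {f : X → Y → G} (hf : ContDiff ℝ ∞ (Function.uncurry f))
    (j : ℕ) (x : X) : Continuous fun y => iteratedFDeriv ℝ j (fun x => f x y) x := by
  have h : ∀ y, iteratedFDeriv ℝ j (fun x => f x y) x =
      (iteratedFDeriv ℝ j (Function.uncurry f) (x, y)).compContinuousLinearMap
        fun _ => ContinuousLinearMap.inl ℝ X Y := fun y => by
    have := iteratedFDeriv_comp_affine hf (ContinuousLinearMap.inl ℝ X Y) (0, y) j x
    simpa [Function.uncurry] using this
  simp_rw [h]
  exact (ContinuousMultilinearMap.compContinuousLinearMapL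
    fun _ : Fin j => ContinuousLinearMap.inl ℝ X Y).continuous.comp
      ((hf.continuous_iteratedFDeriv (natCast_le_infty j)).comp (by fun_prop))

end Calculus

/-! ### Symbols decaying rapidly in the second variable -/

section PartialFourier

variable {d : ℕ} {G H K : Type*} [NormedAddCommGroup G] [NormedSpace ℝ G]
  [NormedAddCommGroup H] [NormedSpace ℝ H] [NormedAddCommGroup K] [NormedSpace ℝ K]

/-- Smooth functions on phase space which, together with all derivatives, decay rapidly in the
second variable, uniformly in the first one. -/
structure RapidDecay (a : E d × E d → G) : Prop where
  smooth : ContDiff ℝ ∞ a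
  decay : ∀ j N : ℕ, ∃ C : ℝ, ∀ z, (1 + ‖z.2‖) ^ N * ‖iteratedFDeriv ℝ j a z‖ ≤ C

theorem RapidDecay.of_zero_outside {a : E d × E d → G} (ha : ContDiff ℝ ∞ a)
    (hb : ∀ j : ℕ, ∃ C : ℝ, ∀ z, ‖iteratedFDeriv ℝ j a z‖ ≤ C) {R : ℝ}
    (h0 : ∀ z, R ≤ ‖z.2‖ → a z = 0) : RapidDecay a := by
  refine ⟨ha, fun j N => ?_⟩
  obtain ⟨C, hC⟩ := hb j
  have hC0 : 0 ≤ C := (norm_nonneg _).trans (hC 0)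
  refine ⟨(1 + |R|) ^ N * C, fun z => ?_⟩
  rcases le_or_gt ‖z.2‖ R with h | h
  · gcongr
    · exact h.trans (le_abs_self R)
    · exact hC z
  · have : a =ᶠ[nhds z] fun _ => 0 := by
      have : ∀ᶠ y : E d × E d in nhds z, R < ‖y.2‖ :=
        (continuous_snd.norm.continuousAt (x := z)).eventually (lt_mem_nhds h)
      exact this.mono fun y hy => h0 y hy.le
    have h2 : iteratedFDeriv ℝ j a z = 0 := by
      rw [(this.iteratedFDeriv ℝ j).eq_of_nhds]
      simp
    rw [h2, norm_zero, mul_zero]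
    positivity

theorem RapidDecay.add {a b : E d × E d → G} (ha : RapidDecay a) (hb : RapidDecay b) :
    RapidDecay fun z => a z + b z := by
  refine ⟨ha.smooth.add hb.smooth, fun j N => ?_⟩
  obtain ⟨C, hC⟩ := ha.decay j N
  obtain ⟨C', hC'⟩ := hb.decay j N
  refine ⟨C + C', fun z => ?_⟩
  have h2 : iteratedFDeriv ℝ j (fun z => a z + b z) z =
      iteratedFDeriv ℝ j a z + iteratedFDeriv ℝ j b z :=
    congrFun (iteratedFDeriv_add (ha.smooth.of_le (natCast_le_infty j))
      (hb.smooth.of_le (natCast_le_infty j))) z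
  rw [h2]
  calc _ ≤ (1 + ‖z.2‖) ^ N * (‖iteratedFDeriv ℝ j a z‖ + ‖iteratedFDeriv ℝ j b z‖) := by
        gcongr; exact norm_add_le _ _
    _ ≤ _ := by rw [mul_add]; exact add_le_add (hC z) (hC' z)

theorem RapidDecay.clm_comp {a : E d × E d → G} (ha : RapidDecay a) (L : G →L[ℝ] H) :
    RapidDecay fun z => L (a z) := by
  refine ⟨L.contDiff.comp ha.smooth, fun j N => ?_⟩
  obtain ⟨C, hC⟩ := ha.decay j N
  refine ⟨‖L‖ * C, fun z => ?_⟩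
  calc _ ≤ (1 + ‖z.2‖) ^ N * (‖L‖ * ‖iteratedFDeriv ℝ j a z‖) := by
        gcongr
        exact L.norm_iteratedFDeriv_comp_left ha.smooth.contDiffAt (natCast_le_infty j)
    _ = ‖L‖ * ((1 + ‖z.2‖) ^ N * ‖iteratedFDeriv ℝ j a z‖) := by ring
    _ ≤ _ := by gcongr; exact hC z

theorem RapidDecay.zero : RapidDecay fun _ : E d × E d => (0 : G) :=
  ⟨contDiff_const, fun j N => ⟨0, fun z => by simp⟩⟩

theorem RapidDecay.sum {ι : Type*} (s : Finset ι) {a : ι → E d × E d → G}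
    (ha : ∀ i ∈ s, RapidDecay (a i)) : RapidDecay fun z => ∑ i ∈ s, a i z := by
  classical
  induction s using Finset.induction_on with
  | empty => simpa using RapidDecay.zero
  | insert i s hi ih =>
    simp_rw [Finset.sum_insert hi]
    exact (ha i (by simp)).add (ih fun j hj => ha j (by simp [hj]))

theorem RapidDecay.fderiv {a : E d × E d → G} (ha : RapidDecay a) : RapidDecay (fderiv ℝ a) := by
  refine ⟨ha.smooth.fderiv_right (by simp), fun j N => ?_⟩
  simp_rw [norm_iteratedFDeriv_fderiv]
  exact ha.decay (j + 1) N

theorem RapidDecay.fderiv_apply {a : E d × E d → G} (ha : RapidDecay a) (v : E d × E d) :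
    RapidDecay fun z => _root_.fderiv ℝ a z v :=
  ha.fderiv.clm_comp (ContinuousLinearMap.apply ℝ G v)

theorem norm_iteratedFDeriv_clm_le {X Y : Type*} [NormedAddCommGroup X] [NormedSpace ℝ X]
    [NormedAddCommGroup Y] [NormedSpace ℝ Y] (L : X →L[ℝ] Y) (j : ℕ) (x : X) :
    ‖iteratedFDeriv ℝ j L x‖ ≤ ‖L x‖ + ‖L‖ := by
  rcases j with _ | _ | j
  · simp
  · rw [norm_iteratedFDeriv_one, L.fderiv]
    simp
  · rw [← norm_iteratedFDeriv_fderiv]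
    have : _root_.fderiv ℝ (L : X → Y) = fun _ => L := by ext1 x; exact L.fderiv
    rw [this, iteratedFDeriv_const_of_ne (by simp)]
    simp only [Pi.zero_apply, norm_zero]
    positivity

/-- A factor linear in the second variable costs one power of decay, which is why the bounds for `a`
are taken at `N + 1`. Such factors arise whenever a phase is differentiated. -/
theorem RapidDecay.bilin_linear {a : E d × E d → G} (ha : RapidDecay a) (B : H →L[ℝ] G →L[ℝ] K)
    (l : E d →L[ℝ] H) : RapidDecay fun z => B (l z.2) (a z) := by
  let L : E d × E d →L[ℝ] H := l.comp (ContinuousLinearMap.snd ℝ (E d) (E d))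
  refine ⟨(B.contDiff.comp L.contDiff).clm_apply ha.smooth, fun j N => ?_⟩
  choose C hC using fun i => ha.decay i (N + 1)
  refine ⟨‖B‖ * ∑ i ∈ Finset.range (j + 1), (j.choose i : ℝ) * (‖l‖ + ‖L‖) * C (j - i),
    fun z => ?_⟩
  have h := B.norm_iteratedFDeriv_le_of_bilinear L.contDiff ha.smooth z (natCast_le_infty j)
  refine (mul_le_mul_of_nonneg_left h (by positivity)).trans ?_
  calc _
    _ = ‖B‖ * ∑ i ∈ Finset.range (j + 1), (j.choose i : ℝ) * ((1 + ‖z.2‖) ^ N *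
        (‖iteratedFDeriv ℝ i L z‖ * ‖iteratedFDeriv ℝ (j - i) a z‖)) := by
      rw [mul_left_comm, Finset.mul_sum]
      congr 2 with i
      ring
    _ ≤ _ := by
      refine mul_le_mul_of_nonneg_left (Finset.sum_le_sum fun i _ => ?_) (norm_nonneg B)
      rw [mul_assoc]
      refine mul_le_mul_of_nonneg_left ?_ (by positivity)
      have h1 : ‖iteratedFDeriv ℝ i L z‖ ≤ (‖l‖ + ‖L‖) * (1 + ‖z.2‖) := by
        have h2 : ‖L z‖ ≤ ‖l‖ * ‖z.2‖ := l.le_opNorm z.2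
        have := norm_iteratedFDeriv_clm_le L i z
        nlinarith [norm_nonneg l, norm_nonneg L, norm_nonneg z.2,
          mul_nonneg (norm_nonneg L) (norm_nonneg z.2)]
      calc _ ≤ (1 + ‖z.2‖) ^ N * ((‖l‖ + ‖L‖) * (1 + ‖z.2‖) *
            ‖iteratedFDeriv ℝ (j - i) a z‖) := by gcongr
        _ = (‖l‖ + ‖L‖) * ((1 + ‖z.2‖) ^ (N + 1) * ‖iteratedFDeriv ℝ (j - i) a z‖) := by ring
        _ ≤ _ := by gcongr; exact hC _ z

/-- The integrable weight `(1 + |w|)^{-(d+1)}`. -/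
def weight (w : E d) : ℝ := ((1 + ‖w‖) ^ (d + 1))⁻¹

theorem weight_nonneg (w : E d) : 0 ≤ weight w := by unfold weight; positivity

theorem integrable_weight : Integrable (weight : E d → ℝ) := by
  have h := integrable_one_add_norm (E := E d) (μ := volume) (r := (d + 1 : ℕ)) (by simp)
  refine h.congr (Filter.Eventually.of_forall fun w => ?_)
  simp only [weight]
  rw [Real.rpow_neg (by positivity), Real.rpow_natCast]

/-- `∫ (1 + |w|)^{-(d+1)} dw`. -/
def weightMass (d : ℕ) : ℝ := ∫ w : E d, weight w

theorem weightMass_nonneg : 0 ≤ weightMass d := integral_nonneg weight_nonneg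

/-- Spending `d + 1` powers of decay leaves an integrable majorant that does not depend on the first
variable. -/
theorem RapidDecay.bound {a : E d × E d → G} (ha : RapidDecay a) (j N : ℕ) :
    ∃ C : ℝ, 0 ≤ C ∧ ∀ z, (1 + ‖z.2‖) ^ N * ‖iteratedFDeriv ℝ j a z‖ ≤ C * weight z.2 := by
  obtain ⟨C, hC⟩ := ha.decay j (N + (d + 1))
  refine ⟨C, le_trans (by positivity) (hC 0), fun z => ?_⟩
  rw [weight, ← div_eq_mul_inv, le_div_iff₀ (by positivity)]
  refine le_trans (le_of_eq ?_) (hC z)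
  ring

theorem RapidDecay.norm_le {a : E d × E d → G} (ha : RapidDecay a) :
    ∃ C : ℝ, 0 ≤ C ∧ ∀ z, ‖a z‖ ≤ C * weight z.2 := by
  simpa using ha.bound 0 0

theorem RapidDecay.integrable {a : E d × E d → G} (ha : RapidDecay a) (x : E d) :
    Integrable fun w => a (x, w) := by
  obtain ⟨C, -, hC⟩ := ha.norm_le
  refine (integrable_weight.const_mul C).mono'
    (ha.smooth.continuous.comp (by fun_prop)).aestronglyMeasurable
    (Filter.Eventually.of_forall fun w => hC (x, w))

end PartialFourier

/-! ### The partial Fourier transform and its derivative -/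

section PartialFourierTransform

variable {d : ℕ} {G : Type*} [NormedAddCommGroup G] [NormedSpace ℝ G] [NormedSpace ℂ G]

/-- The phase `e^{i w ξ}`. -/
def phase (w ξ : E d) : ℂ := Complex.exp (Complex.I * (inner ℝ w ξ : ℝ))

theorem norm_phase (w ξ : E d) : ‖phase w ξ‖ = 1 := by
  rw [phase, mul_comm, Complex.norm_exp_ofReal_mul_I]

theorem continuous_phase : Continuous fun p : E d × E d => phase p.1 p.2 := by
  unfold phase; fun_prop

/-- The partial (inverse, unnormalized) Fourier transform in the second variable. -/
def partialFourier (a : E d × E d → G) (z : E d × E d) : G := ∫ ξ, phase z.2 ξ • a (z.1, ξ)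

theorem RapidDecay.integrable_phase_smul {a : E d × E d → G} (ha : RapidDecay a) (x w : E d) :
    Integrable fun ξ => phase w ξ • a (x, ξ) :=
  (ha.integrable x).bdd_smul 1
    (continuous_phase.comp (by fun_prop : Continuous fun ξ => (w, ξ))).aestronglyMeasurable
    (Filter.Eventually.of_forall fun ξ => (norm_phase w ξ).le)

theorem RapidDecay.norm_partialFourier_le {a : E d × E d → G} (ha : RapidDecay a) :
    ∃ C : ℝ, ∀ z, ‖partialFourier a z‖ ≤ C := by
  obtain ⟨C, hC0, hC⟩ := ha.norm_le
  refine ⟨∫ ξ : E d, C * weight ξ, fun z => ?_⟩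
  refine norm_integral_le_of_norm_le (integrable_weight.const_mul C)
    (Filter.Eventually.of_forall fun ξ => ?_)
  rw [norm_smul, norm_phase, one_mul]
  exact hC (z.1, ξ)

variable [IsScalarTower ℝ ℂ G]

/-- The linear form `(h, k) ↦ ⟨k, ξ⟩`, as a linear function of `ξ`. -/
def sndPairing (d : ℕ) : E d →L[ℝ] (E d × E d →L[ℝ] ℝ) :=
  ((ContinuousLinearMap.compL ℝ (E d × E d) (E d) ℝ).flip
    (ContinuousLinearMap.snd ℝ (E d) (E d))).comp (innerSL ℝ : E d →L[ℝ] E d →L[ℝ] ℝ)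

theorem sndPairing_apply (ξ : E d) (v : E d × E d) : sndPairing d ξ v = inner ℝ ξ v.2 := rfl

/-- Multiplication by `i` as a real-linear map. -/
def mulI (G : Type*) [NormedAddCommGroup G] [NormedSpace ℝ G] [NormedSpace ℂ G]
    [IsScalarTower ℝ ℂ G] : G →L[ℝ] G := ContinuousLinearMap.lsmul ℝ ℂ Complex.I

theorem mulI_apply (g : G) : mulI G g = Complex.I • g := rfl

/-- The symbol of the derivative of a partial Fourier transform. -/
def partialFourierDeriv (a : E d × E d → G) (z : E d × E d) : E d × E d →L[ℝ] G :=
  (fderiv ℝ a z).comp ((ContinuousLinearMap.inl ℝ (E d) (E d)).comp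
    (ContinuousLinearMap.fst ℝ (E d) (E d))) +
    ContinuousLinearMap.smulRightL ℝ (E d × E d) G (sndPairing d z.2) (mulI G (a z))

/-- An `x`-derivative stays in the class, and differentiating the phase only multiplies by a linear
factor. The derivative of a partial Fourier transform is thus again one, which drives the inductions
on the order below. -/
theorem RapidDecay.partialFourierDeriv {a : E d × E d → G} (ha : RapidDecay a) :
    RapidDecay (partialFourierDeriv a) := by
  refine RapidDecay.add ?_ ?_
  · exact ha.fderiv.clm_comp ((ContinuousLinearMap.compL ℝ (E d × E d) (E d × E d) G).flip
      ((ContinuousLinearMap.inl ℝ (E d) (E d)).comp (ContinuousLinearMap.fst ℝ (E d) (E d))))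
  · exact (ha.clm_comp (mulI G)).bilin_linear (ContinuousLinearMap.smulRightL ℝ (E d × E d) G)
      (sndPairing d)

theorem hasFDerivAt_phase (w ξ : E d) (x : E d) :
    HasFDerivAt (fun z : E d × E d => phase z.2 ξ)
      ((phase w ξ * Complex.I) • (Complex.ofRealCLM.comp (sndPairing d ξ))) (x, w) := by
  have h1 : HasFDerivAt (fun z : E d × E d => (inner ℝ z.2 ξ : ℝ)) (sndPairing d ξ) (x, w) := by
    have := (sndPairing d ξ).hasFDerivAt (x := (x, w))
    refine this.congr_of_eventuallyEq (Filter.Eventually.of_forall fun z => ?_)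
    simp only [sndPairing_apply, real_inner_comm]
  have h2 := (Complex.ofRealCLM.hasFDerivAt.comp (x, w) h1).const_mul Complex.I |>.cexp
  refine h2.congr_fderiv ?_
  ext v <;> simp [phase, mul_assoc]

theorem hasFDerivAt_phase_smul {a : E d × E d → G} (ha : ContDiff ℝ ∞ a) (x w ξ : E d) :
    HasFDerivAt (fun z : E d × E d => phase z.2 ξ • a (z.1, ξ))
      (phase w ξ • partialFourierDeriv a (x, ξ)) (x, w) := by
  have h1 : HasFDerivAt (fun z : E d × E d => a (z.1, ξ))
      ((fderiv ℝ a (x, ξ)).comp ((ContinuousLinearMap.inl ℝ (E d) (E d)).comp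
        (ContinuousLinearMap.fst ℝ (E d) (E d)))) (x, w) := by
    refine HasFDerivAt.comp (f := fun z : E d × E d => (z.1, ξ)) (x, w)
      ((ha.differentiable (by simp)) (x, ξ)).hasFDerivAt ?_
    refine (hasFDerivAt_fst.prodMk (hasFDerivAt_const ξ _)).congr_fderiv ?_
    ext v <;> simp
  have h2 := (hasFDerivAt_phase w ξ x).smul h1
  refine h2.congr_fderiv (ContinuousLinearMap.ext fun v => ?_)
  have h3 : partialFourierDeriv a (x, ξ) v =
      fderiv ℝ a (x, ξ) (v.1, 0) + (inner ℝ ξ v.2 : ℝ) • (Complex.I • a (x, ξ)) := rfl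
  rw [smul_apply, h3]
  simp only [add_apply, smul_apply, smul_add,
    ContinuousLinearMap.comp_apply, ContinuousLinearMap.smulRight_apply, sndPairing_apply]
  have e1 : Complex.ofRealCLM (inner ℝ ξ v.2 : ℝ) = ((inner ℝ ξ v.2 : ℝ) : ℂ) := rfl
  rw [e1, smul_comm (inner ℝ ξ v.2 : ℝ) Complex.I, smul_eq_mul,
    RCLike.real_smul_eq_coe_smul (K := ℂ) (inner ℝ ξ v.2 : ℝ) (a (x, ξ)), smul_smul, smul_smul]
  rfl

theorem RapidDecay.hasFDerivAt_partialFourier {a : E d × E d → G} (ha : RapidDecay a)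
    (z : E d × E d) :
    HasFDerivAt (partialFourier a) (partialFourier (Paradiff.partialFourierDeriv a) z) z := by
  obtain ⟨C, hC0, hC⟩ := ha.partialFourierDeriv.norm_le
  have h1 : ∀ y : E d × E d, Integrable fun ξ => phase y.2 ξ • a (y.1, ξ) := fun y =>
    ha.integrable_phase_smul y.1 y.2
  have h2 : Integrable fun ξ => phase z.2 ξ • Paradiff.partialFourierDeriv a (z.1, ξ) :=
    ha.partialFourierDeriv.integrable_phase_smul z.1 z.2
  refine hasFDerivAt_integral_of_dominated_of_fderiv_le (s := Set.univ) (x₀ := z)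
    (𝕜 := ℝ) (F := fun (z : E d × E d) ξ => phase z.2 ξ • a (z.1, ξ))
    (F' := fun z ξ => phase z.2 ξ • Paradiff.partialFourierDeriv a (z.1, ξ))
    (bound := fun ξ => C * weight ξ) Filter.univ_mem
    (Filter.Eventually.of_forall fun y => (h1 y).aestronglyMeasurable) (h1 z)
    h2.aestronglyMeasurable
    (Filter.Eventually.of_forall fun ξ y _ => ?_) (integrable_weight.const_mul C)
    (Filter.Eventually.of_forall fun ξ y _ => ?_)
  · rw [norm_smul, norm_phase, one_mul]
    exact hC (y.1, ξ)
  · exact hasFDerivAt_phase_smul ha.smooth y.1 y.2 ξ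

end PartialFourierTransform

/-! ### The partial Fourier transform preserves rapid decay -/

section PartialFourierDecay

variable {d : ℕ} {G : Type*} [NormedAddCommGroup G] [NormedSpace ℝ G] [NormedSpace ℂ G]
  [IsScalarTower ℝ ℂ G]

/-- Each differentiation replaces the target `G` by linear maps into `G`, so `G` has to be
quantified inside the induction. -/
theorem RapidDecay.contDiff_partialFourier_nat (n : ℕ) :
    ∀ {G : Type _} [NormedAddCommGroup G] [NormedSpace ℝ G] [NormedSpace ℂ G] [IsScalarTower ℝ ℂ G]
      {a : E d × E d → G}, RapidDecay a → ContDiff ℝ n (partialFourier a) := by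
  induction n with
  | zero =>
    intro G _ _ _ _ a ha
    rw [Nat.cast_zero, contDiff_zero]
    exact continuous_iff_continuousAt.2 fun z => (ha.hasFDerivAt_partialFourier z).continuousAt
  | succ n ih =>
    intro G _ _ _ _ a ha
    rw [Nat.cast_succ, contDiff_succ_iff_hasFDerivAt]
    exact ⟨_, ih ha.partialFourierDeriv, ha.hasFDerivAt_partialFourier⟩

theorem RapidDecay.contDiff_partialFourier {a : E d × E d → G} (ha : RapidDecay a) :
    ContDiff ℝ ∞ (partialFourier a) :=
  contDiff_infty.2 fun n => RapidDecay.contDiff_partialFourier_nat n ha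

theorem hasFDerivAt_phase_right (w ξ : E d) :
    HasFDerivAt (phase w) ((phase w ξ * Complex.I) • (Complex.ofRealCLM.comp (innerSL ℝ w))) ξ := by
  have h1 : HasFDerivAt (fun ξ : E d => (inner ℝ w ξ : ℝ)) (innerSL ℝ w) ξ :=
    (innerSL ℝ w).hasFDerivAt
  have h2 := (Complex.ofRealCLM.hasFDerivAt.comp ξ h1).const_mul Complex.I |>.cexp
  refine h2.congr_fderiv ?_
  ext v
  simp [phase, mul_assoc]

/-- Integration by parts in ξ: differentiating the phase along `e` produces i⟨w, e⟩, and the two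
signs (from the parts and from i²) cancel. -/
theorem inner_smul_partialFourier {a : E d × E d → G} (ha : RapidDecay a)
    (e : E d) (z : E d × E d) : (inner ℝ z.2 e : ℝ) • partialFourier a z =
      partialFourier (fun y => mulI G (fderiv ℝ a y (0, e))) z := by
  obtain ⟨x, w⟩ := z
  have hd : ∀ ξ, HasFDerivAt (fun ξ => a (x, ξ))
      ((fderiv ℝ a (x, ξ)).comp (ContinuousLinearMap.inr ℝ (E d) (E d))) ξ := fun ξ =>
    HasFDerivAt.comp (f := fun ξ : E d => (x, ξ)) ξ
      (g := a) ((ha.smooth.differentiable (by simp)) (x, ξ)).hasFDerivAt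
      (hasFDerivAt_prodMk_right x ξ)
  have e1 : ∀ ξ, fderiv ℝ (fun ξ => a (x, ξ)) ξ e = fderiv ℝ a (x, ξ) (0, e) := fun ξ => by
    rw [(hd ξ).fderiv]; rfl
  have e2 : ∀ ξ, fderiv ℝ (phase w) ξ e • a (x, ξ) =
      (inner ℝ w e : ℝ) • mulI G (phase w ξ • a (x, ξ)) := fun ξ => by
    have : fderiv ℝ (phase w) ξ e = phase w ξ * Complex.I * ((inner ℝ w e : ℝ) : ℂ) := by
      rw [(hasFDerivAt_phase_right w ξ).fderiv]; rfl
    rw [this, mulI_apply, RCLike.real_smul_eq_coe_smul (K := ℂ), smul_smul, smul_smul]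
    congr 1
    change phase w ξ * Complex.I * ((inner ℝ w e : ℝ) : ℂ) =
      ((inner ℝ w e : ℝ) : ℂ) * Complex.I * phase w ξ
    ring
  have hI := ha.integrable_phase_smul x w
  have key := integral_smul_fderiv_eq_neg_fderiv_smul_of_integrable (μ := volume)
    (f := phase w) (g := fun ξ => a (x, ξ)) (v := e) ?_ ?_ hI
    (fun ξ _ => (hasFDerivAt_phase_right w ξ).differentiableAt)
    (fun ξ _ => (hd ξ).differentiableAt)
  · simp_rw [e1, e2, mulI_apply] at key
    rw [integral_smul, integral_smul] at key
    have e3 : partialFourier (fun y => mulI G (fderiv ℝ a y (0, e))) (x, w) =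
        Complex.I • ∫ ξ, phase w ξ • fderiv ℝ a (x, ξ) (0, e) := by
      rw [← integral_smul]
      exact integral_congr_ae (Filter.Eventually.of_forall fun ξ => smul_comm _ _ _)
    rw [e3, key, smul_neg, smul_comm Complex.I (inner ℝ w e : ℝ), smul_smul, Complex.I_mul_I,
      neg_one_smul, smul_neg, neg_neg]
    rfl
  · simp_rw [e2]
    exact ((mulI G).integrable_comp hI).smul (inner ℝ w e : ℝ)
  · simp_rw [e1]
    exact (ha.fderiv_apply (0, e)).integrable_phase_smul x w

/-- The symbol `b` is (1 - Δ_ξ)a, obtained by using the previous identity twice in every coordinate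
direction. Iterating gives decay of arbitrary order. -/
theorem exists_rapidDecay_one_add_sq {a : E d × E d → G} (ha : RapidDecay a) :
    ∃ b : E d × E d → G, RapidDecay b ∧
      ∀ z, (1 + ‖z.2‖ ^ 2) • partialFourier a z = partialFourier b z := by
  let D : Fin d → (E d × E d → G) → E d × E d → G := fun i a y =>
    mulI G (fderiv ℝ a y (0, EuclideanSpace.single i 1))
  have hD : ∀ i {a : E d × E d → G}, RapidDecay a → RapidDecay (D i a) := fun i a ha =>
    (ha.fderiv_apply _).clm_comp (mulI G)
  have hS : RapidDecay fun z => ∑ i, D i (D i a) z := RapidDecay.sum _ fun i _ => hD i (hD i ha)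
  refine ⟨fun z => a z + ∑ i, D i (D i a) z, ha.add hS, fun z => ?_⟩
  have h1 : partialFourier (fun z => a z + ∑ i, D i (D i a) z) z =
      partialFourier a z + ∑ i, partialFourier (D i (D i a)) z := by
    simp only [partialFourier, smul_add, Finset.smul_sum]
    rw [integral_add (ha.integrable_phase_smul z.1 z.2), integral_finsetSum]
    · exact fun i _ => (hD i (hD i ha)).integrable_phase_smul z.1 z.2
    · exact integrable_finsetSum _ fun i _ => (hD i (hD i ha)).integrable_phase_smul z.1 z.2
  rw [h1, add_smul, one_smul]
  congr 1
  rw [EuclideanSpace.norm_sq_eq, Finset.sum_smul]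
  refine Finset.sum_congr rfl fun i _ => ?_
  rw [← inner_smul_partialFourier (hD i ha), ← inner_smul_partialFourier ha, smul_smul]
  congr 1
  simp [EuclideanSpace.inner_single_right, sq]

theorem RapidDecay.partialFourier_decay_zero (M : ℕ) :
    ∀ {a : E d × E d → G}, RapidDecay a →
      ∃ C : ℝ, ∀ z, (1 + ‖z.2‖ ^ 2) ^ M * ‖partialFourier a z‖ ≤ C := by
  induction M with
  | zero => intro a ha; simpa using ha.norm_partialFourier_le
  | succ M ih =>
    intro a ha
    obtain ⟨b, hb, hab⟩ := exists_rapidDecay_one_add_sq ha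
    obtain ⟨C, hC⟩ := ih hb
    refine ⟨C, fun z => ?_⟩
    have := hC z
    rw [← hab, norm_smul, Real.norm_of_nonneg (by positivity)] at this
    rwa [pow_succ, mul_assoc]

theorem RapidDecay.partialFourier_decay (j N : ℕ) :
    ∀ {G : Type _} [NormedAddCommGroup G] [NormedSpace ℝ G] [NormedSpace ℂ G] [IsScalarTower ℝ ℂ G]
      {a : E d × E d → G}, RapidDecay a →
      ∃ C : ℝ, ∀ z, (1 + ‖z.2‖) ^ N * ‖iteratedFDeriv ℝ j (partialFourier a) z‖ ≤ C := by
  induction j with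
  | zero =>
    intro G _ _ _ _ a ha
    obtain ⟨C, hC⟩ := RapidDecay.partialFourier_decay_zero N ha
    refine ⟨2 ^ N * C, fun z => ?_⟩
    rw [norm_iteratedFDeriv_zero]
    calc _ ≤ (2 * (1 + ‖z.2‖ ^ 2)) ^ N * ‖partialFourier a z‖ := by
          gcongr
          nlinarith [sq_nonneg (‖z.2‖ - 1), sq_nonneg ‖z.2‖]
      _ = 2 ^ N * ((1 + ‖z.2‖ ^ 2) ^ N * ‖partialFourier a z‖) := by rw [mul_pow, mul_assoc]
      _ ≤ _ := by gcongr; exact hC z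
  | succ j ih =>
    intro G _ _ _ _ a ha
    obtain ⟨C, hC⟩ := ih ha.partialFourierDeriv
    refine ⟨C, fun z => ?_⟩
    have : _root_.fderiv ℝ (partialFourier a) = partialFourier (Paradiff.partialFourierDeriv a) :=
      funext fun z => (ha.hasFDerivAt_partialFourier z).fderiv
    rw [← norm_iteratedFDeriv_fderiv, this]
    exact hC z

theorem RapidDecay.partialFourier {a : E d × E d → G} (ha : RapidDecay a) :
    RapidDecay (partialFourier a) :=
  ⟨ha.contDiff_partialFourier, fun j N => RapidDecay.partialFourier_decay j N ha⟩

end PartialFourierDecay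

/-! ### Operators with rescaled rapidly decaying kernels -/

section KernelOperators

variable {d : ℕ} {G : Type*} [NormedAddCommGroup G] [NormedSpace ℝ G]

theorem integral_sub_smul (g : E d → G) (x : E d) {ε : ℝ} (hε : 0 < ε) :
    ∫ w, g (x - ε • w) = (ε ^ d)⁻¹ • ∫ y, g y := by
  have h := Measure.integral_comp_smul (volume : Measure (E d)) (fun w => g (x - w)) ε
  rw [h, integral_sub_left_eq_self g volume x, finrank_euclideanSpace_fin,
    abs_of_nonneg (by positivity)]

variable [NormedSpace ℂ G] [IsScalarTower ℝ ℂ G]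

/-- The operator `f ↦ ∫ κ(εx, w) f(x - εw) dw`. -/
def kernelOp (κ : E d × E d → ℂ) (ε : ℝ) (f : E d → G) (x : E d) : G :=
  ∫ w, κ (ε • x, w) • f (x - ε • w)

/-- In this form `x` enters only through the kernel, so the operator can be differentiated when `f`
is merely continuous. -/
theorem kernelOp_eq (κ : E d × E d → ℂ) {ε : ℝ} (hε : 0 < ε) (f : E d → G) (x : E d) :
    kernelOp κ ε f x = ∫ y, κ (ε • x, ε⁻¹ • (x - y)) • (ε ^ d)⁻¹ • f y := by
  have h := integral_sub_smul (fun y => κ (ε • x, ε⁻¹ • (x - y)) • f y) x hε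
  simp only [sub_sub_cancel, smul_smul, inv_mul_cancel₀ hε.ne', one_smul] at h
  rw [kernelOp, h, ← integral_smul]
  exact integral_congr_ae (Filter.Eventually.of_forall fun y => smul_comm _ _ _)

/-- The kernel `κ(x, w) = (2π)^{-d} ∫ e^{iwξ} a(x, ξ) dξ` of a symbol. -/
def kernel (a : E d × E d → ℂ) (z : E d × E d) : ℂ :=
  ((2 * Real.pi : ℂ) ^ d)⁻¹ * partialFourier a z

theorem RapidDecay.kernel {a : E d × E d → ℂ} (ha : RapidDecay a) : RapidDecay (kernel a) :=
  ha.partialFourier.clm_comp (ContinuousLinearMap.mul ℝ ℂ ((2 * Real.pi : ℂ) ^ d)⁻¹)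

/-- The substitution η = εξ. It covers both families in the theorem: Φ_k(x,D) with ε = 2^{-k} and
the multiplier ψ₀(2^{-kδ}D) with ε = 2^{-kδ}. -/
theorem pseudoDiff_eq_kernelOp (a : E d × E d → ℂ) {ε : ℝ} (hε : 0 < ε) (f : E d → ℂ) (x : E d) :
    pseudoDiff (fun x ξ => a (ε • x, ε • ξ)) f x = kernelOp (kernel a) ε f x := by
  rw [kernelOp_eq _ hε, pseudoDiff, ← integral_const_mul]
  refine integral_congr_ae (Filter.Eventually.of_forall fun y => ?_)
  have h := Measure.integral_comp_smul (volume : Measure (E d))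
    (fun η => phase (ε⁻¹ • (x - y)) η * a (ε • x, η)) ε
  rw [finrank_euclideanSpace_fin, abs_of_nonneg (by positivity)] at h
  have h2 : ∀ ξ, phase (ε⁻¹ • (x - y)) (ε • ξ) =
      Complex.exp (Complex.I * (inner ℝ (x - y) ξ : ℝ)) := fun ξ => by
    rw [phase, inner_smul_left, inner_smul_right]
    congr 3
    simp [← mul_assoc, inv_mul_cancel₀ hε.ne']
  simp_rw [h2] at h
  simp only [h, kernel, partialFourier, smul_eq_mul, Complex.real_smul]
  ring

/-- Bounded functions all of whose derivatives are bounded. -/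
structure SmoothBounded (f : E d → G) : Prop where
  smooth : ContDiff ℝ ∞ f
  bounded : ∀ j : ℕ, ∃ C : ℝ, ∀ x, ‖iteratedFDeriv ℝ j f x‖ ≤ C

theorem weight_smul_le {ε : ℝ} (hε : 0 < ε) (hε1 : ε ≤ 1) (w : E d) :
    weight (ε⁻¹ • w) ≤ weight w := by
  unfold weight
  rw [norm_smul, Real.norm_of_nonneg (by positivity)]
  gcongr
  exact le_mul_of_one_le_left (norm_nonneg _) ((one_le_inv₀ hε).2 hε1)

theorem weight_le_of_near {x x₀ : E d} (h : ‖x - x₀‖ ≤ 1) (y : E d) :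
    weight (x - y) ≤ 2 ^ (d + 1) * weight (x₀ - y) := by
  unfold weight
  rw [← div_eq_mul_inv, le_div_iff₀ (by positivity), inv_mul_le_iff₀ (by positivity), ← mul_pow]
  gcongr
  have : ‖x₀ - y‖ ≤ ‖x - y‖ + ‖x - x₀‖ := by
    have := norm_sub_le (x - y) (x - x₀)
    rwa [sub_sub_sub_cancel_left] at this
  nlinarith [norm_nonneg (x - y)]

/-- All derivatives fall on the kernel, composed with the affine map x ↦ (εx, ε⁻¹(x - y)) whose
linear part has norm at most ε⁻¹. The bound is then rewritten in w = ε⁻¹(x - y), so that growth of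
`f` around `x` can still be exploited. -/
theorem RapidDecay.kernelOp_rough {κ : E d × E d → ℂ} (hκ : RapidDecay κ) {ε : ℝ} (hε : 0 < ε)
    (hε1 : ε ≤ 1) {f : E d → G} (hf : Continuous f) {B : ℝ} (hB : ∀ x, ‖f x‖ ≤ B) :
    ContDiff ℝ ∞ (kernelOp κ ε f) ∧ ∀ j x, ‖iteratedFDeriv ℝ j (kernelOp κ ε f) x‖ ≤
      ∫ w, ‖f (x - ε • w)‖ * ((ε ^ j)⁻¹ * ‖iteratedFDeriv ℝ j κ (ε • x, w)‖) := by
  have hB0 : 0 ≤ B := (norm_nonneg _).trans (hB 0)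
  let A : E d →L[ℝ] E d × E d :=
    (ε • ContinuousLinearMap.id ℝ (E d)).prod (ε⁻¹ • ContinuousLinearMap.id ℝ (E d))
  have hA : ∀ x y, A x + (0, -(ε⁻¹ • y)) = (ε • x, ε⁻¹ • (x - y)) := fun x y => by
    simp [A, sub_eq_add_neg]
  have hAn : ‖A‖ ≤ ε⁻¹ := by
    have h1 : 1 ≤ ε⁻¹ := (one_le_inv₀ hε).2 hε1
    refine A.opNorm_le_bound (by positivity) fun x => ?_
    change max ‖ε • x‖ ‖ε⁻¹ • x‖ ≤ _
    rw [norm_smul, norm_smul, Real.norm_of_nonneg hε.le, Real.norm_of_nonneg (by positivity)]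
    exact max_le (by gcongr; linarith) le_rfl
  let L : G →L[ℝ] ℂ →L[ℝ] G := (ContinuousLinearMap.lsmul ℝ ℂ : ℂ →L[ℝ] G →L[ℝ] G).flip
  have hLn : ∀ g : G, ‖L g‖ ≤ ‖g‖ := fun g =>
    (L g).opNorm_le_bound (norm_nonneg _) fun c => by
      change ‖c • g‖ ≤ _
      rw [norm_smul, mul_comm]
  let k : E d → E d → G := fun x y => κ (ε • x, ε⁻¹ • (x - y)) • (ε ^ d)⁻¹ • f y
  have hk : ∀ y, (fun x => k x y) =
      L ((ε ^ d)⁻¹ • f y) ∘ fun x => κ (A x + (0, -(ε⁻¹ • y))) := fun y => by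
    ext x; simp only [hA]; rfl
  have hκA : ∀ y, ContDiff ℝ ∞ fun x => κ (A x + (0, -(ε⁻¹ • y))) := fun y =>
    hκ.smooth.comp (A.contDiff.add contDiff_const)
  have hder : ∀ j x y, iteratedFDeriv ℝ j (fun x => k x y) x =
      (L ((ε ^ d)⁻¹ • f y)).compContinuousMultilinearMap
        ((iteratedFDeriv ℝ j κ (ε • x, ε⁻¹ • (x - y))).compContinuousLinearMap fun _ => A) := by
    intro j x y
    rw [hk, ContinuousLinearMap.iteratedFDeriv_comp_left _ (hκA y).contDiffAt (natCast_le_infty j),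
      iteratedFDeriv_comp_affine hκ.smooth, hA]
  have hnorm : ∀ j x y, ‖iteratedFDeriv ℝ j (fun x => k x y) x‖ ≤ (ε ^ d)⁻¹ * (‖f y‖ *
      ((ε ^ j)⁻¹ * ‖iteratedFDeriv ℝ j κ (ε • x, ε⁻¹ • (x - y))‖)) := by
    intro j x y
    rw [hder]
    refine (ContinuousLinearMap.norm_compContinuousMultilinearMap_le _ _).trans ?_
    rw [← mul_assoc]
    have h1 : ‖L ((ε ^ d)⁻¹ • f y)‖ ≤ (ε ^ d)⁻¹ * ‖f y‖ := (hLn _).trans_eq (by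
      rw [norm_smul, Real.norm_of_nonneg (by positivity)])
    refine mul_le_mul h1 ?_ (norm_nonneg _) (by positivity)
    refine (ContinuousMultilinearMap.norm_compContinuousLinearMap_le _ _).trans ?_
    rw [mul_comm, Finset.prod_const, Finset.card_univ, Fintype.card_fin, ← inv_pow]
    gcongr
  have key := contDiff_integral_of_dominated (μ := volume) (f := k) ?_ ?_ ?_
  · have hop : kernelOp κ ε f = fun x => ∫ y, k x y := funext fun x => kernelOp_eq κ hε f x
    rw [hop]
    refine ⟨key.1, fun j x => ?_⟩
    rw [key.2]
    have h2 := integral_sub_smul (fun y => ‖f y‖ *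
      ((ε ^ j)⁻¹ * ‖iteratedFDeriv ℝ j κ (ε • x, ε⁻¹ • (x - y))‖)) x hε
    simp only [sub_sub_cancel, smul_smul, inv_mul_cancel₀ hε.ne', one_smul] at h2
    rw [h2, smul_eq_mul, ← integral_const_mul]
    refine norm_integral_le_of_norm_le ?_ (Filter.Eventually.of_forall (hnorm j x))
    obtain ⟨C, hC0, hC⟩ := hκ.bound j 0
    refine ((integrable_weight.comp_sub_left x).const_mul
      ((ε ^ d)⁻¹ * (B * ((ε ^ j)⁻¹ * C)))).mono' ?_ (Filter.Eventually.of_forall fun y => ?_)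
    · refine Continuous.aestronglyMeasurable ?_
      have := hκ.smooth.continuous_iteratedFDeriv (natCast_le_infty j)
      fun_prop
    · rw [Real.norm_of_nonneg (by positivity)]
      have h3 := hC (ε • x, ε⁻¹ • (x - y))
      rw [pow_zero, one_mul] at h3
      have h4 := weight_smul_le hε hε1 (x - y)
      calc _ ≤ (ε ^ d)⁻¹ * (B * ((ε ^ j)⁻¹ * (C * weight (x - y)))) := by
            gcongr
            · exact hB y
            · exact h3.trans (by gcongr)
        _ = _ := by ring
  · exact fun y => by
      rw [hk]
      exact (L _).contDiff.comp (hκA y)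
  · intro j x
    refine Continuous.aestronglyMeasurable ?_
    simp_rw [hder]
    have h1 : Continuous fun y : E d => L ((ε ^ d)⁻¹ • f y) :=
      L.continuous.comp (hf.const_smul _)
    have h2 : Continuous fun y : E d => (iteratedFDeriv ℝ j κ
        (ε • x, ε⁻¹ • (x - y))).compContinuousLinearMap fun _ => A :=
      (ContinuousMultilinearMap.compContinuousLinearMapL fun _ : Fin j => A).continuous.comp
        ((hκ.smooth.continuous_iteratedFDeriv (natCast_le_infty j)).comp (by fun_prop))
    exact ((ContinuousLinearMap.compContinuousMultilinearMapL ℝ (fun _ : Fin j => E d) ℂ G).continuous.comp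
      h1).clm_apply h2
  -- The majorant must serve all `x` near `x₀`; on the unit ball around `x₀` the weight changes by a
  -- factor at most 2^{d+1}.
  · intro j x₀
    obtain ⟨C, hC0, hC⟩ := hκ.bound j 0
    refine ⟨fun y => (ε ^ d)⁻¹ * (B * ((ε ^ j)⁻¹ * (C * (2 ^ (d + 1) * weight (x₀ - y))))), ?_,
      Metric.closedBall x₀ 1, Metric.closedBall_mem_nhds _ one_pos,
      Filter.Eventually.of_forall fun y x hx => (hnorm j x y).trans ?_⟩
    · exact (((((integrable_weight.comp_sub_left x₀).const_mul _).const_mul _).const_mul _).const_mul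
        _).const_mul _
    · have h3 := hC (ε • x, ε⁻¹ • (x - y))
      rw [pow_zero, one_mul] at h3
      rw [mem_closedBall_iff_norm] at hx
      have h4 := (weight_smul_le hε hε1 (x - y)).trans (weight_le_of_near hx y)
      beta_reduce
      gcongr
      · exact hB y
      · exact h3.trans (by gcongr)

end KernelOperators

/-! ### Derivative bounds for kernel operators -/

section KernelOperatorBounds

variable {d : ℕ} {G : Type*} [NormedAddCommGroup G] [NormedSpace ℝ G]
  [NormedSpace ℂ G] [IsScalarTower ℝ ℂ G]

/-- A derivative of order `j` costs `ε^{-j}`, if it falls on the kernel. -/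
theorem RapidDecay.norm_iteratedFDeriv_kernelOp_le_rough {κ : E d × E d → ℂ} (hκ : RapidDecay κ)
    (j : ℕ) : ∃ C : ℝ, 0 ≤ C ∧ ∀ {ε : ℝ}, 0 < ε → ε ≤ 1 → ∀ {f : E d → G}, Continuous f →
      (∃ B : ℝ, ∀ x, ‖f x‖ ≤ B) → ∀ (x : E d) (M : ℝ), (∀ w, ‖f (x - ε • w)‖ ≤ M * (1 + ‖w‖)) →
      ‖iteratedFDeriv ℝ j (kernelOp κ ε f) x‖ ≤ C * ((ε ^ j)⁻¹ * M) := by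
  -- One extra power of decay absorbs the permitted growth 1 + |w| of `f`.
  obtain ⟨C, hC0, hC⟩ := hκ.bound j 1
  refine ⟨C * weightMass d, mul_nonneg hC0 weightMass_nonneg, ?_⟩
  rintro ε hε hε1 f hf ⟨B, hB⟩ x M hM
  have hM0 : 0 ≤ M := by simpa using (norm_nonneg _).trans (hM 0)
  refine ((hκ.kernelOp_rough hε hε1 hf hB).2 j x).trans ?_
  have : C * weightMass d * ((ε ^ j)⁻¹ * M) = ∫ w : E d, C * ((ε ^ j)⁻¹ * M) * weight w := by
    rw [integral_const_mul, weightMass]; ring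
  rw [this]
  refine integral_mono_of_nonneg (Filter.Eventually.of_forall fun w => by positivity)
    (integrable_weight.const_mul _) (Filter.Eventually.of_forall fun w => ?_)
  beta_reduce
  have h1 := hC (ε • x, w)
  rw [pow_one] at h1
  calc _ ≤ M * (1 + ‖w‖) * ((ε ^ j)⁻¹ * ‖iteratedFDeriv ℝ j κ (ε • x, w)‖) := by
        gcongr; exact hM w
    _ = (ε ^ j)⁻¹ * M * ((1 + ‖w‖) * ‖iteratedFDeriv ℝ j κ (ε • x, w)‖) := by ring
    _ ≤ (ε ^ j)⁻¹ * M * (C * weight w) := by gcongr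
    _ = _ := by ring

theorem RapidDecay.norm_iteratedFDeriv_kernelOp_le_sup {κ : E d × E d → ℂ} (hκ : RapidDecay κ)
    (j : ℕ) : ∃ C : ℝ, 0 ≤ C ∧ ∀ {ε : ℝ}, 0 < ε → ε ≤ 1 → ∀ {f : E d → G}, Continuous f →
      ∀ M : ℝ, (∀ x, ‖f x‖ ≤ M) → ∀ x,
      ‖iteratedFDeriv ℝ j (kernelOp κ ε f) x‖ ≤ C * ((ε ^ j)⁻¹ * M) := by
  obtain ⟨C, hC0, hC⟩ := hκ.norm_iteratedFDeriv_kernelOp_le_rough (G := G) j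
  refine ⟨C, hC0, fun {ε} hε hε1 f hf M hM x => hC hε hε1 hf ⟨M, hM⟩ x M fun w => ?_⟩
  have := hM (x - ε • w)
  exact this.trans (le_mul_of_one_le_right ((norm_nonneg _).trans this) (by simp))

theorem iteratedFDeriv_affine_smul_id {κ : E d × E d → ℂ} (hκ : ContDiff ℝ ∞ κ) {ε : ℝ}
    (hε : 0 < ε) (hε1 : ε ≤ 1) (w : E d) (j : ℕ) (x : E d) :
    ‖iteratedFDeriv ℝ j (fun x => κ (ε • x, w)) x‖ ≤ ‖iteratedFDeriv ℝ j κ (ε • x, w)‖ := by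
  let A : E d →L[ℝ] E d × E d := (ε • ContinuousLinearMap.id ℝ (E d)).prod 0
  have hA : ∀ x, A x + (0, w) = (ε • x, w) := fun x => by simp [A]
  have hAn : ‖A‖ ≤ 1 := by
    refine A.opNorm_le_bound zero_le_one fun x => ?_
    change max ‖ε • x‖ ‖(0 : E d)‖ ≤ _
    rw [norm_smul, norm_zero, Real.norm_of_nonneg hε.le]
    exact max_le (by gcongr) (by positivity)
  have := norm_iteratedFDeriv_comp_affine_le hκ A (0, w) j x
  simp only [hA] at this
  exact this.trans (mul_le_of_le_one_left (norm_nonneg _) (pow_le_one₀ (norm_nonneg _) hAn))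

/-- Derivatives falling on a smooth bounded function. -/
theorem RapidDecay.norm_iteratedFDeriv_kernelOp_le_smooth {κ : E d × E d → ℂ} (hκ : RapidDecay κ)
    (j : ℕ) : ∃ C : ℝ, 0 ≤ C ∧ ∀ {ε : ℝ}, 0 < ε → ε ≤ 1 → ∀ {f : E d → G}, SmoothBounded f →
      ∀ M : ℝ, (∀ i ≤ j, ∀ x, ‖iteratedFDeriv ℝ i f x‖ ≤ M) → ∀ x,
      ‖iteratedFDeriv ℝ j (kernelOp κ ε f) x‖ ≤ C * M := by
  choose C hC0 hC using fun i => hκ.bound i 0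
  simp only [pow_zero, one_mul] at hC
  refine ⟨(∑ i ∈ Finset.range (j + 1), (j.choose i : ℝ) * C i) * weightMass d,
    mul_nonneg (Finset.sum_nonneg fun i _ => mul_nonneg (by positivity) (hC0 i)) weightMass_nonneg,
    ?_⟩
  intro ε hε hε1 f hf M hM x
  choose B hB using hf.bounded
  let k : E d → E d → G := fun x w => κ (ε • x, w) • f (x - ε • w)
  have hκ1 : ∀ w, ContDiff ℝ ∞ fun x => κ (ε • x, w) := fun w => hκ.smooth.comp (by fun_prop)
  have hf1 : ∀ w, ContDiff ℝ ∞ fun x => f (x - ε • w) := fun w => hf.smooth.comp (by fun_prop)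
  have hk : ContDiff ℝ ∞ (Function.uncurry k) := by
    refine ContDiff.smul (f := fun p : E d × E d => κ (ε • p.1, p.2))
      (g := fun p : E d × E d => f (p.1 - ε • p.2)) ?_ ?_
    · exact hκ.smooth.comp (by fun_prop)
    · exact hf.smooth.comp (by fun_prop)
  have hbd : ∀ (j : ℕ) (M : ℝ) (x : E d), (∀ i ≤ j, ∀ x, ‖iteratedFDeriv ℝ i f x‖ ≤ M) → ∀ w,
      ‖iteratedFDeriv ℝ j (fun x => k x w) x‖ ≤
        (∑ i ∈ Finset.range (j + 1), (j.choose i : ℝ) * C i) * M * weight w := by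
    intro j M x hM w
    refine (norm_iteratedFDeriv_smul_le (hκ1 w) (hf1 w) x (natCast_le_infty j)).trans ?_
    rw [Finset.sum_mul, Finset.sum_mul]
    refine Finset.sum_le_sum fun i _ => ?_
    rw [iteratedFDeriv_comp_sub]
    have h1 := (iteratedFDeriv_affine_smul_id hκ.smooth hε hε1 w i x).trans (hC i (ε • x, w))
    calc _ ≤ (j.choose i : ℝ) * (C i * weight w) * M := by
          have h0 : 0 ≤ C i * weight w := mul_nonneg (hC0 i) (weight_nonneg w)
          gcongr
          exact hM _ (Nat.sub_le _ _) _
      _ = _ := by ring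
  have key := contDiff_integral_of_dominated (μ := volume) (f := k)
    (fun w => (hκ1 w).smul (hf1 w))
    (fun j x => (continuous_iteratedFDeriv_param hk j x).aestronglyMeasurable)
    (fun j x₀ => ⟨_, integrable_weight.const_mul ((∑ i ∈ Finset.range (j + 1),
      (j.choose i : ℝ) * C i) * ∑ i ∈ Finset.range (j + 1), B i), Set.univ, Filter.univ_mem,
      Filter.Eventually.of_forall fun w x _ => hbd j _ x (fun i hi y => (hB i y).trans
        (Finset.single_le_sum (f := B) (fun i _ => (norm_nonneg _).trans (hB i 0))
          (Finset.mem_range_succ_iff.2 hi))) w⟩)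
  have hop : kernelOp κ ε f = fun x => ∫ w, k x w := rfl
  rw [hop, key.2]
  refine (norm_integral_le_of_norm_le (integrable_weight.const_mul _)
    (Filter.Eventually.of_forall (hbd j M x hM))).trans_eq ?_
  rw [integral_const_mul, weightMass]
  ring

theorem SmoothBounded.kernelOp {κ : E d × E d → ℂ} (hκ : RapidDecay κ) {ε : ℝ} (hε : 0 < ε)
    (hε1 : ε ≤ 1) {f : E d → G} (hf : Continuous f) {B : ℝ} (hB : ∀ x, ‖f x‖ ≤ B) :
    SmoothBounded (kernelOp κ ε f) := by
  refine ⟨(hκ.kernelOp_rough hε hε1 hf hB).1, fun j => ?_⟩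
  obtain ⟨C, -, hC⟩ := hκ.norm_iteratedFDeriv_kernelOp_le_sup (G := G) j
  exact ⟨_, hC hε hε1 hf B hB⟩

theorem RapidDecay.integrable_kernelOp {κ : E d × E d → ℂ} (hκ : RapidDecay κ) (ε : ℝ)
    {H : Type*} [NormedAddCommGroup H] [NormedSpace ℂ H] {f : E d → H} (hf : Continuous f) {B : ℝ} (hB : ∀ x, ‖f x‖ ≤ B) (x : E d) :
    Integrable fun w => κ (ε • x, w) • f (x - ε • w) := by
  have h := (hκ.integrable (ε • x)).norm.mul_const B
  refine h.mono' ?_ (Filter.Eventually.of_forall fun w => ?_)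
  · have := hκ.smooth.continuous
    exact Continuous.aestronglyMeasurable (by fun_prop)
  · rw [norm_smul]
    gcongr
    exact hB _

theorem RapidDecay.kernelOp_add {κ : E d × E d → ℂ} (hκ : RapidDecay κ) (ε : ℝ)
    {H : Type*} [NormedAddCommGroup H] [NormedSpace ℝ H] [NormedSpace ℂ H] {f g : E d → H}
    (hf : Continuous f) {B : ℝ} (hB : ∀ x, ‖f x‖ ≤ B) (hg : Continuous g) {B' : ℝ}
    (hB' : ∀ x, ‖g x‖ ≤ B') : Paradiff.kernelOp κ ε (fun x => f x + g x) =
      fun x => Paradiff.kernelOp κ ε f x + Paradiff.kernelOp κ ε g x := by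
  ext1 x
  simp only [Paradiff.kernelOp, smul_add]
  exact integral_add (hκ.integrable_kernelOp ε hf hB x) (hκ.integrable_kernelOp ε hg hB' x)

/-- Kernels which do not depend on the base point: those of Fourier multipliers. -/
def TranslationInvariant (κ : E d × E d → ℂ) : Prop := ∀ x w, κ (x, w) = κ (0, w)

/-- Without dependence on the base point only `f` is differentiated: Fourier multipliers commute
with derivatives. -/
theorem RapidDecay.hasFDerivAt_kernelOp {κ : E d × E d → ℂ} (hκ : RapidDecay κ)
    (hinv : TranslationInvariant κ) (ε : ℝ) {f : E d → G} (hf : ContDiff ℝ 1 f) {B B' : ℝ}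
    (hB : ∀ x, ‖f x‖ ≤ B) (hB' : ∀ x, ‖_root_.fderiv ℝ f x‖ ≤ B') (x : E d) :
    HasFDerivAt (Paradiff.kernelOp κ ε f) (Paradiff.kernelOp κ ε (_root_.fderiv ℝ f) x) x := by
  have h1 := fun y => hκ.integrable_kernelOp ε hf.continuous hB y
  have h2 := hκ.integrable_kernelOp ε (hf.continuous_fderiv (by simp)) hB' x
  refine hasFDerivAt_integral_of_dominated_of_fderiv_le (s := Set.univ) (x₀ := x)
    (𝕜 := ℝ) (F := fun x w => κ (ε • x, w) • f (x - ε • w))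
    (F' := fun x w => κ (ε • x, w) • _root_.fderiv ℝ f (x - ε • w))
    (bound := fun w => ‖κ (0, w)‖ * B') Filter.univ_mem
    (Filter.Eventually.of_forall fun y => (h1 y).aestronglyMeasurable) (h1 x)
    h2.aestronglyMeasurable
    (Filter.Eventually.of_forall fun w y _ => ?_) ((hκ.integrable 0).norm.mul_const B')
    (Filter.Eventually.of_forall fun w y _ => ?_)
  · rw [norm_smul, hinv]
    gcongr
    exact hB' _
  · simp only [hinv (ε • _) w]
    have h3 := (hf.differentiable (by simp) (y - ε • w)).hasFDerivAt
    rw [← hasFDerivAt_comp_sub] at h3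
    exact h3.const_smul (κ (0, w))

theorem RapidDecay.fderiv_kernelOp {κ : E d × E d → ℂ} (hκ : RapidDecay κ)
    (hinv : TranslationInvariant κ) (ε : ℝ) {f : E d → G} (hf : ContDiff ℝ 1 f) {B B' : ℝ}
    (hB : ∀ x, ‖f x‖ ≤ B) (hB' : ∀ x, ‖_root_.fderiv ℝ f x‖ ≤ B') :
    _root_.fderiv ℝ (Paradiff.kernelOp κ ε f) = Paradiff.kernelOp κ ε (_root_.fderiv ℝ f) :=
  funext fun x => (hκ.hasFDerivAt_kernelOp hinv ε hf hB hB' x).fderiv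

end KernelOperatorBounds

/-! ### Moments of the kernel of a multiplier equal to one near the origin -/

section Moments

variable {d : ℕ}

/-- The `x`-independent symbol `p(ξ)`. -/
def multiplierSymbol (p : E d → ℂ) (z : E d × E d) : ℂ := p z.2

theorem partialFourier_multiplierSymbol (p : E d → ℂ) (v : E d) :
    partialFourier (multiplierSymbol p) (0, (2 * Real.pi) • v) = 𝓕⁻ p v := by
  rw [Real.fourierInv_eq']
  refine integral_congr_ae (Filter.Eventually.of_forall fun ξ => ?_)
  simp only [phase, multiplierSymbol]
  congr 2
  rw [inner_smul_left, real_inner_comm]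
  simp
  ring

/-- Fourier inversion, after the dilation by 2π that reconciles the phase e^{iwξ} with the
convention of `𝓕`; the Jacobian (2π)^d is the normalization of `kernel`. It makes the values of `p`
near 0 readable from the kernel. -/
theorem fourier_inversion_kernel {p : E d → ℂ} (hp : RapidDecay (multiplierSymbol p)) (ξ : E d) :
    partialFourier (kernel (multiplierSymbol p)) (0, -ξ) = p ξ := by
  have hpi : (0 : ℝ) < 2 * Real.pi := by positivity
  have hint : Integrable p := hp.integrable 0
  have hc : Continuous p := hp.smooth.continuous.comp (by fun_prop : Continuous fun ξ : E d => ((0 : E d), ξ))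
  have h1 : Integrable (𝓕 p) := by
    have h2 : Integrable fun v => partialFourier (multiplierSymbol p) (0, (2 * Real.pi) • v) :=
      (hp.partialFourier.integrable 0).comp_smul hpi.ne'
    refine h2.comp_neg.congr (Filter.Eventually.of_forall fun v => ?_)
    simp only [partialFourier_multiplierSymbol, Real.fourierInv_eq_fourier_neg, neg_neg]
  have h3 := congrFun (hc.fourier_fourierInv_eq hint h1) ξ
  rw [← h3, Real.fourier_eq']
  have h4 := Measure.integral_comp_smul (volume : Measure (E d)) (fun w =>
    phase (-ξ) w • partialFourier (multiplierSymbol p) (0, w)) (2 * Real.pi)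
  rw [finrank_euclideanSpace_fin, abs_of_nonneg (by positivity)] at h4
  have h5 : ∀ v, Complex.exp (↑(-2 * Real.pi * inner ℝ v ξ) * Complex.I) • 𝓕⁻ p v =
      phase (-ξ) ((2 * Real.pi) • v) •
        partialFourier (multiplierSymbol p) (0, (2 * Real.pi) • v) := fun v => by
    rw [partialFourier_multiplierSymbol, phase]
    congr 2
    rw [inner_smul_right, inner_neg_left, real_inner_comm]
    push_cast
    ring
  simp_rw [h5]
  rw [h4, ← integral_smul]
  refine integral_congr_ae (Filter.Eventually.of_forall fun w => ?_)
  simp only [kernel, smul_eq_mul, Complex.real_smul]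
  push_cast
  ring

/-- A Fourier transform constant on the unit ball has zero derivative there, and its derivative
along `e` is i times the transform of ⟨w, e⟩b. -/
theorem inner_moment_eq_zero {b : E d × E d → ℂ} (hb : RapidDecay b) {c : ℂ}
    (hc : ∀ ξ : E d, ‖ξ‖ < 1 → partialFourier b (0, ξ) = c) (e : E d) :
    ∀ ξ : E d, ‖ξ‖ < 1 →
      partialFourier (fun z => (inner ℝ z.2 e : ℝ) • b z) (0, ξ) = 0 := by
  intro ξ hξ
  have h1 : HasFDerivAt (fun ξ : E d => partialFourier b (0, ξ))
      ((partialFourier (partialFourierDeriv b) (0, ξ)).comp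
        (ContinuousLinearMap.inr ℝ (E d) (E d))) ξ :=
    HasFDerivAt.comp (f := fun ξ : E d => ((0 : E d), ξ)) (g := partialFourier b) ξ
      (hb.hasFDerivAt_partialFourier (0, ξ)) (hasFDerivAt_prodMk_right 0 ξ)
  have h2 : HasFDerivAt (fun ξ : E d => partialFourier b (0, ξ)) (0 : E d →L[ℝ] ℂ) ξ := by
    refine (hasFDerivAt_const c ξ).congr_of_eventuallyEq ?_
    filter_upwards [(continuous_norm.continuousAt (x := ξ)).eventually (gt_mem_nhds hξ)] with η hη
    exact hc η hη
  have h3 := congrArg (fun L : E d →L[ℝ] ℂ => L e) (h1.unique h2)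
  have h4 : partialFourier (partialFourierDeriv b) (0, ξ) (0, e) = 0 := h3
  have h5 : Integrable fun w => phase ξ w • partialFourierDeriv b (0, w) :=
    hb.partialFourierDeriv.integrable_phase_smul 0 ξ
  have h6 : partialFourier (partialFourierDeriv b) (0, ξ) (0, e) =
      ∫ w, (phase ξ w • partialFourierDeriv b (0, w)) (0, e) :=
    ContinuousLinearMap.integral_apply h5 (0, e)
  have h7 : ∀ w, (phase ξ w • partialFourierDeriv b (0, w)) (0, e) =
      Complex.I • (phase ξ w • ((inner ℝ w e : ℝ) • b (0, w))) := fun w => by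
    have : partialFourierDeriv b (0, w) (0, e) =
      fderiv ℝ b (0, w) (0, 0) + (inner ℝ w e : ℝ) • (Complex.I • b (0, w)) := rfl
    rw [smul_apply, this]
    have h0 : ((0 : E d), (0 : E d)) = 0 := rfl
    rw [h0, map_zero, zero_add]
    simp only [smul_eq_mul, Complex.real_smul]
    ring
  rw [h6] at h4
  simp_rw [h7] at h4
  rw [integral_smul] at h4
  exact (smul_eq_zero.1 h4).resolve_left Complex.I_ne_zero

/-- Rapidly decaying kernels, independent of the base point, with integral one and vanishing
higher moments. -/
structure UnitKernel (κ : E d × E d → ℂ) : Prop where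
  decay : RapidDecay κ
  invariant : TranslationInvariant κ
  integral_one : ∫ w, κ (0, w) = 1
  moments : ∀ n : ℕ, ∀ v : Fin (n + 1) → E d, ∫ w, (∏ i, inner ℝ w (v i) : ℝ) • κ (0, w) = 0

theorem rapidDecay_inner_mul {b : E d × E d → ℂ} (hb : RapidDecay b) (e : E d) :
    RapidDecay fun z => (inner ℝ z.2 e : ℝ) • b z := by
  have := hb.bilin_linear (ContinuousLinearMap.lsmul ℝ ℝ : ℝ →L[ℝ] ℂ →L[ℝ] ℂ) (innerSL ℝ e)
  simpa [real_inner_comm] using this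

theorem rapidDecay_prod_inner_mul {b : E d × E d → ℂ} (hb : RapidDecay b) (n : ℕ) :
    ∀ v : Fin n → E d, RapidDecay fun z => (∏ i, inner ℝ z.2 (v i) : ℝ) • b z := by
  induction n with
  | zero => simpa using hb
  | succ n ih =>
    intro v
    simp_rw [Fin.prod_univ_succ, mul_smul]
    exact rapidDecay_inner_mul (ih fun i => v i.succ) (v 0)

theorem unitKernel_of_eq_one {p : E d → ℂ} (hp : RapidDecay (multiplierSymbol p))
    (h1 : ∀ ξ, ‖ξ‖ < 1 → p ξ = 1) : UnitKernel (kernel (multiplierSymbol p)) := by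
  set κ := kernel (multiplierSymbol p) with hκ
  have hinv : ∀ ξ : E d, ‖ξ‖ < 1 → partialFourier κ (0, ξ) = 1 := fun ξ hξ => by
    have := fourier_inversion_kernel hp (-ξ)
    rw [neg_neg] at this
    rw [this, h1 _ (by rwa [norm_neg])]
  have hzero : ∀ b : E d × E d → ℂ, partialFourier b (0, 0) = ∫ w, b (0, w) := fun b => by
    simp [partialFourier, phase]
  -- Induction on the number of linear factors: the transform is constant on the unit ball, equal to
  -- 1 without factors and to 0 once there is one.
  have key : ∀ n : ℕ, ∀ v : Fin n → E d, ∃ c : ℂ, ∀ ξ : E d, ‖ξ‖ < 1 →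
      partialFourier (fun z => (∏ i, inner ℝ z.2 (v i) : ℝ) • κ z) (0, ξ) = c := by
    intro n
    induction n with
    | zero => exact fun v => ⟨1, by simpa using hinv⟩
    | succ n ih =>
      intro v
      obtain ⟨c, hc⟩ := ih fun i => v i.succ
      refine ⟨0, ?_⟩
      simp_rw [Fin.prod_univ_succ, mul_smul]
      exact inner_moment_eq_zero (rapidDecay_prod_inner_mul hp.kernel n _) hc (v 0)
  refine ⟨hp.kernel, fun x w => rfl, ?_, fun n v => ?_⟩
  · rw [← hzero, hinv 0 (by simp)]
  · obtain ⟨c, hc⟩ := key n fun i => v i.succ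
    have := inner_moment_eq_zero (rapidDecay_prod_inner_mul hp.kernel n _) hc (v 0) 0 (by simp)
    rw [hzero] at this
    simp_rw [Fin.prod_univ_succ, mul_smul]
    exact this

end Moments

/-! ### Taylor's formula with Hölder remainder -/

section Taylor

variable {X G : Type*} [NormedAddCommGroup X] [NormedSpace ℝ X] [NormedAddCommGroup G]
  [NormedSpace ℝ G]

/-- Taylor's formula for functions whose top order derivative is Hölder continuous. -/
theorem norm_sub_taylor_le_of_holder [CompleteSpace G] {n : ℕ} {f : X → G} (hf : ContDiff ℝ n f)
    {H s : ℝ} (hH : 0 ≤ H) (hs : 0 ≤ s)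
    (hhol : ∀ x y, ‖iteratedFDeriv ℝ n f x - iteratedFDeriv ℝ n f y‖ ≤ H * ‖x - y‖ ^ s) (x y : X) :
    ‖f (x + y) - ∑ k ∈ Finset.range (n + 1),
      (k.factorial : ℝ)⁻¹ • iteratedFDeriv ℝ k f x fun _ => y‖ ≤ H * (‖y‖ ^ n * ‖y‖ ^ s) := by
  rcases n with _ | m
  · have := hhol (x + y) x
    rw [add_sub_cancel_left] at this
    simp only [zero_add, Finset.sum_range_one, Nat.factorial_zero, Nat.cast_one, inv_one, one_smul,
      iteratedFDeriv_zero_apply, pow_zero, one_mul]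
    refine le_trans (le_of_eq ?_) this
    simp only [iteratedFDeriv_zero_eq_comp, Function.comp_apply, ← map_sub,
      LinearIsometryEquiv.norm_map]
  · have hf' : ∀ t : ℝ, t ∈ Set.Icc 0 1 → ContDiffAt ℝ (m + 1) f (x + t • y) := fun t _ => by
      exact_mod_cast hf.contDiffAt
    rw [map_add_eq_sum_add_integral_iteratedFDeriv hf',
      Finset.sum_range_succ _ (m + 1), add_sub_add_left_eq_sub]
    set D := iteratedFDeriv ℝ (m + 1) f with hD
    have hDc : Continuous D := hf.continuous_iteratedFDeriv le_rfl
    -- The top Taylor term is written as the remainder integral with the derivative frozen at `x`,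
    -- so that the difference involves only the oscillation of `D`.
    have h1 : ((m + 1).factorial : ℝ)⁻¹ • D x (fun _ => y) =
        (m.factorial : ℝ)⁻¹ • ∫ t in (0 : ℝ)..1, (1 - t) ^ m • D x (fun _ => y) := by
      rw [intervalIntegral.integral_smul_const]
      have : ∫ t in (0 : ℝ)..1, (1 - t) ^ m = ((m : ℝ) + 1)⁻¹ := by
        rw [intervalIntegral.integral_comp_sub_left (fun t => t ^ m) 1]
        simp
      rw [this, smul_smul, Nat.factorial_succ]
      push_cast
      rw [mul_inv, mul_comm]
    rw [h1, ← smul_sub, ← intervalIntegral.integral_sub]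
    · rw [norm_smul, Real.norm_of_nonneg (by positivity)]
      have h2 : ‖∫ t in (0 : ℝ)..1, ((1 - t) ^ m • D (x + t • y) (fun _ => y) -
          (1 - t) ^ m • D x fun _ => y)‖ ≤ H * (‖y‖ ^ (m + 1) * ‖y‖ ^ s) * |(1 : ℝ) - 0| := by
        refine intervalIntegral.norm_integral_le_of_norm_le_const fun t ht => ?_
        rw [Set.uIoc_of_le zero_le_one] at ht
        rw [← smul_sub, norm_smul, ← sub_apply]
        have h3 : ‖(1 - t) ^ m‖ ≤ 1 := by
          rw [norm_pow, Real.norm_of_nonneg (by linarith [ht.2])]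
          exact pow_le_one₀ (by linarith [ht.2]) (by linarith [ht.1])
        have h4 : ‖(D (x + t • y) - D x) fun _ => y‖ ≤ H * ‖y‖ ^ s * ‖y‖ ^ (m + 1) := by
          refine (ContinuousMultilinearMap.le_opNorm _ _).trans ?_
          rw [Finset.prod_const, Finset.card_univ, Fintype.card_fin]
          gcongr
          refine (hhol _ _).trans ?_
          rw [add_sub_cancel_left, norm_smul, Real.norm_of_nonneg ht.1.le]
          have ht0 : 0 < t := ht.1
          gcongr
          exact mul_le_of_le_one_left (norm_nonneg y) ht.2
        calc _ ≤ 1 * (H * ‖y‖ ^ s * ‖y‖ ^ (m + 1)) := by gcongr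
          _ = _ := by ring
      rw [sub_zero, abs_one, mul_one] at h2
      refine le_trans (mul_le_of_le_one_left ?_ ?_) h2
      · exact norm_nonneg _
      · exact inv_le_one_of_one_le₀ (by exact_mod_cast m.factorial_pos)
    · refine Continuous.intervalIntegrable ?_ _ _
      have : Continuous fun t : ℝ => D (x + t • y) := hDc.comp (by fun_prop)
      exact (by fun_prop : Continuous fun t : ℝ => (1 - t) ^ m).smul
        (this.eval continuous_const)
    · refine Continuous.intervalIntegrable ?_ _ _
      fun_prop

end Taylor

/-! ### Approximation of Hölder functions by smoothing -/

section Approximation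

variable {d : ℕ}

/-- Expanding `w` in the standard basis turns a homogeneous polynomial into a combination of
products of linear forms, whose moments are known. -/
theorem UnitKernel.integral_multilinear {κ : E d × E d → ℂ} (hκ : UnitKernel κ) {G : Type*}
    [NormedAddCommGroup G] [NormedSpace ℝ G] [NormedSpace ℂ G] [IsScalarTower ℝ ℂ G]
    [CompleteSpace G] (n : ℕ) (p : ContinuousMultilinearMap ℝ (fun _ : Fin n => E d) G) :
    (Integrable fun w => κ (0, w) • p fun _ => w) ∧
      (n ≠ 0 → ∫ w, κ (0, w) • p (fun _ => w) = 0) := by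
  have hp : ∀ w : E d, κ (0, w) • (p fun _ => w) = ∑ σ : Fin n → Fin d,
      ((∏ i, inner ℝ w (EuclideanSpace.single (σ i) (1 : ℝ)) : ℝ) • κ (0, w)) •
        p fun i => EuclideanSpace.single (σ i) (1 : ℝ) := by
    intro w
    have h1 : w = ∑ j : Fin d, (inner ℝ w (EuclideanSpace.single j (1 : ℝ)) : ℝ) •
        EuclideanSpace.single j (1 : ℝ) := by
      have := (EuclideanSpace.basisFun (Fin d) ℝ).sum_repr w
      simp only [EuclideanSpace.basisFun_apply, EuclideanSpace.basisFun_repr] at this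
      simpa [EuclideanSpace.inner_single_right] using this.symm
    have h2 : (p fun _ => w) = ∑ σ : Fin n → Fin d,
        (∏ i, inner ℝ w (EuclideanSpace.single (σ i) (1 : ℝ)) : ℝ) •
          p fun i => EuclideanSpace.single (σ i) (1 : ℝ) := by
      conv_lhs => rw [h1]
      rw [p.map_sum]
      exact Finset.sum_congr rfl fun σ _ => p.map_smul_univ _ _
    rw [h2, Finset.smul_sum]
    refine Finset.sum_congr rfl fun σ _ => ?_
    rw [smul_assoc, smul_comm]
  have hI : ∀ σ : Fin n → Fin d, Integrable fun w : E d =>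
      ((∏ i, inner ℝ w (EuclideanSpace.single (σ i) (1 : ℝ)) : ℝ) • κ (0, w)) •
        p fun i => EuclideanSpace.single (σ i) (1 : ℝ) := fun σ =>
    ((rapidDecay_prod_inner_mul hκ.decay n fun i =>
      EuclideanSpace.single (σ i) (1 : ℝ)).integrable 0).smul_const _
  simp_rw [hp]
  refine ⟨integrable_finsetSum _ fun σ _ => hI σ, fun hn => ?_⟩
  rw [integral_finsetSum _ fun σ _ => hI σ]
  refine Finset.sum_eq_zero fun σ _ => ?_
  obtain ⟨m, rfl⟩ := Nat.exists_eq_succ_of_ne_zero hn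
  rw [integral_smul_const, hκ.moments m, zero_smul]

/-- The Taylor polynomial of degree `n` at `x` integrates against κ to f(x), since only its constant
term survives. The error is therefore the integral of the Taylor remainder, of size H(ε|w|)^{n+s}.
-/
theorem UnitKernel.norm_kernelOp_sub_le {κ : E d × E d → ℂ} (hκ : UnitKernel κ) (n : ℕ) {s : ℝ}
    (hs : 0 ≤ s) : ∃ C : ℝ, 0 ≤ C ∧ ∀ {G : Type*}
    [NormedAddCommGroup G] [NormedSpace ℝ G] [NormedSpace ℂ G] [IsScalarTower ℝ ℂ G]
    [CompleteSpace G] {ε : ℝ}, 0 < ε → ∀ {f : E d → G}, ContDiff ℝ n f →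
    (∃ B : ℝ, ∀ x, ‖f x‖ ≤ B) → ∀ {H : ℝ}, 0 ≤ H →
    (∀ x y, ‖iteratedFDeriv ℝ n f x - iteratedFDeriv ℝ n f y‖ ≤ H * ‖x - y‖ ^ s) → ∀ x,
    ‖kernelOp κ ε f x - f x‖ ≤ C * (H * ε ^ (n + s)) := by
  -- The decay of κ must absorb the growth |w|^{n+s}; the exponent is rounded up to an integer.
  obtain ⟨C, hC0, hC⟩ := hκ.decay.bound 0 ⌈(n : ℝ) + s⌉₊
  refine ⟨C * weightMass d, mul_nonneg hC0 weightMass_nonneg, ?_⟩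
  rintro G _ _ _ _ _ ε hε f hf ⟨B, hB⟩ H hH hhol x
  let p : ∀ k : ℕ, ContinuousMultilinearMap ℝ (fun _ : Fin k => E d) G := fun k =>
    ((k.factorial : ℝ)⁻¹ * (-ε) ^ k) • iteratedFDeriv ℝ k f x
  have hp : ∀ k w, (k.factorial : ℝ)⁻¹ • (iteratedFDeriv ℝ k f x fun _ => -(ε • w)) =
      p k fun _ => w := by
    intro k w
    have := (iteratedFDeriv ℝ k f x).map_smul_univ (fun _ => -ε) (fun _ => w)
    simp only [neg_smul, Finset.prod_const, Finset.card_univ, Fintype.card_fin] at this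
    simp only [p, this, smul_apply, smul_smul]
  have hI1 : Integrable fun w => κ (0, w) • f (x - ε • w) := by
    have := hκ.decay.integrable_kernelOp ε hf.continuous hB x
    simpa only [hκ.invariant (ε • x)] using this
  have h1 : ∫ w, κ (0, w) • ∑ k ∈ Finset.range (n + 1), (p k fun _ => w) = f x := by
    simp_rw [Finset.smul_sum]
    rw [integral_finsetSum _ fun k _ => (hκ.integral_multilinear k (p k)).1,
      Finset.sum_range_succ', Finset.sum_eq_zero, zero_add]
    · have : ∀ w : E d, (p 0 fun _ => w) = f x := fun w => by simp [p]
      simp_rw [this]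
      rw [integral_smul_const, hκ.integral_one, one_smul]
    · exact fun k _ => (hκ.integral_multilinear (k + 1) (p (k + 1))).2 (by simp)
  have hI2 : Integrable fun w => κ (0, w) • ∑ k ∈ Finset.range (n + 1), (p k fun _ => w) := by
    simp_rw [Finset.smul_sum]
    exact integrable_finsetSum _ fun k _ => (hκ.integral_multilinear k (p k)).1
  have h2 : kernelOp κ ε f x - f x = ∫ w, κ (0, w) • (f (x + -(ε • w)) -
      ∑ k ∈ Finset.range (n + 1),
        (k.factorial : ℝ)⁻¹ • (iteratedFDeriv ℝ k f x fun _ => -(ε • w))) := by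
    simp_rw [hp, smul_sub, ← sub_eq_add_neg]
    rw [integral_sub hI1 hI2, h1]
    simp only [kernelOp, hκ.invariant (ε • x)]
  have h3 : C * weightMass d * (H * ε ^ (n + s)) =
      ∫ w : E d, C * (H * ε ^ (n + s)) * weight w := by
    rw [integral_const_mul, weightMass]; ring
  rw [h2, h3]
  refine norm_integral_le_of_norm_le (integrable_weight.const_mul _)
    (Filter.Eventually.of_forall fun w => ?_)
  rw [norm_smul]
  have h4 := norm_sub_taylor_le_of_holder hf hH hs hhol x (-(ε • w))
  rw [norm_neg, norm_smul, Real.norm_of_nonneg hε.le] at h4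
  have h5 := hC (0, w)
  simp only [norm_iteratedFDeriv_zero] at h5
  have h6 : (ε * ‖w‖) ^ n * (ε * ‖w‖) ^ s ≤ ε ^ (n + s) * (1 + ‖w‖) ^ ⌈(n : ℝ) + s⌉₊ := by
    have hw : 0 ≤ ‖w‖ := norm_nonneg w
    have : ‖w‖ ^ n * ‖w‖ ^ s ≤ (1 + ‖w‖) ^ ⌈(n : ℝ) + s⌉₊ := by
      calc ‖w‖ ^ n * ‖w‖ ^ s ≤ (1 + ‖w‖) ^ n * (1 + ‖w‖) ^ s := by gcongr <;> linarith
        _ = (1 + ‖w‖) ^ ((n : ℝ) + s) := by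
          rw [Real.rpow_add (by positivity), Real.rpow_natCast]
        _ ≤ (1 + ‖w‖) ^ (⌈(n : ℝ) + s⌉₊ : ℝ) :=
          Real.rpow_le_rpow_of_exponent_le (by linarith) (Nat.le_ceil _)
        _ = _ := Real.rpow_natCast _ _
    calc _ = ε ^ (n + s) * (‖w‖ ^ n * ‖w‖ ^ s) := by
          rw [mul_pow, Real.mul_rpow hε.le hw, Real.rpow_add hε, Real.rpow_natCast]; ring
      _ ≤ _ := by gcongr
  calc _ ≤ ‖κ (0, w)‖ * (H * (ε ^ (n + s) * (1 + ‖w‖) ^ ⌈(n : ℝ) + s⌉₊)) := by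
        gcongr
        exact h4.trans (by gcongr)
    _ = H * ε ^ (n + s) * ((1 + ‖w‖) ^ ⌈(n : ℝ) + s⌉₊ * ‖κ (0, w)‖) := by ring
    _ ≤ H * ε ^ (n + s) * (C * weight w) := by gcongr
    _ = _ := by ring

end Approximation

/-! ### The derivative loss at a given scale -/

section Loss

/-- The factor `ε^{-(j - r)_+}`: the size, at scale `ε`, of the derivatives of order `j` of a
smoothed function of class `C^r`. -/
def loss (r ε : ℝ) (j : ℕ) : ℝ := ε ^ (-max ((j : ℝ) - r) 0)

theorem loss_pos {r ε : ℝ} (hε : 0 < ε) (j : ℕ) : 0 < loss r ε j := Real.rpow_pos_of_pos hε _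

theorem loss_mono {r ε : ℝ} (hε : 0 < ε) (hε1 : ε ≤ 1) {i j : ℕ} (h : i ≤ j) :
    loss r ε i ≤ loss r ε j := by
  refine Real.rpow_le_rpow_of_exponent_ge hε hε1 (neg_le_neg (max_le_max ?_ le_rfl))
  have : (i : ℝ) ≤ j := by exact_mod_cast h
  linarith

theorem one_le_loss {r ε : ℝ} (hε : 0 < ε) (hε1 : ε ≤ 1) (j : ℕ) : 1 ≤ loss r ε j :=
  Real.one_le_rpow_of_pos_of_le_one_of_nonpos hε hε1 (by simp)

theorem inv_pow_mul_rpow_le_loss {r ε : ℝ} (hε : 0 < ε) (hε1 : ε ≤ 1) (j : ℕ) :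
    (ε ^ j)⁻¹ * ε ^ r ≤ loss r ε j := by
  rw [loss, ← Real.rpow_natCast, ← Real.rpow_neg hε.le, ← Real.rpow_add hε]
  refine Real.rpow_le_rpow_of_exponent_ge hε hε1 ?_
  have := le_max_left ((j : ℝ) - r) 0
  linarith

theorem loss_eq_of_lt {r ε : ℝ} (hε : 0 < ε) {j : ℕ} (h : r ≤ j) :
    loss r ε j = (ε ^ j)⁻¹ * ε ^ r := by
  rw [loss, max_eq_left (by linarith), ← Real.rpow_natCast, ← Real.rpow_neg hε.le,
    ← Real.rpow_add hε]
  congr 1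
  ring

theorem loss_succ (n : ℕ) (s ε : ℝ) (j : ℕ) :
    loss (((n + 1 : ℕ) : ℝ) + s) ε (j + 1) = loss ((n : ℝ) + s) ε j := by
  rw [loss, loss]
  congr 3
  push_cast
  ring

end Loss

/-! ### Derivatives of smoothed functions -/

section Smoothing

variable {d : ℕ}

theorem SmoothBounded.fderiv {G : Type*} [NormedAddCommGroup G] [NormedSpace ℝ G]
    {f : E d → G} (hf : SmoothBounded f) : SmoothBounded (fderiv ℝ f) := by
  refine ⟨hf.smooth.fderiv_right (by simp), fun j => ?_⟩
  simp_rw [norm_iteratedFDeriv_fderiv]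
  exact hf.bounded (j + 1)

theorem SmoothBounded.norm_le {G : Type*} [NormedAddCommGroup G] [NormedSpace ℝ G]
    {f : E d → G} (hf : SmoothBounded f) : ∃ B : ℝ, ∀ x, ‖f x‖ ≤ B := by
  simpa using hf.bounded 0

/-- Derivatives commute with the smoothing, so `j` of them can be moved onto `f`; the remaining `N`
are turned into ε^N by the approximation estimate. -/
theorem UnitKernel.norm_iteratedFDeriv_kernelOp_sub_le {κ : E d × E d → ℂ} (hκ : UnitKernel κ)
    (N j : ℕ) : ∀ {G : Type _}
    [NormedAddCommGroup G] [NormedSpace ℝ G] [NormedSpace ℂ G] [IsScalarTower ℝ ℂ G]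
    [CompleteSpace G], ∃ C : ℝ, 0 ≤ C ∧ ∀ {ε : ℝ}, 0 < ε → ε ≤ 1 → ∀ {f : E d → G},
    SmoothBounded f → ∀ {M : ℝ}, (∀ x, ‖iteratedFDeriv ℝ (N + j) f x‖ ≤ M) → ∀ x,
    ‖iteratedFDeriv ℝ j (fun x => kernelOp κ ε f x - f x) x‖ ≤ C * (ε ^ N * M) := by
  induction j with
  | zero =>
    intro G _ _ _ _ _
    obtain ⟨C, hC0, hC⟩ := hκ.norm_kernelOp_sub_le N le_rfl
    refine ⟨C * 2, by positivity, fun {ε} hε _ {f} hf {M} hM x => ?_⟩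
    have hM0 : 0 ≤ M := (norm_nonneg _).trans (hM 0)
    rw [norm_iteratedFDeriv_zero]
    -- Hölder exponent 0: the oscillation of the derivative of order `N` is at most 2M.
    have := hC hε (hf.smooth.of_le (natCast_le_infty N)) hf.norm_le (H := 2 * M) (by positivity)
      (fun x y => by
        rw [Real.rpow_zero, mul_one, two_mul]
        exact (norm_sub_le _ _).trans (add_le_add (hM x) (hM y))) x
    rw [add_zero, Real.rpow_natCast] at this
    refine this.trans_eq ?_
    ring
  | succ j ih =>
    intro G _ _ _ _ _
    obtain ⟨C, hC0, hC⟩ := ih (G := E d →L[ℝ] G)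
    refine ⟨C, hC0, fun {ε} hε hε1 {f} hf {M} hM x => ?_⟩
    obtain ⟨B, hB⟩ := hf.norm_le
    obtain ⟨B', hB'⟩ := hf.fderiv.norm_le
    have h1 : _root_.fderiv ℝ (fun x => kernelOp κ ε f x - f x) =
        fun x => kernelOp κ ε (_root_.fderiv ℝ f) x - _root_.fderiv ℝ f x := funext fun x =>
      ((hκ.decay.hasFDerivAt_kernelOp hκ.invariant ε (hf.smooth.of_le (by simp)) hB hB' x).sub
        (hf.smooth.differentiable (by simp) x).hasFDerivAt).fderiv
    rw [← norm_iteratedFDeriv_fderiv, h1]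
    exact hC hε hε1 hf.fderiv (fun x => by
      rw [norm_iteratedFDeriv_fderiv]; exact hM x) x

theorem UnitKernel.kernelOp_const {κ : E d × E d → ℂ} (hκ : UnitKernel κ) {G : Type*}
    [NormedAddCommGroup G] [NormedSpace ℝ G] [NormedSpace ℂ G]
    [CompleteSpace G] (ε : ℝ) (c : G) (x : E d) : kernelOp κ ε (fun _ => c) x = c := by
  simp only [kernelOp, hκ.invariant (ε • x)]
  rw [integral_smul_const, hκ.integral_one, one_smul]

/-- Smoothing of a Hölder function at scale `ε`. -/
theorem UnitKernel.norm_iteratedFDeriv_kernelOp_le_loss {κ : E d × E d → ℂ} (hκ : UnitKernel κ)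
    {H s : ℝ} (hH : 0 ≤ H) (hs : 0 ≤ s) (hs1 : s ≤ 1) (n : ℕ) : ∀ {G : Type _}
    [NormedAddCommGroup G] [NormedSpace ℝ G] [NormedSpace ℂ G] [IsScalarTower ℝ ℂ G]
    [CompleteSpace G] {f : E d → G}, ContDiff ℝ n f →
    (∀ i ≤ n, ∃ B : ℝ, ∀ x, ‖iteratedFDeriv ℝ i f x‖ ≤ B) →
    (∀ x y, ‖iteratedFDeriv ℝ n f x - iteratedFDeriv ℝ n f y‖ ≤ H * ‖x - y‖ ^ s) →
    ∀ j : ℕ, ∃ C : ℝ, ∀ {ε : ℝ}, 0 < ε → ε ≤ 1 → ∀ x,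
      ‖iteratedFDeriv ℝ j (kernelOp κ ε f) x‖ ≤ C * loss (n + s) ε j := by
  have hzero : ∀ {G : Type _}
    [NormedAddCommGroup G] [NormedSpace ℝ G] [NormedSpace ℂ G] [IsScalarTower ℝ ℂ G]
    [CompleteSpace G] (r : ℝ) {f : E d → G}, Continuous f → (∃ B : ℝ, ∀ x, ‖f x‖ ≤ B) →
    ∃ C : ℝ, ∀ {ε : ℝ}, 0 < ε → ε ≤ 1 → ∀ x,
      ‖iteratedFDeriv ℝ 0 (kernelOp κ ε f) x‖ ≤ C * loss r ε 0 := by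
    intro G _ _ _ _ _ r f hf ⟨B, hB⟩
    have hB0 : 0 ≤ B := (norm_nonneg _).trans (hB 0)
    obtain ⟨C, hC0, hC⟩ := hκ.decay.norm_iteratedFDeriv_kernelOp_le_sup (G := G) 0
    refine ⟨C * B, fun {ε} hε hε1 x => (hC hε hε1 hf B hB x).trans ?_⟩
    rw [pow_zero, inv_one, one_mul]
    exact le_mul_of_one_le_right (by positivity) (one_le_loss hε hε1 0)
  induction n with
  | zero =>
    intro G _ _ _ _ _ f hf hb hhol j
    have hfc : Continuous f := hf.continuous
    obtain ⟨B, hB⟩ := hb 0 le_rfl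
    simp only [norm_iteratedFDeriv_zero] at hB
    rcases j with _ | j
    · exact hzero _ hfc ⟨B, hB⟩
    obtain ⟨C, hC0, hC⟩ := hκ.decay.norm_iteratedFDeriv_kernelOp_le_rough (G := G) (j + 1)
    refine ⟨C * H, fun {ε} hε hε1 x => ?_⟩
    have hhol' : ∀ x y, ‖f x - f y‖ ≤ H * ‖x - y‖ ^ s := fun x y => by
      have := hhol x y
      simpa only [iteratedFDeriv_zero_eq_comp, Function.comp_apply, ← map_sub,
        LinearIsometryEquiv.norm_map] using this
    -- Constants are reproduced, so for a derivative of positive order at `x` one may replace `f` by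
    -- f - f(x). At x - εw this is at most Hε^s|w|^s ≤ Hε^s(1 + |w|), where s ≤ 1 is used.
    have hgc : Continuous fun y => f y - f x := hfc.sub continuous_const
    have hgB : ∀ y, ‖f y - f x‖ ≤ B + B := fun y =>
      (norm_sub_le _ _).trans (add_le_add (hB y) (hB x))
    have h1 : kernelOp κ ε f = fun y => kernelOp κ ε (fun y => f y - f x) y + f x := by
      have h2 := hκ.decay.kernelOp_add ε hgc hgB (continuous_const (y := f x))
        (B' := ‖f x‖) (fun _ => le_rfl)
      simp only [sub_add_cancel, hκ.kernelOp_const] at h2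
      exact h2
    have hsm := (hκ.decay.kernelOp_rough hε hε1 hgc hgB).1
    have h3 : iteratedFDeriv ℝ (j + 1) (kernelOp κ ε f) x =
        iteratedFDeriv ℝ (j + 1) (kernelOp κ ε fun y => f y - f x) x := by
      rw [h1]
      have := congrFun (iteratedFDeriv_add (hsm.of_le (natCast_le_infty (j + 1)))
        (contDiff_const (c := f x))) x
      rw [iteratedFDeriv_const_of_ne (by simp)] at this
      exact this.trans (add_zero _)
    rw [h3]
    have hHε : 0 ≤ H * ε ^ s := by positivity
    have h4 := hC hε hε1 hgc ⟨_, hgB⟩ x (H * ε ^ s) fun w => by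
      refine (hhol' _ _).trans ?_
      rw [sub_sub_cancel_left, norm_neg, norm_smul, Real.norm_of_nonneg hε.le,
        Real.mul_rpow hε.le (norm_nonneg _), ← mul_assoc]
      refine mul_le_mul_of_nonneg_left ?_ hHε
      calc ‖w‖ ^ s ≤ (1 + ‖w‖) ^ s := by gcongr; linarith
        _ ≤ (1 + ‖w‖) ^ (1 : ℝ) :=
          Real.rpow_le_rpow_of_exponent_le (by linarith [norm_nonneg w]) hs1
        _ = _ := Real.rpow_one _
    refine h4.trans_eq ?_
    rw [loss_eq_of_lt hε (by push_cast; linarith [(Nat.cast_nonneg j : (0 : ℝ) ≤ j)])]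
    simp only [Nat.cast_zero, zero_add]
    ring
  | succ n ih =>
    intro G _ _ _ _ _ f hf hb hhol j
    obtain ⟨B, hB⟩ := hb 0 (Nat.zero_le _)
    simp only [norm_iteratedFDeriv_zero] at hB
    rcases j with _ | j
    · exact hzero _ hf.continuous ⟨B, hB⟩
    obtain ⟨B', hB'⟩ := hb 1 (by simp)
    simp only [norm_iteratedFDeriv_one] at hB'
    -- One derivative passes to `f`, lowering the order `j` and the regularity together; the loss
    -- depends only on their difference.
    have hf1 : ContDiff ℝ n (_root_.fderiv ℝ f) := hf.fderiv_right (by simp)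
    obtain ⟨C, hC⟩ := ih hf1 (fun i hi => by
        simp_rw [norm_iteratedFDeriv_fderiv]
        exact hb (i + 1) (by omega))
      (fun x y => by
        have := hhol x y
        rw [iteratedFDeriv_succ_eq_comp_right, iteratedFDeriv_succ_eq_comp_right, ← dist_eq_norm] at this
        rw [← dist_eq_norm]
        exact ((continuousMultilinearCurryRightEquiv' ℝ n (E d) G).symm.dist_map _ _).symm.trans_le
          this) j
    refine ⟨C, fun {ε} hε hε1 x => ?_⟩
    rw [loss_succ, ← norm_iteratedFDeriv_fderiv,
      hκ.decay.fderiv_kernelOp hκ.invariant ε (hf.of_le (by simp)) hB hB']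
    exact hC hε hε1 x

end Smoothing

/-! ### Kernel operators acting on functions split at scale ε -/

section MultiplierBounds

variable {d : ℕ}

theorem norm_iteratedFDeriv_add_le {X G : Type*} [NormedAddCommGroup X] [NormedSpace ℝ X]
    [NormedAddCommGroup G] [NormedSpace ℝ G] {f g : X → G} (hf : ContDiff ℝ ∞ f)
    (hg : ContDiff ℝ ∞ g) (j : ℕ) (x : X) : ‖iteratedFDeriv ℝ j (fun x => f x + g x) x‖ ≤
      ‖iteratedFDeriv ℝ j f x‖ + ‖iteratedFDeriv ℝ j g x‖ := by
  have : iteratedFDeriv ℝ j (fun x => f x + g x) x = _ :=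
    congrFun (iteratedFDeriv_add (hf.of_le (natCast_le_infty j)) (hg.of_le (natCast_le_infty j))) x
  rw [this]
  exact norm_add_le _ _

theorem norm_iteratedFDeriv_sub_le {X G : Type*} [NormedAddCommGroup X] [NormedSpace ℝ X]
    [NormedAddCommGroup G] [NormedSpace ℝ G] {f g : X → G} (hf : ContDiff ℝ ∞ f)
    (hg : ContDiff ℝ ∞ g) (j : ℕ) (x : X) : ‖iteratedFDeriv ℝ j (fun x => f x - g x) x‖ ≤
      ‖iteratedFDeriv ℝ j f x‖ + ‖iteratedFDeriv ℝ j g x‖ := by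
  have h := norm_iteratedFDeriv_add_le hf hg.neg j x
  have h2 : iteratedFDeriv ℝ j (fun x => -g x) x = -iteratedFDeriv ℝ j g x :=
    iteratedFDeriv_neg_apply
  rw [h2, norm_neg] at h
  simpa only [sub_eq_add_neg] using h

theorem SmoothBounded.sub {G : Type*} [NormedAddCommGroup G] [NormedSpace ℝ G] {f g : E d → G}
    (hf : SmoothBounded f) (hg : SmoothBounded g) : SmoothBounded fun x => f x - g x := by
  refine ⟨hf.smooth.sub hg.smooth, fun j => ?_⟩
  obtain ⟨C, hC⟩ := hf.bounded j
  obtain ⟨C', hC'⟩ := hg.bounded j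
  exact ⟨C + C', fun x => (norm_iteratedFDeriv_sub_le hf.smooth hg.smooth j x).trans
    (add_le_add (hC x) (hC' x))⟩

/-- A smoothed function inherits the derivative bounds of a smooth approximation. -/
theorem RapidDecay.norm_iteratedFDeriv_kernelOp_le_of_approx {κ : E d × E d → ℂ}
    (hκ : RapidDecay κ) (r : ℝ) {Ca : ℕ → ℝ} {Cb : ℝ} (hCa : ∀ i, 0 ≤ Ca i) (j : ℕ) :
    ∃ C : ℝ, 0 ≤ C ∧ ∀ {ε σ : ℝ}, 0 < ε → ε ≤ 1 → 0 < σ → σ ≤ 1 → ∀ {m a : E d → ℂ},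
      Continuous m → SmoothBounded a →
      (∀ i x, ‖iteratedFDeriv ℝ i a x‖ ≤ Ca i * loss r ε i) → (∀ x, ‖m x - a x‖ ≤ Cb * ε ^ r) →
      ContDiff ℝ ∞ (Paradiff.kernelOp κ σ m) ∧
      ContDiff ℝ ∞ (Paradiff.kernelOp κ σ a) ∧
      (∀ x, ‖iteratedFDeriv ℝ j (Paradiff.kernelOp κ σ a) x‖ ≤ C * loss r ε j) ∧
      ∀ x, ‖iteratedFDeriv ℝ j (fun x => Paradiff.kernelOp κ σ m x - Paradiff.kernelOp κ σ a x) x‖ ≤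
        C * ((σ ^ j)⁻¹ * ε ^ r) := by
  obtain ⟨C1, hC1, h1⟩ := hκ.norm_iteratedFDeriv_kernelOp_le_smooth (G := ℂ) j
  obtain ⟨C2, hC2, h2⟩ := hκ.norm_iteratedFDeriv_kernelOp_le_sup (G := ℂ) j
  have hS : 0 ≤ ∑ i ∈ Finset.range (j + 1), Ca i := Finset.sum_nonneg fun i _ => hCa i
  refine ⟨C1 * (∑ i ∈ Finset.range (j + 1), Ca i) + C2 * |Cb|, by positivity, ?_⟩
  intro ε σ hε hε1 hσ hσ1 m a hm ha hab hb
  obtain ⟨B, hB⟩ := ha.norm_le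
  have hbc : Continuous fun x => m x - a x := hm.sub ha.smooth.continuous
  have hsa := (hκ.kernelOp_rough hσ hσ1 ha.smooth.continuous hB).1
  have hsb := (hκ.kernelOp_rough hσ hσ1 hbc hb).1
  have hadd := hκ.kernelOp_add σ hbc hb ha.smooth.continuous hB
  simp only [sub_add_cancel] at hadd
  -- By linearity the two parts separate: derivatives stay on `a`, whereas for m - a, known only in
  -- supremum norm, they fall on the kernel and cost σ⁻¹ each.
  have hadd' : Paradiff.kernelOp κ σ m = fun x => Paradiff.kernelOp κ σ (fun x => m x - a x) x +
    Paradiff.kernelOp κ σ a x := hadd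
  refine ⟨?_, hsa, fun x => ?_, fun x => ?_⟩
  · rw [hadd']; exact hsb.add hsa
  · refine (h1 hσ hσ1 ha ((∑ i ∈ Finset.range (j + 1), Ca i) * loss r ε j) (fun i hi x =>
      (hab i x).trans ?_) x).trans ?_
    · refine mul_le_mul (Finset.single_le_sum (f := Ca) (fun i _ => hCa i)
        (Finset.mem_range_succ_iff.2 hi)) (loss_mono hε hε1 hi) (loss_pos hε i).le hS
    · rw [← mul_assoc]
      have := loss_pos (r := r) hε j
      gcongr
      exact le_add_of_nonneg_right (by positivity)
  · simp only [hadd', add_sub_cancel_right]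
    refine (h2 hσ hσ1 hbc _ hb x).trans ?_
    have h3 : 0 ≤ C1 * (∑ i ∈ Finset.range (j + 1), Ca i) * ((σ ^ j)⁻¹ * ε ^ r) := by positivity
    calc C2 * ((σ ^ j)⁻¹ * (Cb * ε ^ r)) = C2 * Cb * ((σ ^ j)⁻¹ * ε ^ r) := by ring
      _ ≤ C2 * |Cb| * ((σ ^ j)⁻¹ * ε ^ r) := by gcongr; exact le_abs_self _
      _ ≤ _ := by rw [add_mul]; linarith

/-- When the operator acts at the scale of the splitting, the rough part contributes ε^{r-j}, which
never exceeds the loss allowed to the smooth part. -/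
theorem RapidDecay.norm_iteratedFDeriv_kernelOp_le_loss_of_approx {κ : E d × E d → ℂ}
    (hκ : RapidDecay κ) (r : ℝ) {Ca : ℕ → ℝ} {Cb : ℝ} (hCa : ∀ i, 0 ≤ Ca i) (j : ℕ) :
    ∃ C : ℝ, 0 ≤ C ∧ ∀ {ε : ℝ}, 0 < ε → ε ≤ 1 → ∀ {m a : E d → ℂ},
      Continuous m → SmoothBounded a →
      (∀ i x, ‖iteratedFDeriv ℝ i a x‖ ≤ Ca i * loss r ε i) → (∀ x, ‖m x - a x‖ ≤ Cb * ε ^ r) →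
      ∀ x, ‖iteratedFDeriv ℝ j (Paradiff.kernelOp κ ε m) x‖ ≤ C * loss r ε j := by
  obtain ⟨C, hC0, hC⟩ :=
    hκ.norm_iteratedFDeriv_kernelOp_le_of_approx r (Ca := Ca) (Cb := Cb) hCa j
  refine ⟨C + C, by positivity, fun {ε} hε hε1 {m a} hm ha hab hb x => ?_⟩
  obtain ⟨h1, h2, h3, h4⟩ := hC hε hε1 hε hε1 hm ha hab hb
  have h5 := norm_iteratedFDeriv_add_le (h1.sub h2) h2 j x
  simp only [sub_add_cancel] at h5
  refine h5.trans ?_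
  rw [add_mul]
  refine add_le_add ((h4 x).trans ?_) (h3 x)
  gcongr
  exact inv_pow_mul_rpow_le_loss hε hε1 j

/-- An interpolation argument: the remainder is O(ε^r), and its derivatives of order N + j, with N =
⌈r⌉, are O(τ^{-(N+j)}ε^r). Smoothing it at the finer scale τ gives the bound of order `j`. -/
theorem UnitKernel.norm_iteratedFDeriv_sub_kernelOp_le {κ : E d × E d → ℂ} (hκ : UnitKernel κ)
    {r : ℝ} (hr : 0 < r) {Ca Cm : ℕ → ℝ} {Cb : ℝ} (hCa : ∀ i, 0 ≤ Ca i) (hCm : ∀ i, 0 ≤ Cm i)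
    (j : ℕ) : ∃ C : ℝ, ∀ {ε τ : ℝ}, ε ≤ 1 → 0 < τ → τ ≤ ε → ∀ {m a : E d → ℂ},
      SmoothBounded m → SmoothBounded a →
      (∀ i x, ‖iteratedFDeriv ℝ i a x‖ ≤ Ca i * loss r ε i) → (∀ x, ‖m x - a x‖ ≤ Cb * ε ^ r) →
      (∀ i x, ‖iteratedFDeriv ℝ i m x‖ ≤ Cm i * loss r τ i) →
      ∀ x, ‖iteratedFDeriv ℝ j (fun x => m x - kernelOp κ ε m x) x‖ ≤ C * ((τ ^ j)⁻¹ * ε ^ r) := by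
  have hN : r ≤ (⌈r⌉₊ : ℝ) := Nat.le_ceil r
  set N := ⌈r⌉₊
  obtain ⟨C1, hC1, h1⟩ := hκ.decay.norm_iteratedFDeriv_kernelOp_le_loss_of_approx r
    (Ca := Ca) (Cb := Cb) hCa (N + j)
  obtain ⟨C2, hC2, h2⟩ := hκ.norm_iteratedFDeriv_kernelOp_sub_le N 0 (G := ℂ)
  obtain ⟨C3, hC3, h3⟩ := hκ.decay.norm_iteratedFDeriv_kernelOp_le_of_approx r
    (Ca := Ca) (Cb := Cb) hCa 0
  obtain ⟨C4, hC4, h4⟩ := hκ.norm_iteratedFDeriv_kernelOp_sub_le N j (G := ℂ)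
  obtain ⟨C5, hC5, h5⟩ := hκ.decay.norm_iteratedFDeriv_kernelOp_le_sup (G := ℂ) j
  refine ⟨C5 * (C2 * Ca N + |Cb| + C3) + C4 * (Cm (N + j) + C1), ?_⟩
  intro ε τ hε1 hτ hτε m a hm ha hab hb hmb x
  have hε : 0 < ε := hτ.trans_le hτε
  have hτ1 : τ ≤ 1 := hτε.trans hε1
  have hεr : 0 < ε ^ r := Real.rpow_pos_of_pos hε r
  obtain ⟨B, hB⟩ := hm.norm_le
  have hkm := SmoothBounded.kernelOp hκ.decay hε hε1 hm.smooth.continuous hB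
  have hh := hm.sub hkm
  set h := fun x => m x - kernelOp κ ε m x with hdef
  -- The remainder is (m - a) - κ_ε(m - a) - (κ_ε a - a). The last term is controlled by `N`
  -- derivatives of `a`: ε^N times ε^{r-N}.
  have hsup : ∀ x, ‖h x‖ ≤ (C2 * Ca N + |Cb| + C3) * ε ^ r := fun x => by
    obtain ⟨-, -, -, h6⟩ := h3 hε hε1 hε hε1 hm.smooth.continuous ha hab hb
    have h7 := h6 x
    have h8 := h2 hε hε1 ha (hab N) x
    rw [norm_iteratedFDeriv_zero] at h7 h8
    rw [pow_zero, inv_one, one_mul] at h7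
    have h9 : ε ^ N * (Ca N * loss r ε N) = Ca N * ε ^ r := by
      rw [loss_eq_of_lt hε hN]
      have : ε ^ N ≠ 0 := by positivity
      field_simp
    rw [h9] at h8
    have h10 : h x = (m x - a x) - (kernelOp κ ε m x - kernelOp κ ε a x) -
        (kernelOp κ ε a x - a x) := by rw [hdef]; ring
    have h11 : Cb * ε ^ r ≤ |Cb| * ε ^ r := by gcongr; exact le_abs_self _
    rw [h10]
    refine (norm_sub_le _ _).trans ((add_le_add (norm_sub_le _ _) le_rfl).trans ?_)
    have := hb x
    linarith
  -- Both contributions are enlarged to the same form: τ^r ≤ ε^r for `m`, and ε^{-(N+j)} ≤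
  -- τ^{-(N+j)} for its smoothing.
  have hhigh : ∀ x, ‖iteratedFDeriv ℝ (N + j) h x‖ ≤
      (Cm (N + j) + C1) * ((τ ^ (N + j))⁻¹ * ε ^ r) := fun x => by
    refine (norm_iteratedFDeriv_sub_le hm.smooth hkm.smooth (N + j) x).trans ?_
    have hNj : r ≤ ((N + j : ℕ) : ℝ) := by push_cast; linarith [(Nat.cast_nonneg j : (0 : ℝ) ≤ j)]
    rw [add_mul]
    refine add_le_add ((hmb _ x).trans ?_)
      ((h1 hε hε1 hm.smooth.continuous ha hab hb x).trans ?_)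
    · rw [loss_eq_of_lt hτ hNj]
      have := hCm (N + j)
      gcongr
    · rw [loss_eq_of_lt hε hNj]
      gcongr
  obtain ⟨B', hB'⟩ := hh.norm_le
  have hkh := SmoothBounded.kernelOp hκ.decay hτ hτ1 hh.smooth.continuous hB'
  -- With h = κ_τ h - (κ_τ h - h), the first term pays τ^{-j} on the supremum bound and the second
  -- gains τ^N on the high derivatives.
  have h12 := h4 hτ hτ1 hh hhigh x
  have h13 := h5 hτ hτ1 hh.smooth.continuous _ hsup x
  have h14 := norm_iteratedFDeriv_sub_le hkh.smooth (hkh.sub hh).smooth j x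
  simp only [sub_sub_cancel] at h14
  refine h14.trans ((add_le_add h13 h12).trans_eq ?_)
  have : τ ^ N ≠ 0 := by positivity
  rw [pow_add]
  field_simp

end MultiplierBounds

/-! ### Nonlinear functions and segment means -/

section Composition

variable {d : ℕ}

theorem loss_zero {r : ℝ} (hr : 0 ≤ r) (ε : ℝ) : loss r ε 0 = 1 := by
  rw [loss, max_eq_right (by simpa using hr), neg_zero, Real.rpow_zero]

/-- Interpolation of the derivative losses between the orders `0` and `j`. -/
theorem loss_le_pow {r ε : ℝ} (hr : 0 ≤ r) (hε : 0 < ε) (hε1 : ε ≤ 1) {i j : ℕ} (hi : 1 ≤ i)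
    (hij : i ≤ j) : loss r ε i ≤ (ε ^ (-max ((j : ℝ) - r) 0 / j)) ^ i := by
  have hi' : (0 : ℝ) < i := by exact_mod_cast hi
  have hij' : (i : ℝ) ≤ j := by exact_mod_cast hij
  have hj : (0 : ℝ) < j := hi'.trans_le hij'
  rw [loss, ← Real.rpow_natCast, ← Real.rpow_mul hε.le]
  refine Real.rpow_le_rpow_of_exponent_ge hε hε1 ?_
  rw [neg_div, neg_mul]
  refine neg_le_neg (max_le ?_ (by positivity))
  rw [div_mul_eq_mul_div, le_div_iff₀ hj]
  have h1 : ((j : ℝ) - r) * i ≤ max ((j : ℝ) - r) 0 * i := by gcongr; exact le_max_left _ _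
  nlinarith

theorem pow_eq_loss {r ε : ℝ} (hr : 0 ≤ r) (hε : 0 < ε) (j : ℕ) :
    (ε ^ (-max ((j : ℝ) - r) 0 / j)) ^ j = loss r ε j := by
  rcases Nat.eq_zero_or_pos j with rfl | hj
  · rw [pow_zero, loss_zero hr]
  · have : (j : ℝ) ≠ 0 := by positivity
    rw [loss, ← Real.rpow_natCast, ← Real.rpow_mul hε.le, div_mul_cancel₀ _ this]

/-- The chain rule of order `j` wants the derivatives of order `i` bounded by D^i. Since (i-r)_+ ≤
(i/j)(j-r)_+, the choice D = Kε^{-(j-r)_+/j} works, and D^j is exactly the loss of order `j`. -/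
theorem norm_iteratedFDeriv_comp_le_loss {g : ℝ → ℝ} (hg : ContDiff ℝ ∞ g) {r : ℝ} (hr : 0 ≤ r)
    {C : ℕ → ℝ} (hC : ∀ i, 0 ≤ C i) (j : ℕ) : ∃ C' : ℝ, 0 ≤ C' ∧ ∀ {ε : ℝ}, 0 < ε → ε ≤ 1 →
      ∀ {f : E d → ℝ}, ContDiff ℝ ∞ f → (∀ i x, ‖iteratedFDeriv ℝ i f x‖ ≤ C i * loss r ε i) →
      ∀ x, ‖iteratedFDeriv ℝ j (fun x => g (f x)) x‖ ≤ C' * loss r ε j := by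
  choose B hB using fun i : ℕ => (isCompact_closedBall (0 : ℝ) (C 0)).exists_bound_of_continuousOn
    (hg.continuous_iteratedFDeriv (natCast_le_infty i)).continuousOn
  have hB0 : ∀ i, 0 ≤ B i := fun i =>
    (norm_nonneg _).trans (hB i 0 (Metric.mem_closedBall_self (hC 0)))
  set S := ∑ i ∈ Finset.range (j + 1), B i with hS
  set K := 1 + ∑ i ∈ Finset.range (j + 1), C i with hK
  have hS0 : 0 ≤ S := Finset.sum_nonneg fun i _ => hB0 i
  have hK1 : 1 ≤ K := le_add_of_nonneg_right (Finset.sum_nonneg fun i _ => hC i)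
  refine ⟨j.factorial * S * K ^ j, by positivity, fun {ε} hε hε1 {f} hf hfb x => ?_⟩
  have hfx : f x ∈ Metric.closedBall (0 : ℝ) (C 0) := by
    have := hfb 0 x
    rw [norm_iteratedFDeriv_zero, loss_zero hr, mul_one] at this
    simpa using this
  -- Since the loss of order 0 is 1, `f` takes values in the fixed interval [-C 0, C 0], on which
  -- the derivatives of `g` are bounded by `S`.
  have h := norm_iteratedFDeriv_comp_le hg hf (natCast_le_infty j) x (C := S)
    (D := K * ε ^ (-max ((j : ℝ) - r) 0 / j))
    (fun i hi => (hB i _ hfx).trans (Finset.single_le_sum (f := B) (fun i _ => hB0 i)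
      (Finset.mem_range_succ_iff.2 hi)))
    (fun i hi hij => by
      rw [mul_pow]
      refine (hfb i x).trans (mul_le_mul ?_ (loss_le_pow hr hε hε1 hi hij)
        (loss_pos hε i).le (by positivity))
      calc C i ≤ ∑ i ∈ Finset.range (j + 1), C i :=
            Finset.single_le_sum (f := C) (fun i _ => hC i) (Finset.mem_range_succ_iff.2 hij)
        _ ≤ K := by rw [hK]; linarith
        _ ≤ K ^ i := le_self_pow₀ hK1 (by omega))
  rw [mul_pow, pow_eq_loss hr hε, ← mul_assoc] at h
  exact h

/-- The mean of `g` over the segment from `f₀(x)` to `f₁(x)`. -/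
def segmentMean (g : ℝ → ℝ) (f₀ f₁ : E d → ℝ) (x : E d) : ℝ :=
  ∫ t in (0 : ℝ)..1, g (f₀ x + t * (f₁ x - f₀ x))

theorem segmentMean_bounds {g : ℝ → ℝ} (hg : ContDiff ℝ ∞ g) {r : ℝ} (hr : 0 ≤ r)
    {C : ℕ → ℝ} (hC : ∀ i, 0 ≤ C i) : ∃ C' : ℕ → ℝ, (∀ j, 0 ≤ C' j) ∧ ∀ {ε : ℝ}, 0 < ε → ε ≤ 1 →
      ∀ {f₀ f₁ : E d → ℝ}, ContDiff ℝ ∞ f₀ → ContDiff ℝ ∞ f₁ →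
      (∀ i x, ‖iteratedFDeriv ℝ i f₀ x‖ ≤ C i * loss r ε i) →
      (∀ i x, ‖iteratedFDeriv ℝ i f₁ x‖ ≤ C i * loss r ε i) →
      ContDiff ℝ ∞ (segmentMean g f₀ f₁) ∧
      ∀ j x, ‖iteratedFDeriv ℝ j (segmentMean g f₀ f₁) x‖ ≤ C' j * loss r ε j := by
  choose C' hC' hb using fun j => norm_iteratedFDeriv_comp_le_loss (d := d) hg hr
    (C := fun i => 3 * C i) (fun i => by have := hC i; positivity) j
  refine ⟨C', hC', fun {ε} hε hε1 {f₀ f₁} h0 h1 hb0 hb1 => ?_⟩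
  have hsm : ∀ t : ℝ, ContDiff ℝ ∞ fun x => f₀ x + t * (f₁ x - f₀ x) := fun t =>
    h0.add (contDiff_const.mul (h1.sub h0))
  -- Uniform in `t`: the bound 3C comes from f₀ + t(f₁ - f₀), with 0 < t ≤ 1.
  have hseg : ∀ t ∈ Set.Ioc (0 : ℝ) 1, ∀ i x,
      ‖iteratedFDeriv ℝ i (fun x => f₀ x + t * (f₁ x - f₀ x)) x‖ ≤ 3 * C i * loss r ε i := by
    intro t ht i x
    have e1 := norm_iteratedFDeriv_sub_le h1 h0 i x
    have e2 : iteratedFDeriv ℝ i (fun x => t * (f₁ x - f₀ x)) x =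
        t • iteratedFDeriv ℝ i (fun x => f₁ x - f₀ x) x :=
      iteratedFDeriv_const_smul_apply (a := t) (f := fun x => f₁ x - f₀ x) (x := x)
        ((h1.sub h0).of_le (natCast_le_infty i)).contDiffAt
    have e3 := norm_iteratedFDeriv_add_le h0 (contDiff_const.mul (h1.sub h0) :
      ContDiff ℝ ∞ fun x => t * (f₁ x - f₀ x)) i x
    rw [e2, norm_smul, Real.norm_of_nonneg ht.1.le] at e3
    have e4 : t * ‖iteratedFDeriv ℝ i (fun x => f₁ x - f₀ x) x‖ ≤
        ‖iteratedFDeriv ℝ i (fun x => f₁ x - f₀ x) x‖ :=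
      mul_le_of_le_one_left (norm_nonneg _) ht.2
    linarith [hb0 i x, hb1 i x]
  let k : E d → ℝ → ℝ := fun x t => g (f₀ x + t * (f₁ x - f₀ x))
  have hk : ContDiff ℝ ∞ (Function.uncurry k) := by
    refine hg.comp (g := g) (f := fun p : E d × ℝ => f₀ p.1 + p.2 * (f₁ p.1 - f₀ p.1)) ?_
    exact (h0.comp contDiff_fst).add
      (contDiff_snd.mul ((h1.comp contDiff_fst).sub (h0.comp contDiff_fst)))
  have hbound : ∀ j, ∀ᵐ t ∂volume.restrict (Set.Ioc (0 : ℝ) 1),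
      ∀ x ∈ (Set.univ : Set (E d)), ‖iteratedFDeriv ℝ j (fun x => k x t) x‖ ≤ C' j * loss r ε j := by
    intro j
    filter_upwards [ae_restrict_mem measurableSet_Ioc] with t ht x _
    exact hb j hε hε1 (hsm t) (hseg t ht) x
  have key := contDiff_integral_of_dominated (μ := volume.restrict (Set.Ioc (0 : ℝ) 1)) (f := k)
    (fun t => hg.comp (hsm t))
    (fun j x => (continuous_iteratedFDeriv_param hk j x).aestronglyMeasurable)
    (fun j x => ⟨fun _ => C' j * loss r ε j, integrable_const _, Set.univ, Filter.univ_mem,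
      hbound j⟩)
  have heq : segmentMean g f₀ f₁ = fun x => ∫ t in Set.Ioc (0 : ℝ) 1, k x t := funext fun x =>
    intervalIntegral.integral_of_le zero_le_one
  rw [heq]
  refine ⟨key.1, fun j x => ?_⟩
  rw [key.2]
  have h2 : ‖∫ t in Set.Ioc (0 : ℝ) 1, iteratedFDeriv ℝ j (fun x => k x t) x‖ ≤
      C' j * loss r ε j * (volume : Measure ℝ).real (Set.Ioc 0 1) :=
    norm_setIntegral_le_of_norm_le_const (by simp) fun t ht =>
      hb j hε hε1 (hsm t) (hseg t ht) x
  simpa using h2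

/-- Carries the small part of a splitting through the nonlinearity: both segments stay in [-R, R],
and corresponding points are within η of each other. -/
theorem segmentMean_lipschitz {g : ℝ → ℝ} (hg : ContDiff ℝ ∞ g) (R : ℝ) : ∃ L : ℝ, 0 ≤ L ∧
    ∀ {f₀ f₁ h₀ h₁ : E d → ℝ} {η : ℝ} {x : E d}, |f₀ x| ≤ R → |f₁ x| ≤ R → |h₀ x| ≤ R →
      |h₁ x| ≤ R → |f₀ x - h₀ x| ≤ η → |f₁ x - h₁ x| ≤ η →
      |segmentMean g f₀ f₁ x - segmentMean g h₀ h₁ x| ≤ L * η := by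
  obtain ⟨L, hL⟩ := (isCompact_closedBall (0 : ℝ) R).exists_bound_of_continuousOn
    (hg.continuous_deriv (by simp)).continuousOn
  refine ⟨|L|, abs_nonneg L, fun {f₀ f₁ h₀ h₁ η x} hf0 hf1 hh0 hh1 e0 e1 => ?_⟩
  have hmem : ∀ {a b t : ℝ}, |a| ≤ R → |b| ≤ R → t ∈ Set.Ioc (0 : ℝ) 1 →
      a + t * (b - a) ∈ Metric.closedBall (0 : ℝ) R := fun {a b t} ha hb ht => by
    rw [mem_closedBall_zero_iff, Real.norm_eq_abs, abs_le]
    rw [abs_le] at ha hb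
    constructor <;> nlinarith [ht.1, ht.2]
  have hI : ∀ a b : ℝ, IntervalIntegrable (fun t => g (a + t * (b - a))) volume 0 1 := fun a b =>
    (hg.continuous.comp (by fun_prop)).intervalIntegrable _ _
  rw [segmentMean, segmentMean, ← intervalIntegral.integral_sub (hI _ _) (hI _ _)]
  have := intervalIntegral.norm_integral_le_of_norm_le_const (a := (0 : ℝ)) (b := 1)
    (f := fun t => g (f₀ x + t * (f₁ x - f₀ x)) - g (h₀ x + t * (h₁ x - h₀ x))) (C := |L| * η)
    fun t ht => by
      rw [Set.uIoc_of_le zero_le_one] at ht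
      have h2 := (convex_closedBall (0 : ℝ) R).norm_image_sub_le_of_norm_deriv_le (f := g)
        (C := |L|) (fun y _ => hg.differentiable (by simp) y)
        (fun y hy => (hL y hy).trans (le_abs_self L)) (hmem hh0 hh1 ht) (hmem hf0 hf1 ht)
      refine h2.trans (mul_le_mul_of_nonneg_left ?_ (abs_nonneg L))
      rw [Real.norm_eq_abs, abs_le]
      rw [abs_le] at e0 e1
      constructor <;> nlinarith [ht.1, ht.2]
  simpa using this

end Composition

/-! ### Kernels of the cutoffs -/

section Cutoffs

variable {d : ℕ}

theorem exists_bound_iteratedFDeriv_of_zero_outside {V G : Type*} [NormedAddCommGroup V]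
    [NormedSpace ℝ V] [FiniteDimensional ℝ V] [NormedAddCommGroup G] [NormedSpace ℝ G] {f : V → G}
    (hf : ContDiff ℝ ∞ f) {R : ℝ} (h0 : ∀ z, R ≤ ‖z‖ → f z = 0) (j : ℕ) :
    ∃ C : ℝ, ∀ z, ‖iteratedFDeriv ℝ j f z‖ ≤ C := by
  have hc : HasCompactSupport f := HasCompactSupport.intro (isCompact_closedBall (0 : V) R)
    fun z hz => h0 z (by
      rw [mem_closedBall_zero_iff, not_le] at hz
      exact hz.le)
  exact (hf.continuous_iteratedFDeriv (natCast_le_infty j)).bounded_above_of_compact_support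
    (hc.iteratedFDeriv j)

theorem rapidDecay_of_zero_outside {f : E d × E d → ℝ} (hf : ContDiff ℝ ∞ f) {R : ℝ}
    (h0 : ∀ z, R ≤ ‖z‖ → f z = 0) : RapidDecay fun z => (f z : ℂ) := by
  have h := RapidDecay.of_zero_outside hf (exists_bound_iteratedFDeriv_of_zero_outside hf h0)
    (R := R) fun z hz => h0 z (hz.trans (norm_snd_le z))
  exact h.clm_comp Complex.ofRealCLM

/-- The norm of `E d × E d` is the maximum norm, which is dominated by the Euclidean norm used to
normalize φ₀. -/
theorem IsPhaseLPCutoff.eq_zero_of_norm {φ₀ : E d × E d → ℝ} (h : IsPhaseLPCutoff φ₀)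
    (z : E d × E d) (hz : 2 ≤ ‖z‖) : φ₀ z = 0 := by
  refine h.eq_zero z.1 z.2 (hz.trans ?_)
  refine Real.le_sqrt_of_sq_le ?_
  have h1 := sq_nonneg ‖z.1‖
  have h2 := sq_nonneg ‖z.2‖
  rcases max_choice ‖z.1‖ ‖z.2‖ with h' | h' <;> rw [Prod.norm_def, h'] <;> linarith

theorem IsPhaseLPCutoff.rapidDecay {φ₀ : E d × E d → ℝ} (h : IsPhaseLPCutoff φ₀) :
    RapidDecay fun z => (φ₀ z : ℂ) :=
  rapidDecay_of_zero_outside h.smooth h.eq_zero_of_norm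

/-- This is the symbol of Φ_{k+1} seen at the scale 2^{-k}; it allows Φ_k and Φ_{k+1} to be
subtracted as kernels at one scale. -/
theorem IsPhaseLPCutoff.rapidDecay_half {φ₀ : E d × E d → ℝ} (h : IsPhaseLPCutoff φ₀) :
    RapidDecay fun z => (φ₀ ((2 : ℝ)⁻¹ • z) : ℂ) := by
  refine rapidDecay_of_zero_outside (R := 4) (h.smooth.comp (contDiff_const_smul _)) fun z hz =>
    h.eq_zero_of_norm _ ?_
  rw [norm_smul]
  norm_num
  linarith

theorem IsLPCutoff.rapidDecay {ψ₀ : E d → ℝ} (h : IsLPCutoff ψ₀) :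
    RapidDecay (multiplierSymbol fun ξ => (ψ₀ ξ : ℂ)) := by
  have hs : ContDiff ℝ ∞ fun z : E d × E d => ψ₀ z.2 := h.smooth.comp contDiff_snd
  have := RapidDecay.of_zero_outside hs (R := 2) (fun j => ?_) fun z hz => h.eq_zero _ hz
  · exact this.clm_comp Complex.ofRealCLM
  · obtain ⟨C, hC⟩ := exists_bound_iteratedFDeriv_of_zero_outside h.smooth h.eq_zero j
    refine ⟨‖ContinuousLinearMap.snd ℝ (E d) (E d)‖ ^ j * C, fun z => ?_⟩
    have h2 := norm_iteratedFDeriv_comp_affine_le h.smooth (ContinuousLinearMap.snd ℝ (E d) (E d))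
      0 j z
    simp only [add_zero] at h2
    exact h2.trans (by gcongr; exact hC _)

theorem IsLPCutoff.unitKernel {ψ₀ : E d → ℝ} (h : IsLPCutoff ψ₀) :
    UnitKernel (kernel (multiplierSymbol fun ξ => (ψ₀ ξ : ℂ))) :=
  unitKernel_of_eq_one h.rapidDecay fun ξ hξ => by rw [h.eq_one ξ hξ.le, Complex.ofReal_one]

end Cutoffs

/-! ### The splitting of a function of class C^r -/

section HolderSmoothing

variable {d : ℕ}

theorem MemHolder.exists_bound {r : ℝ} {u : E d → ℝ} (hu : MemHolder r u) :
    ∃ B : ℝ, ∀ x, ‖(u x : ℂ)‖ ≤ B := by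
  obtain ⟨B, hB⟩ := hu.bounded 0 (Nat.zero_le _)
  refine ⟨B, fun x => ?_⟩
  simpa using hB x

theorem MemHolder.continuous {r : ℝ} {u : E d → ℝ} (hu : MemHolder r u) :
    Continuous fun x => (u x : ℂ) :=
  Complex.continuous_ofReal.comp hu.contDiff.continuous

/-- Smooth approximation of a function of class `C^r` at scale `ε`. -/
theorem UnitKernel.smoothing {κ : E d × E d → ℂ} (hκ : UnitKernel κ) {r : ℝ} (hr : 0 < r)
    {u : E d → ℝ} (hu : MemHolder r u) : ∃ (Ca : ℕ → ℝ) (Cb : ℝ), (∀ i, 0 ≤ Ca i) ∧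
      ∀ {ε : ℝ}, 0 < ε → ε ≤ 1 → SmoothBounded (kernelOp κ ε fun x => (u x : ℂ)) ∧
        (∀ i x, ‖iteratedFDeriv ℝ i (kernelOp κ ε fun x => (u x : ℂ)) x‖ ≤ Ca i * loss r ε i) ∧
        ∀ x, ‖(u x : ℂ) - kernelOp κ ε (fun x => (u x : ℂ)) x‖ ≤ Cb * ε ^ r := by
  have hn : ((⌊r⌋₊ : ℕ) : ℝ) ≤ r := Nat.floor_le hr.le
  have hn1 : r < (⌊r⌋₊ : ℕ) + 1 := Nat.lt_floor_add_one r
  obtain ⟨hsm, hbd, H, hH⟩ := hu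
  have hu' : MemHolder r u := ⟨hsm, hbd, H, hH⟩
  set n := ⌊r⌋₊
  have hder : ∀ i ≤ n, ∀ x, iteratedFDeriv ℝ i (fun x => (u x : ℂ)) x =
      Complex.ofRealCLM.compContinuousMultilinearMap (iteratedFDeriv ℝ i u x) := fun i hi x =>
    Complex.ofRealCLM.iteratedFDeriv_comp_left hsm.contDiffAt (by exact_mod_cast hi)
  have hsmc : ContDiff ℝ n fun x => (u x : ℂ) := Complex.ofRealCLM.contDiff.comp hsm
  have hle : ∀ {i : ℕ} (A : ContinuousMultilinearMap ℝ (fun _ : Fin i => E d) ℝ),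
      ‖Complex.ofRealCLM.compContinuousMultilinearMap A‖ ≤ ‖A‖ := fun A =>
    (ContinuousLinearMap.norm_compContinuousMultilinearMap_le _ _).trans (by simp)
  have hbdc : ∀ i ≤ n, ∃ B : ℝ, ∀ x, ‖iteratedFDeriv ℝ i (fun x => (u x : ℂ)) x‖ ≤ B := by
    intro i hi
    obtain ⟨B, hB⟩ := hbd i hi
    exact ⟨B, fun x => by rw [hder i hi]; exact (hle _).trans (hB x)⟩
  have hholc : ∀ x y, ‖iteratedFDeriv ℝ n (fun x => (u x : ℂ)) x -
      iteratedFDeriv ℝ n (fun x => (u x : ℂ)) y‖ ≤ |H| * ‖x - y‖ ^ (r - n) := fun x y => by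
    have e : Complex.ofRealCLM.compContinuousMultilinearMap (iteratedFDeriv ℝ n u x) -
        Complex.ofRealCLM.compContinuousMultilinearMap (iteratedFDeriv ℝ n u y) =
        Complex.ofRealCLM.compContinuousMultilinearMap
          (iteratedFDeriv ℝ n u x - iteratedFDeriv ℝ n u y) := by
      ext v; simp
    rw [hder n le_rfl, hder n le_rfl, e]
    refine ((hle _).trans (hH x y)).trans ?_
    gcongr
    exact le_abs_self H
  have hs0 : 0 ≤ r - n := by linarith
  choose C hC using hκ.norm_iteratedFDeriv_kernelOp_le_loss (abs_nonneg H) hs0 (by linarith) n hsmc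
    hbdc hholc
  obtain ⟨Cb, -, hCb⟩ := hκ.norm_kernelOp_sub_le n hs0
  obtain ⟨B, hB⟩ := hu'.exists_bound
  simp only [add_sub_cancel] at hC hCb
  refine ⟨fun i => |C i|, Cb * |H|, fun i => abs_nonneg _, fun {ε} hε hε1 => ⟨?_, ?_, ?_⟩⟩
  · exact SmoothBounded.kernelOp hκ.decay hε hε1 hu'.continuous hB
  · refine fun i x => (hC i hε hε1 x).trans ?_
    have := loss_pos (r := r) hε i
    gcongr
    exact le_abs_self _
  · intro x
    rw [norm_sub_rev, mul_assoc]
    exact hCb hε hsmc ⟨B, hB⟩ (abs_nonneg H) hholc x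

end HolderSmoothing

/-! ### The functions Φ_k(x,D)u -/

section LowFrequencyPart

variable {d : ℕ}

theorem norm_iteratedFDeriv_re_le {f : E d → ℂ} (hf : ContDiff ℝ ∞ f) (j : ℕ) (x : E d) :
    ‖iteratedFDeriv ℝ j (fun x => (f x).re) x‖ ≤ ‖iteratedFDeriv ℝ j f x‖ := by
  have := Complex.reCLM.norm_iteratedFDeriv_comp_left hf.contDiffAt (x := x) (natCast_le_infty j)
  rwa [Complex.reCLM_norm, one_mul] at this

theorem norm_iteratedFDeriv_ofReal_le {f : E d → ℝ} (hf : ContDiff ℝ ∞ f) (j : ℕ) (x : E d) :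
    ‖iteratedFDeriv ℝ j (fun x => (f x : ℂ)) x‖ ≤ ‖iteratedFDeriv ℝ j f x‖ := by
  have := Complex.ofRealCLM.norm_iteratedFDeriv_comp_left hf.contDiffAt (x := x)
    (natCast_le_infty j)
  rwa [Complex.ofRealCLM_norm, one_mul] at this

/-- `Φ_k(x, D) u`. -/
def lowFreq (φ₀ : E d × E d → ℝ) (u : E d → ℝ) (k : ℕ) : E d → ℝ := realOp (bigPhi φ₀ k) u

theorem lowFreq_eq (φ₀ : E d × E d → ℝ) (u : E d → ℝ) (k : ℕ) :
    lowFreq φ₀ u k = fun x =>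
      (kernelOp (kernel fun z => (φ₀ z : ℂ)) ((2 : ℝ) ^ k)⁻¹ (fun y => (u y : ℂ)) x).re := by
  ext x
  rw [← pseudoDiff_eq_kernelOp _ (by positivity)]
  rfl

theorem lowFreq_succ_eq (φ₀ : E d × E d → ℝ) (u : E d → ℝ) (k : ℕ) :
    lowFreq φ₀ u (k + 1) = fun x => (kernelOp (kernel fun z => (φ₀ ((2 : ℝ)⁻¹ • z) : ℂ))
      ((2 : ℝ) ^ k)⁻¹ (fun y => (u y : ℂ)) x).re := by
  ext x
  rw [← pseudoDiff_eq_kernelOp _ (by positivity)]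
  have : ∀ z : E d × E d, bigPhi φ₀ (k + 1) z = φ₀ ((2 : ℝ)⁻¹ • ((2 : ℝ) ^ k)⁻¹ • z) := fun z => by
    rw [bigPhi, smul_smul, pow_succ, mul_inv, mul_comm]
  simp only [lowFreq, realOp, this]
  rfl

/-- Linearity in the symbol, justified by convergence of both kernel integrals. It turns Φ_k u +
tφ_{k+1}u into a point of the segment from Φ_k u to Φ_{k+1}u. -/
theorem realOp_smallPhi_eq {φ₀ : E d × E d → ℝ} (hφ : IsPhaseLPCutoff φ₀) {u : E d → ℝ}
    (hc : Continuous fun x => (u x : ℂ)) {B : ℝ} (hB : ∀ x, ‖(u x : ℂ)‖ ≤ B) (k : ℕ) (x : E d) :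
    realOp (smallPhi φ₀ (k + 1)) u x = lowFreq φ₀ u (k + 1) x - lowFreq φ₀ u k x := by
  set a : E d × E d → ℂ := fun z => (φ₀ z : ℂ)
  set b : E d × E d → ℂ := fun z => (φ₀ ((2 : ℝ)⁻¹ • z) : ℂ)
  have ha : RapidDecay a := hφ.rapidDecay
  have hb : RapidDecay b := hφ.rapidDecay_half
  have hker : ∀ z, kernel (fun z => b z - a z) z = kernel b z - kernel a z := fun z => by
    simp only [kernel, partialFourier, smul_sub]
    rw [integral_sub (hb.integrable_phase_smul z.1 z.2) (ha.integrable_phase_smul z.1 z.2), mul_sub]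
  have h1 : kernelOp (kernel fun z => b z - a z) ((2 : ℝ) ^ k)⁻¹ (fun y => (u y : ℂ)) x =
      kernelOp (kernel b) ((2 : ℝ) ^ k)⁻¹ (fun y => (u y : ℂ)) x -
        kernelOp (kernel a) ((2 : ℝ) ^ k)⁻¹ (fun y => (u y : ℂ)) x := by
    simp only [kernelOp, hker, sub_smul]
    exact integral_sub (hb.kernel.integrable_kernelOp _ hc hB x)
      (ha.kernel.integrable_kernelOp _ hc hB x)
  rw [lowFreq_succ_eq, lowFreq_eq, ← Complex.sub_re, ← h1,
    ← pseudoDiff_eq_kernelOp _ (by positivity)]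
  have h2 : ∀ z : E d × E d, smallPhi φ₀ (k + 1) z =
      φ₀ ((2 : ℝ)⁻¹ • ((2 : ℝ) ^ k)⁻¹ • z) - φ₀ (((2 : ℝ) ^ k)⁻¹ • z) := fun z => by
    change φ₀ (((2 : ℝ) ^ (k + 1))⁻¹ • z) - φ₀ (((2 : ℝ) ^ k)⁻¹ • z) = _
    rw [smul_smul, pow_succ, mul_inv, mul_comm]
  simp only [realOp, h2, a, b]
  push_cast
  rfl

end LowFrequencyPart

/-! ### Estimates for m_k, its smoothing and the remainder -/

section Coefficients

variable {d : ℕ} {ψ₀ : E d → ℝ} {φ₀ : E d × E d → ℝ} {r : ℝ} {u : E d → ℝ}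

/-- At every scale `ε`, the functions `Φ_k(x, D) u` split into a part that is smooth at the
scale `ε` and a part of size `ε ^ r`. -/
theorem exists_lowFreq_split (hψ : IsLPCutoff ψ₀) (hφ : IsPhaseLPCutoff φ₀) (hr : 0 < r)
    (hu : MemHolder r u) : ∃ C : ℕ → ℝ, (∀ i, 0 ≤ C i) ∧ ∀ {ε : ℝ}, 0 < ε → ε ≤ 1 →
      ∃ A : ℕ → E d → ℝ, ∀ k, ContDiff ℝ ∞ (lowFreq φ₀ u k) ∧ ContDiff ℝ ∞ (A k) ∧
        (∀ i x, ‖iteratedFDeriv ℝ i (A k) x‖ ≤ C i * loss r ε i) ∧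
        ∀ i x, ‖iteratedFDeriv ℝ i (fun x => lowFreq φ₀ u k x - A k x) x‖ ≤
          C i * (((2 : ℝ) ^ k) ^ i * ε ^ r) := by
  obtain ⟨Ca, Cb, hCa, hsplit⟩ := hψ.unitKernel.smoothing hr hu
  choose C hC0 hC using fun j => hφ.rapidDecay.kernel.norm_iteratedFDeriv_kernelOp_le_of_approx r
    (Ca := Ca) (Cb := Cb) hCa j
  refine ⟨C, hC0, fun {ε} hε hε1 => ?_⟩
  obtain ⟨ha, hab, hb⟩ := hsplit hε hε1
  -- The smooth part is Φ_k(x,D) applied to ψ₀(εD)u, with ε independent of `k`.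
  refine ⟨fun k x => (kernelOp (kernel fun z => (φ₀ z : ℂ)) ((2 : ℝ) ^ k)⁻¹
    (kernelOp (kernel (multiplierSymbol fun ξ => (ψ₀ ξ : ℂ))) ε fun x => (u x : ℂ)) x).re,
    fun k => ?_⟩
  have hσ : 0 < ((2 : ℝ) ^ k)⁻¹ := by positivity
  have hσ1 : ((2 : ℝ) ^ k)⁻¹ ≤ 1 := inv_le_one_of_one_le₀ (one_le_pow₀ one_le_two)
  have key := fun j => hC j hε hε1 hσ hσ1 hu.continuous ha hab hb
  obtain ⟨h1, h2, -, -⟩ := key 0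
  rw [lowFreq_eq]
  refine ⟨Complex.reCLM.contDiff.comp h1, Complex.reCLM.contDiff.comp h2, fun i x => ?_,
    fun i x => ?_⟩
  · exact (norm_iteratedFDeriv_re_le h2 i x).trans ((key i).2.2.1 x)
  · have h3 := norm_iteratedFDeriv_re_le (h1.sub h2) i x
    have h4 := (key i).2.2.2 x
    rw [inv_pow, inv_inv] at h4
    simp only [Complex.sub_re] at h3
    exact h3.trans h4

/-- The splitting at ε = 2^{-k}, with its parts added. Allowing l ≤ k + 1 covers both endpoints of
the segment defining m_k and accounts for the factor 2^i. -/
theorem exists_lowFreq_bound (hψ : IsLPCutoff ψ₀) (hφ : IsPhaseLPCutoff φ₀) (hr : 0 < r)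
    (hu : MemHolder r u) : ∃ C : ℕ → ℝ, (∀ i, 0 ≤ C i) ∧ ∀ {k l : ℕ}, l ≤ k + 1 → ∀ i x,
      ‖iteratedFDeriv ℝ i (lowFreq φ₀ u l) x‖ ≤ C i * loss r ((2 : ℝ) ^ k)⁻¹ i := by
  obtain ⟨C, hC0, hC⟩ := exists_lowFreq_split hψ hφ hr hu
  refine ⟨fun i => (2 ^ i + 1) * C i, fun i => by have := hC0 i; positivity,
    fun {k l} hl i x => ?_⟩
  have hε : 0 < ((2 : ℝ) ^ k)⁻¹ := by positivity
  have hε1 : ((2 : ℝ) ^ k)⁻¹ ≤ 1 := inv_le_one_of_one_le₀ (one_le_pow₀ one_le_two)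
  obtain ⟨A, hA⟩ := hC hε hε1
  obtain ⟨h1, h2, h3, h4⟩ := hA l
  have h5 := norm_iteratedFDeriv_add_le (h1.sub h2) h2 i x
  simp only [sub_add_cancel] at h5
  refine h5.trans ((add_le_add (h4 i x) (h3 i x)).trans ?_)
  have h6 : ((2 : ℝ) ^ l) ^ i ≤ 2 ^ i * ((((2 : ℝ) ^ k)⁻¹) ^ i)⁻¹ := by
    rw [inv_pow, inv_inv, ← mul_pow, ← pow_succ']
    gcongr
    exact one_le_two
  have h7 := inv_pow_mul_rpow_le_loss (r := r) hε hε1 i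
  have h8 := hC0 i
  have h9 : C i * (((2 : ℝ) ^ l) ^ i * ((2 : ℝ) ^ k)⁻¹ ^ r) ≤
      C i * (2 ^ i * loss r ((2 : ℝ) ^ k)⁻¹ i) := by
    refine mul_le_mul_of_nonneg_left ?_ h8
    refine le_trans ?_ (mul_le_mul_of_nonneg_left h7 (by positivity : (0 : ℝ) ≤ 2 ^ i))
    rw [← mul_assoc]
    gcongr
  linarith

theorem contDiff_lowFreq (hψ : IsLPCutoff ψ₀) (hφ : IsPhaseLPCutoff φ₀) (hr : 0 < r)
    (hu : MemHolder r u) (k : ℕ) : ContDiff ℝ ∞ (lowFreq φ₀ u k) := by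
  obtain ⟨C, -, hC⟩ := exists_lowFreq_split hψ hφ hr hu
  obtain ⟨A, hA⟩ := hC one_pos le_rfl
  exact (hA k).1

theorem mCoeff_eq_segmentMean (hφ : IsPhaseLPCutoff φ₀) (hu : MemHolder r u) (F : ℝ → ℝ) (k : ℕ) :
    mCoeff φ₀ F u k = segmentMean (deriv F) (lowFreq φ₀ u k) (lowFreq φ₀ u (k + 1)) := by
  obtain ⟨B, hB⟩ := hu.exists_bound
  ext x
  simp only [mCoeff, realOp_smallPhi_eq hφ hu.continuous hB]
  rfl

variable {F : ℝ → ℝ}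

theorem exists_mCoeff_bound (hψ : IsLPCutoff ψ₀) (hφ : IsPhaseLPCutoff φ₀)
    (hF : ContDiff ℝ ∞ F) (hr : 0 < r) (hu : MemHolder r u) : ∃ C : ℕ → ℝ, (∀ i, 0 ≤ C i) ∧ ∀ k,
      ContDiff ℝ ∞ (mCoeff φ₀ F u k) ∧
      ∀ i x, ‖iteratedFDeriv ℝ i (mCoeff φ₀ F u k) x‖ ≤ C i * loss r ((2 : ℝ) ^ k)⁻¹ i := by
  have hF' : ContDiff ℝ ∞ (deriv F) := (contDiff_infty_iff_deriv.1 hF).2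
  obtain ⟨C, hC0, hC⟩ := exists_lowFreq_bound hψ hφ hr hu
  obtain ⟨C', hC0', hC'⟩ := segmentMean_bounds (d := d) hF' hr.le hC0
  refine ⟨C', hC0', fun k => ?_⟩
  rw [mCoeff_eq_segmentMean hφ hu]
  exact hC' (by positivity) (inv_le_one_of_one_le₀ (one_le_pow₀ one_le_two))
    (contDiff_lowFreq hψ hφ hr hu k) (contDiff_lowFreq hψ hφ hr hu (k + 1))
    (hC (Nat.le_succ k)) (hC le_rfl)

/-- The smooth part `a` is the segment mean built from the smooth parts of Φ_k u and Φ_{k+1}u; the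
Lipschitz bound controls the difference. Constants depend neither on `k` nor on ε, so ε can later be
coupled to `k`. -/
theorem exists_mCoeff_split (hψ : IsLPCutoff ψ₀) (hφ : IsPhaseLPCutoff φ₀)
    (hF : ContDiff ℝ ∞ F) (hr : 0 < r) (hu : MemHolder r u) : ∃ (Ca : ℕ → ℝ) (Cb : ℝ),
      (∀ i, 0 ≤ Ca i) ∧ ∀ {ε : ℝ}, 0 < ε → ε ≤ 1 → ∀ k, ∃ a : E d → ℝ, ContDiff ℝ ∞ a ∧
        (∀ i x, ‖iteratedFDeriv ℝ i a x‖ ≤ Ca i * loss r ε i) ∧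
        ∀ x, |mCoeff φ₀ F u k x - a x| ≤ Cb * ε ^ r := by
  have hF' : ContDiff ℝ ∞ (deriv F) := (contDiff_infty_iff_deriv.1 hF).2
  obtain ⟨C, hC0, hC⟩ := exists_lowFreq_split hψ hφ hr hu
  obtain ⟨D, hD0, hD⟩ := exists_lowFreq_bound hψ hφ hr hu
  obtain ⟨C', hC0', hC'⟩ := segmentMean_bounds (d := d) hF' hr.le hC0
  obtain ⟨L, hL0, hL⟩ := segmentMean_lipschitz (d := d) hF' (C 0 + D 0)
  refine ⟨C', L * C 0, hC0', fun {ε} hε hε1 k => ?_⟩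
  obtain ⟨A, hA⟩ := hC hε hε1
  obtain ⟨h1, h2⟩ := hC' hε hε1 (hA k).2.1 (hA (k + 1)).2.1 (hA k).2.2.1 (hA (k + 1)).2.2.1
  refine ⟨_, h1, h2, fun x => ?_⟩
  rw [mCoeff_eq_segmentMean hφ hu, mul_assoc]
  have hlow : ∀ l, |lowFreq φ₀ u l x| ≤ C 0 + D 0 := fun l => by
    have := hD (Nat.le_succ l) 0 x
    rw [norm_iteratedFDeriv_zero, loss_zero hr.le, mul_one, Real.norm_eq_abs] at this
    linarith [hC0 0]
  have hA0 : ∀ l, |A l x| ≤ C 0 + D 0 := fun l => by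
    have := (hA l).2.2.1 0 x
    rw [norm_iteratedFDeriv_zero, loss_zero hr.le, mul_one, Real.norm_eq_abs] at this
    linarith [hD0 0]
  have hdiff : ∀ l, |lowFreq φ₀ u l x - A l x| ≤ C 0 * ε ^ r := fun l => by
    have := (hA l).2.2.2 0 x
    rwa [norm_iteratedFDeriv_zero, pow_zero, one_mul, Real.norm_eq_abs] at this
  exact hL (hlow _) (hlow _) (hA0 _) (hA0 _) (hdiff _) (hdiff _)

theorem mSmooth_eq_kernelOp (ψ₀ : E d → ℝ) (φ₀ : E d × E d → ℝ) (δ : ℝ) (F : ℝ → ℝ)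
    (u : E d → ℝ) (k : ℕ) : mSmooth ψ₀ φ₀ δ F u k =
      kernelOp (kernel (multiplierSymbol fun ξ => (ψ₀ ξ : ℂ))) ((2 : ℝ) ^ (-((k : ℝ) * δ)))
        (fun y => (mCoeff φ₀ F u k y : ℂ)) := by
  ext x
  rw [← pseudoDiff_eq_kernelOp _ (by positivity)]
  rfl

variable {δ : ℝ}

theorem two_rpow_neg_mul (k : ℕ) (δ : ℝ) : (2 : ℝ) ^ (-((k : ℝ) * δ)) = ((2 : ℝ) ^ k) ^ (-δ) := by
  rw [← Real.rpow_natCast, ← Real.rpow_mul zero_le_two, mul_neg]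

/-- The splitting is used at the scale ε = 2^{-kδ} of the multiplier, where the loss equals
2^{kδ(i-r)_+}. -/
theorem exists_mSmooth_bound (hψ : IsLPCutoff ψ₀) (hφ : IsPhaseLPCutoff φ₀)
    (hF : ContDiff ℝ ∞ F) (hr : 0 < r) (hu : MemHolder r u) (hδ : 0 < δ) : ∃ C : ℕ → ℝ, ∀ k,
      ContDiff ℝ ∞ (mSmooth ψ₀ φ₀ δ F u k) ∧
      ∀ i x, ‖iteratedFDeriv ℝ i (mSmooth ψ₀ φ₀ δ F u k) x‖ ≤
        C i * ((2 : ℝ) ^ k) ^ (δ * max ((i : ℝ) - r) 0) := by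
  obtain ⟨Ca, Cb, hCa, hsplit⟩ := exists_mCoeff_split hψ hφ hF hr hu
  obtain ⟨Cm, hCm, hm⟩ := exists_mCoeff_bound hψ hφ hF hr hu
  choose C hC0 hC using fun j =>
    hψ.unitKernel.decay.norm_iteratedFDeriv_kernelOp_le_loss_of_approx r
      (Ca := Ca) (Cb := Cb) hCa j
  refine ⟨C, fun k => ?_⟩
  have hε : 0 < (2 : ℝ) ^ (-((k : ℝ) * δ)) := by positivity
  have hε1 : (2 : ℝ) ^ (-((k : ℝ) * δ)) ≤ 1 :=
    Real.rpow_le_one_of_one_le_of_nonpos one_le_two (by simpa using by positivity)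
  have hloss : ∀ i : ℕ, ((2 : ℝ) ^ k) ^ (δ * max ((i : ℝ) - r) 0) =
      loss r ((2 : ℝ) ^ (-((k : ℝ) * δ))) i := fun i => by
    rw [loss, two_rpow_neg_mul, ← Real.rpow_mul (by positivity), neg_mul_neg]
  obtain ⟨a, ha, hab, hb⟩ := hsplit hε hε1 k
  obtain ⟨hms, hmb⟩ := hm k
  have hsm : ContDiff ℝ ∞ fun x => (mCoeff φ₀ F u k x : ℂ) := Complex.ofRealCLM.contDiff.comp hms
  have habc : ∀ i x, ‖iteratedFDeriv ℝ i (fun x => (a x : ℂ)) x‖ ≤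
      Ca i * loss r ((2 : ℝ) ^ (-((k : ℝ) * δ))) i := fun i x =>
    (norm_iteratedFDeriv_ofReal_le ha i x).trans (hab i x)
  have hac : SmoothBounded fun x => (a x : ℂ) :=
    ⟨Complex.ofRealCLM.contDiff.comp ha, fun i => ⟨_, habc i⟩⟩
  have hbc : ∀ x, ‖(mCoeff φ₀ F u k x : ℂ) - a x‖ ≤
      Cb * ((2 : ℝ) ^ (-((k : ℝ) * δ))) ^ r := fun x => by
    rw [← Complex.ofReal_sub, Complex.norm_real]
    exact hb x
  have hmc : SmoothBounded fun x => (mCoeff φ₀ F u k x : ℂ) :=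
    ⟨hsm, fun i => ⟨_, fun x => (norm_iteratedFDeriv_ofReal_le hms i x).trans (hmb i x)⟩⟩
  obtain ⟨B, hB⟩ := hmc.norm_le
  rw [mSmooth_eq_kernelOp]
  refine ⟨(SmoothBounded.kernelOp hψ.unitKernel.decay hε hε1 hsm.continuous hB).smooth,
    fun i x => ?_⟩
  rw [hloss]
  exact hC i hε hε1 hsm.continuous hac habc hbc x

/-- Two scales meet: ε = 2^{-kδ} from the multiplier and τ = 2^{-k} from Φ_k, with τ ≤ ε because δ <
1. The resulting τ^{-i}ε^r is 2^{k(i-δr)}. -/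
theorem exists_mCoeff_sub_mSmooth_bound (hψ : IsLPCutoff ψ₀) (hφ : IsPhaseLPCutoff φ₀)
    (hF : ContDiff ℝ ∞ F) (hr : 0 < r) (hu : MemHolder r u) (hδ : 0 < δ) (hδ1 : δ < 1) :
    ∃ C : ℕ → ℝ, ∀ k,
      ContDiff ℝ ∞ (fun x => (mCoeff φ₀ F u k x : ℂ) - mSmooth ψ₀ φ₀ δ F u k x) ∧
      ∀ i x, ‖iteratedFDeriv ℝ i
          (fun x => (mCoeff φ₀ F u k x : ℂ) - mSmooth ψ₀ φ₀ δ F u k x) x‖ ≤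
        C i * ((2 : ℝ) ^ k) ^ ((i : ℝ) - δ * r) := by
  obtain ⟨Ca, Cb, hCa, hsplit⟩ := exists_mCoeff_split hψ hφ hF hr hu
  obtain ⟨Cm, hCm, hm⟩ := exists_mCoeff_bound hψ hφ hF hr hu
  choose C hC using fun j =>
    hψ.unitKernel.norm_iteratedFDeriv_sub_kernelOp_le hr (Ca := Ca) (Cb := Cb) hCa hCm j
  refine ⟨C, fun k => ?_⟩
  have hε : 0 < (2 : ℝ) ^ (-((k : ℝ) * δ)) := by positivity
  have hε1 : (2 : ℝ) ^ (-((k : ℝ) * δ)) ≤ 1 :=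
    Real.rpow_le_one_of_one_le_of_nonpos one_le_two (by simpa using by positivity)
  have hτε : ((2 : ℝ) ^ k)⁻¹ ≤ (2 : ℝ) ^ (-((k : ℝ) * δ)) := by
    rw [← Real.rpow_natCast, ← Real.rpow_neg zero_le_two]
    refine Real.rpow_le_rpow_of_exponent_le one_le_two (neg_le_neg ?_)
    exact mul_le_of_le_one_right (Nat.cast_nonneg k) hδ1.le
  have hloss : ∀ i : ℕ, ((2 : ℝ) ^ k) ^ ((i : ℝ) - δ * r) =
      ((((2 : ℝ) ^ k)⁻¹) ^ i)⁻¹ * ((2 : ℝ) ^ (-((k : ℝ) * δ))) ^ r := fun i => by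
    rw [two_rpow_neg_mul, ← Real.rpow_mul (by positivity), inv_pow, inv_inv,
      ← Real.rpow_natCast (2 ^ k) i, ← Real.rpow_add (by positivity), neg_mul, sub_eq_add_neg]
  obtain ⟨a, ha, hab, hb⟩ := hsplit hε hε1 k
  obtain ⟨hms, hmb⟩ := hm k
  have hsm : ContDiff ℝ ∞ fun x => (mCoeff φ₀ F u k x : ℂ) := Complex.ofRealCLM.contDiff.comp hms
  have habc : ∀ i x, ‖iteratedFDeriv ℝ i (fun x => (a x : ℂ)) x‖ ≤
      Ca i * loss r ((2 : ℝ) ^ (-((k : ℝ) * δ))) i := fun i x =>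
    (norm_iteratedFDeriv_ofReal_le ha i x).trans (hab i x)
  have hac : SmoothBounded fun x => (a x : ℂ) :=
    ⟨Complex.ofRealCLM.contDiff.comp ha, fun i => ⟨_, habc i⟩⟩
  have hbc : ∀ x, ‖(mCoeff φ₀ F u k x : ℂ) - a x‖ ≤
      Cb * ((2 : ℝ) ^ (-((k : ℝ) * δ))) ^ r := fun x => by
    rw [← Complex.ofReal_sub, Complex.norm_real]
    exact hb x
  have hmbc : ∀ i x, ‖iteratedFDeriv ℝ i (fun x => (mCoeff φ₀ F u k x : ℂ)) x‖ ≤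
      Cm i * loss r ((2 : ℝ) ^ k)⁻¹ i := fun i x =>
    (norm_iteratedFDeriv_ofReal_le hms i x).trans (hmb i x)
  have hmc : SmoothBounded fun x => (mCoeff φ₀ F u k x : ℂ) := ⟨hsm, fun i => ⟨_, hmbc i⟩⟩
  obtain ⟨B, hB⟩ := hmc.norm_le
  rw [mSmooth_eq_kernelOp]
  refine ⟨hsm.sub (SmoothBounded.kernelOp hψ.unitKernel.decay hε hε1 hsm.continuous hB).smooth,
    fun i x => ?_⟩
  rw [hloss]
  exact hC i hε1 (by positivity) hτε hmc hac habc hbc hmbc x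

end Coefficients

/-! ### From multi-index derivatives to iterated directional derivatives -/

section IteratedDirectionalDerivatives

variable {V : Type*} [NormedAddCommGroup V] [NormedSpace ℝ V]

/-- `D_{v_1} ⋯ D_{v_n} f` for a list of directions. -/
def listDeriv (L : List V) (f : V → ℂ) : V → ℂ := L.foldr dirDeriv f

@[simp]
theorem listDeriv_cons (v : V) (L : List V) (f : V → ℂ) :
    listDeriv (v :: L) f = dirDeriv v (listDeriv L f) := rfl

theorem iterate_dirDeriv (v : V) (n : ℕ) (f : V → ℂ) :
    (dirDeriv v)^[n] f = listDeriv (List.replicate n v) f := by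
  induction n with
  | zero => rfl
  | succ n ih => rw [Function.iterate_succ_apply', ih, List.replicate_succ, listDeriv_cons]

theorem exists_multiDeriv_eq_listDeriv {d : ℕ} (v : Fin d → V) (α : Fin d → ℕ) :
    ∃ L : List V, L.length = multiLen α ∧ (∀ v' ∈ L, ∃ i, v' = v i) ∧
      ∀ f, multiDeriv v α f = listDeriv L f := by
  have key : ∀ l : List (Fin d), ∃ L : List V, L.length = (l.map α).sum ∧
      (∀ v' ∈ L, ∃ i, v' = v i) ∧
      ∀ f, l.foldr (fun i g => (dirDeriv (v i))^[α i] g) f = listDeriv L f := by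
    intro l
    induction l with
    | nil => exact ⟨[], rfl, by simp, fun f => rfl⟩
    | cons i l ih =>
      obtain ⟨L, h1, h2, h3⟩ := ih
      refine ⟨List.replicate (α i) (v i) ++ L, by simp [h1], ?_, fun f => ?_⟩
      · intro v' hv'
        rcases List.mem_append.1 hv' with h | h
        · exact ⟨i, List.eq_of_mem_replicate h⟩
        · exact h2 v' h
      · rw [List.foldr_cons, h3, iterate_dirDeriv, listDeriv, listDeriv, listDeriv,
          List.foldr_append]
  obtain ⟨L, h1, h2, h3⟩ := key (List.finRange d)
  exact ⟨L, by rw [h1, multiLen, Fin.sum_univ_def], h2, h3⟩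

theorem contDiff_dirDeriv {f : V → ℂ} (hf : ContDiff ℝ ∞ f) (v : V) :
    ContDiff ℝ ∞ (dirDeriv v f) :=
  (hf.fderiv_right (m := ∞) (by simp)).clm_apply contDiff_const

theorem contDiff_listDeriv {f : V → ℂ} (hf : ContDiff ℝ ∞ f) (L : List V) :
    ContDiff ℝ ∞ (listDeriv L f) := by
  induction L with
  | nil => exact hf
  | cons v L ih => exact contDiff_dirDeriv ih v

theorem listDeriv_congr {f g : V → ℂ} {z : V} (h : f =ᶠ[nhds z] g) (L : List V) :
    listDeriv L f =ᶠ[nhds z] listDeriv L g := by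
  induction L with
  | nil => exact h
  | cons v L ih =>
    filter_upwards [ih.fderiv (𝕜 := ℝ)] with y hy
    rw [listDeriv_cons, listDeriv_cons, dirDeriv, dirDeriv, hy]

theorem listDeriv_zero (L : List V) : listDeriv L (fun _ => 0) = fun _ => 0 := by
  induction L with
  | nil => rfl
  | cons v L ih => rw [listDeriv_cons, ih]; ext z; simp [dirDeriv]

theorem listDeriv_sum {ι : Type*} {f : ι → V → ℂ} (hf : ∀ i, ContDiff ℝ ∞ (f i)) (s : Finset ι)
    (L : List V) : listDeriv L (fun z => ∑ i ∈ s, f i z) = fun z => ∑ i ∈ s, listDeriv L (f i) z := by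
  induction L with
  | nil => rfl
  | cons v L ih =>
    ext z
    rw [listDeriv_cons, ih, dirDeriv, fderiv_fun_sum fun i _ =>
      (contDiff_listDeriv (hf i) L).differentiable (by simp) z]
    simp [dirDeriv]

theorem norm_iteratedFDeriv_dirDeriv_le {f : V → ℂ} (hf : ContDiff ℝ ∞ f) {v : V} (hv : ‖v‖ ≤ 1)
    (j : ℕ) (z : V) : ‖iteratedFDeriv ℝ j (dirDeriv v f) z‖ ≤ ‖iteratedFDeriv ℝ (j + 1) f z‖ := by
  have hf' : ContDiff ℝ ∞ (fderiv ℝ f) := hf.fderiv_right (m := ∞) (by simp)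
  have h := (ContinuousLinearMap.apply ℝ ℂ v).norm_iteratedFDeriv_comp_left (f := fderiv ℝ f)
    hf'.contDiffAt (x := z) (natCast_le_infty j)
  rw [norm_iteratedFDeriv_fderiv] at h
  refine h.trans (mul_le_of_le_one_left (norm_nonneg _) ?_)
  refine ContinuousLinearMap.opNorm_le_bound _ zero_le_one fun A => ?_
  rw [ContinuousLinearMap.apply_apply, one_mul]
  exact (A.le_opNorm v).trans (mul_le_of_le_one_right (norm_nonneg _) hv)

theorem norm_iteratedFDeriv_listDeriv_le {f : V → ℂ} (hf : ContDiff ℝ ∞ f) {L : List V}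
    (hL : ∀ v ∈ L, ‖v‖ ≤ 1) (j : ℕ) (z : V) :
    ‖iteratedFDeriv ℝ j (listDeriv L f) z‖ ≤ ‖iteratedFDeriv ℝ (j + L.length) f z‖ := by
  induction L generalizing j with
  | nil => rfl
  | cons v L ih =>
    rw [List.forall_mem_cons] at hL
    refine (norm_iteratedFDeriv_dirDeriv_le (contDiff_listDeriv hf L) hL.1 j z).trans
      ((ih hL.2 (j + 1)).trans_eq ?_)
    rw [List.length_cons, add_right_comm, add_assoc]

/-- Derivatives in ξ do not see the coefficient, so all of them fall on the cutoff and gain 2^{-k}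
each. -/
theorem listDeriv_fst_mul {W : Type*} [NormedAddCommGroup W] [NormedSpace ℝ W] {g : V → ℂ}
    (hg : ContDiff ℝ ∞ g) {f : V × W → ℂ} (hf : ContDiff ℝ ∞ f) {L : List (V × W)}
    (hL : ∀ v ∈ L, v.1 = 0) :
    listDeriv L (fun z => g z.1 * f z) = fun z => g z.1 * listDeriv L f z := by
  induction L with
  | nil => rfl
  | cons v L ih =>
    rw [List.forall_mem_cons] at hL
    ext z
    have h1 : HasFDerivAt (fun z : V × W => g z.1)
        ((fderiv ℝ g z.1).comp (ContinuousLinearMap.fst ℝ V W)) z :=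
      (hg.differentiable (by simp) z.1).hasFDerivAt.comp z hasFDerivAt_fst
    have h2 := ((contDiff_listDeriv hf L).differentiable (by simp) z).hasFDerivAt
    have h3 : HasFDerivAt (fun z : V × W => g z.1 * listDeriv L f z) _ z := h1.mul h2
    rw [listDeriv_cons, ih hL.2, dirDeriv, h3.fderiv, listDeriv_cons, dirDeriv]
    simp [hL.1]

end IteratedDirectionalDerivatives

/-! ### Sums over dyadic shells in phase space -/

section DyadicShells

variable {d : ℕ} {φ₀ : E d × E d → ℝ}

theorem IsPhaseLPCutoff.smallPhi_eq_zero_of_le (hφ : IsPhaseLPCutoff φ₀) {k : ℕ} {z : E d × E d}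
    (hz : 2 * ‖z‖ ≤ 2 ^ k) : smallPhi φ₀ (k + 1) z = 0 := by
  -- The Euclidean norm is at most √2 times the maximum norm, so 2‖y‖ ≤ 1 places `y` in the
  -- Euclidean unit ball.
  have hone : ∀ y : E d × E d, 2 * ‖y‖ ≤ 1 → φ₀ y = 1 := fun y hy => by
    refine hφ.eq_one y.1 y.2 (Real.sqrt_le_one.2 ?_)
    have h1 := norm_fst_le y
    have h2 := norm_snd_le y
    nlinarith [norm_nonneg y.1, norm_nonneg y.2]
  have hk : (0 : ℝ) < 2 ^ k := by positivity
  change φ₀ (((2 : ℝ) ^ (k + 1))⁻¹ • z) - φ₀ (((2 : ℝ) ^ k)⁻¹ • z) = 0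
  rw [hone, hone, sub_self]
  · rw [norm_smul, Real.norm_of_nonneg (by positivity), mul_left_comm, inv_mul_le_one₀ hk]
    exact hz
  · rw [norm_smul, Real.norm_of_nonneg (by positivity), mul_left_comm,
      inv_mul_le_one₀ (by positivity), pow_succ]
    linarith

theorem IsPhaseLPCutoff.smallPhi_eq_zero_of_ge (hφ : IsPhaseLPCutoff φ₀) {k : ℕ} {z : E d × E d}
    (hz : 2 ^ (k + 2) ≤ ‖z‖) : smallPhi φ₀ (k + 1) z = 0 := by
  have hk : (0 : ℝ) < 2 ^ k := by positivity
  have h4 : (2 : ℝ) ^ (k + 2) = 4 * 2 ^ k := by ring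
  change φ₀ (((2 : ℝ) ^ (k + 1))⁻¹ • z) - φ₀ (((2 : ℝ) ^ k)⁻¹ • z) = 0
  rw [hφ.eq_zero_of_norm, hφ.eq_zero_of_norm, sub_self]
  · rw [norm_smul, Real.norm_of_nonneg (by positivity), le_inv_mul_iff₀ hk]
    linarith
  · rw [norm_smul, Real.norm_of_nonneg (by positivity), le_inv_mul_iff₀ (by positivity), pow_succ]
    linarith

theorem IsPhaseLPCutoff.contDiff_smallPhi (hφ : IsPhaseLPCutoff φ₀) (k : ℕ) :
    ContDiff ℝ ∞ fun z => (smallPhi φ₀ (k + 1) z : ℂ) :=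
  Complex.ofRealCLM.contDiff.comp
    ((hφ.smooth.comp (contDiff_const_smul _)).sub (hφ.smooth.comp (contDiff_const_smul _)))

/-- φ_{k+1} is φ_1 dilated by 2^k, and φ_1 has compact support. -/
theorem IsPhaseLPCutoff.exists_smallPhi_bound (hφ : IsPhaseLPCutoff φ₀) (j : ℕ) :
    ∃ C : ℝ, 0 ≤ C ∧ ∀ k z,
      ‖iteratedFDeriv ℝ j (fun z => (smallPhi φ₀ (k + 1) z : ℂ)) z‖ ≤ C * (((2 : ℝ) ^ k) ^ j)⁻¹ := by
  have hs : ContDiff ℝ ∞ fun z => (smallPhi φ₀ 1 z : ℂ) := hφ.contDiff_smallPhi 0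
  obtain ⟨C, hC⟩ := exists_bound_iteratedFDeriv_of_zero_outside hs (R := 4) (fun z hz => by
    rw [hφ.smallPhi_eq_zero_of_ge (k := 0) (by norm_num; exact hz), Complex.ofReal_zero]) j
  refine ⟨C, (norm_nonneg _).trans (hC 0), fun k z => ?_⟩
  have heq : (fun z => (smallPhi φ₀ (k + 1) z : ℂ)) =
      fun z => (smallPhi φ₀ 1 (((2 : ℝ) ^ k)⁻¹ • z) : ℂ) := by
    ext z
    change ((φ₀ (((2 : ℝ) ^ (k + 1))⁻¹ • z) - φ₀ (((2 : ℝ) ^ k)⁻¹ • z) : ℝ) : ℂ) =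
      ((φ₀ (((2 : ℝ) ^ 1)⁻¹ • ((2 : ℝ) ^ k)⁻¹ • z) -
        φ₀ (((2 : ℝ) ^ 0)⁻¹ • ((2 : ℝ) ^ k)⁻¹ • z) : ℝ) : ℂ)
    rw [smul_smul, smul_smul, pow_succ, mul_inv, mul_comm, pow_one, pow_zero, inv_one, one_mul]
  have h := congrFun (iteratedFDeriv_comp_const_smul ((2 : ℝ) ^ k)⁻¹
    (hs.of_le (natCast_le_infty j))) z
  rw [heq, h, norm_smul, norm_pow, Real.norm_of_nonneg (by positivity), inv_pow, mul_comm]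
  gcongr
  exact hC _

theorem norm_fst_add_norm_snd_le (x ξ : E d) : ‖x‖ + ‖ξ‖ ≤ 2 * ‖(x, ξ)‖ := by
  have h1 := norm_fst_le (x, ξ)
  have h2 := norm_snd_le (x, ξ)
  simp only at h1 h2
  linarith

theorem norm_prod_le_add (x ξ : E d) : ‖(x, ξ)‖ ≤ ‖x‖ + ‖ξ‖ :=
  max_le (le_add_of_nonneg_right (norm_nonneg _)) (le_add_of_nonneg_left (norm_nonneg _))

theorem rpow_le_of_comparable {X Y : ℝ} (hX : 0 < X) (hY : 0 < Y) (h1 : Y ≤ 9 * X)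
    (h2 : X ≤ 9 * Y) (s : ℝ) : Y ^ s ≤ 9 ^ |s| * X ^ s := by
  rcases le_or_gt 0 s with hs | hs
  · rw [abs_of_nonneg hs, ← Real.mul_rpow (by norm_num) hX.le]
    exact Real.rpow_le_rpow hY.le h1 hs
  · rw [abs_of_neg hs, ← inv_inv (9 : ℝ), Real.inv_rpow (by norm_num), Real.rpow_neg (by norm_num),
      inv_inv, ← Real.mul_rpow (by norm_num) hX.le]
    exact Real.rpow_le_rpow_of_nonpos (by positivity) (by linarith) hs.le

/-- A sum whose terms are supported in dyadic shells has boundedly many nonzero terms. -/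
theorem norm_sum_le_of_shell {T : ℕ → ℂ} {B N : ℝ} (hB : 0 ≤ B) (hT : ∀ k, ‖T k‖ ≤ B)
    (h1 : ∀ k, 2 * N < 2 ^ k → T k = 0) (h2 : ∀ k, 2 ^ (k + 2) < N → T k = 0) (s : Finset ℕ) :
    ‖∑ k ∈ s, T k‖ ≤ 4 * B := by
  classical
  by_cases h : ∃ k, T k ≠ 0
  · have hk0 := Nat.find_spec h
    set k0 := Nat.find h with hk0def
    -- If k0 is the first active index, any active `k` satisfies 2^k ≤ 2N ≤ 2^{k0+3}, leaving four
    -- candidates.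
    have hN : N ≤ 2 ^ (k0 + 2) := not_lt.1 fun hlt => hk0 (h2 _ hlt)
    have hout : ∀ k, k ∉ Finset.Icc k0 (k0 + 3) → T k = 0 := fun k hk => by
      by_contra hne
      refine hk (Finset.mem_Icc.2 ⟨Nat.find_min' h hne, ?_⟩)
      have h3 : (2 : ℝ) ^ k ≤ 2 ^ (k0 + 3) := by
        refine (not_lt.1 fun hlt => hne (h1 _ hlt)).trans ?_
        rw [pow_succ (2 : ℝ) (k0 + 2)]
        linarith
      exact (pow_le_pow_iff_right₀ one_lt_two).1 h3
    calc ‖∑ k ∈ s, T k‖ ≤ ∑ k ∈ s, ‖T k‖ := norm_sum_le _ _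
      _ ≤ ∑ k ∈ Finset.Icc k0 (k0 + 3), ‖T k‖ := by
          rw [← Finset.sum_filter_ne_zero]
          refine Finset.sum_le_sum_of_subset_of_nonneg (fun k hk => ?_) fun _ _ _ => norm_nonneg _
          by_contra hk'
          exact (Finset.mem_filter.1 hk).2 (by rw [hout k hk', norm_zero])
      _ ≤ ∑ _k ∈ Finset.Icc k0 (k0 + 3), B := Finset.sum_le_sum fun k _ => hT k
      _ = 4 * B := by
          rw [Finset.sum_const, Nat.card_Icc, nsmul_eq_mul, show k0 + 3 + 1 - k0 = 4 by omega]
          norm_num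
  · push Not at h
    simp only [h, Finset.sum_const_zero, norm_zero]
    positivity

/-- `∑_k g_k(x) φ_{k+1}(x, ξ)`. -/
def shellSum (φ₀ : E d × E d → ℝ) (g : ℕ → E d → ℂ) (z : E d × E d) : ℂ :=
  ∑' k : ℕ, g k z.1 * (smallPhi φ₀ (k + 1) z : ℂ)

theorem shellSum_eventuallyEq (hφ : IsPhaseLPCutoff φ₀) (g : ℕ → E d → ℂ) (z : E d × E d) :
    ∃ N : ℕ, shellSum φ₀ g =ᶠ[nhds z]
      fun z => ∑ k ∈ Finset.range N, g k z.1 * (smallPhi φ₀ (k + 1) z : ℂ) := by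
  obtain ⟨N, hN⟩ := pow_unbounded_of_one_lt (2 * ‖z‖) (one_lt_two : (1 : ℝ) < 2)
  refine ⟨N, ?_⟩
  have : ∀ᶠ y in nhds z, 2 * ‖y‖ < 2 ^ N :=
    (continuous_const.mul continuous_norm).continuousAt.eventually_lt continuousAt_const hN
  filter_upwards [this] with y hy
  refine tsum_eq_sum fun k hk => ?_
  have hk' : N ≤ k := by simpa using hk
  rw [hφ.smallPhi_eq_zero_of_le (hy.le.trans (pow_le_pow_right₀ one_le_two hk')),
    Complex.ofReal_zero, mul_zero]

theorem contDiff_shellTerm (hφ : IsPhaseLPCutoff φ₀) {g : ℕ → E d → ℂ}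
    (hg : ∀ k, ContDiff ℝ ∞ (g k)) (k : ℕ) :
    ContDiff ℝ ∞ fun z : E d × E d => g k z.1 * (smallPhi φ₀ (k + 1) z : ℂ) :=
  ((hg k).comp contDiff_fst).mul (hφ.contDiff_smallPhi k)

theorem contDiff_shellSum (hφ : IsPhaseLPCutoff φ₀) {g : ℕ → E d → ℂ}
    (hg : ∀ k, ContDiff ℝ ∞ (g k)) : ContDiff ℝ ∞ (shellSum φ₀ g) := by
  rw [contDiff_iff_contDiffAt]
  intro z
  obtain ⟨N, hN⟩ := shellSum_eventuallyEq hφ g z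
  exact (ContDiff.sum fun k _ => contDiff_shellTerm hφ hg k).contDiffAt.congr_of_eventuallyEq hN

/-- In the Leibniz rule an `x`-derivative on the coefficient raises the exponent from w(i) towards
w(n), while one on the cutoff gains 2^{-k}. As `w` is monotone, every term is dominated by the
exponent w(n) - |α|. -/
theorem exists_shellTerm_bound (hφ : IsPhaseLPCutoff φ₀) {g : ℕ → E d → ℂ}
    (hg : ∀ k, ContDiff ℝ ∞ (g k)) {C : ℕ → ℝ} {w : ℕ → ℝ} (hw : Monotone w)
    (hC : ∀ k i x, ‖iteratedFDeriv ℝ i (g k) x‖ ≤ C i * ((2 : ℝ) ^ k) ^ w i)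
    {L L' : List (E d × E d)} (hL : ∀ v ∈ L, ‖v‖ ≤ 1) (hL' : ∀ v ∈ L', ‖v‖ ≤ 1 ∧ v.1 = 0) :
    ∃ B : ℝ, 0 ≤ B ∧ ∀ k z,
      ‖listDeriv L (listDeriv L' fun z => g k z.1 * (smallPhi φ₀ (k + 1) z : ℂ)) z‖ ≤
        B * ((2 : ℝ) ^ k) ^ (w L.length - L'.length) := by
  have hC0 : ∀ i, 0 ≤ C i := fun i => by
    have := (norm_nonneg _).trans (hC 0 i 0)
    rwa [pow_zero, Real.one_rpow, mul_one] at this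
  choose D hD0 hD using hφ.exists_smallPhi_bound
  set n := L.length
  refine ⟨∑ i ∈ Finset.range (n + 1), n.choose i * C i * D (n - i + L'.length),
    Finset.sum_nonneg fun i _ => by have := hC0 i; have := hD0 (n - i + L'.length); positivity,
    fun k z => ?_⟩
  set f : E d × E d → ℂ := fun z => (smallPhi φ₀ (k + 1) z : ℂ)
  have hf : ContDiff ℝ ∞ f := hφ.contDiff_smallPhi k
  have hg1 : ContDiff ℝ ∞ fun z : E d × E d => g k z.1 := (hg k).comp contDiff_fst
  have hf' := contDiff_listDeriv hf L'
  have hX : (0 : ℝ) < 2 ^ k := by positivity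
  have hX1 : (1 : ℝ) ≤ 2 ^ k := one_le_pow₀ one_le_two
  rw [listDeriv_fst_mul (hg k) hf fun v hv => (hL' v hv).2]
  have h1 := norm_iteratedFDeriv_listDeriv_le (hg1.mul hf') hL 0 z
  rw [norm_iteratedFDeriv_zero, zero_add] at h1
  refine h1.trans ((norm_iteratedFDeriv_mul_le hg1 hf' z (natCast_le_infty n)).trans ?_)
  rw [Finset.sum_mul]
  refine Finset.sum_le_sum fun i hi => ?_
  have hin : i ≤ n := Finset.mem_range_succ_iff.1 hi
  have h2 : ‖iteratedFDeriv ℝ i (fun z : E d × E d => g k z.1) z‖ ≤ C i * ((2 : ℝ) ^ k) ^ w i := by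
    have := norm_iteratedFDeriv_comp_affine_le (hg k) (ContinuousLinearMap.fst ℝ (E d) (E d)) 0 i z
    simp only [add_zero] at this
    refine (this.trans (mul_le_of_le_one_left (norm_nonneg _) ?_)).trans (hC k i _)
    exact pow_le_one₀ (norm_nonneg _) (ContinuousLinearMap.norm_fst_le _ _ _)
  have h3 := (norm_iteratedFDeriv_listDeriv_le hf (fun v hv => (hL' v hv).1) (n - i) z).trans
    (hD (n - i + L'.length) k z)
  have h4 : ((2 : ℝ) ^ k) ^ w i * (((2 : ℝ) ^ k) ^ (n - i + L'.length))⁻¹ ≤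
      ((2 : ℝ) ^ k) ^ (w n - L'.length) := by
    rw [← Real.rpow_natCast _ (n - i + L'.length), ← Real.rpow_neg hX.le, ← Real.rpow_add hX]
    refine Real.rpow_le_rpow_of_exponent_le hX1 ?_
    have := hw hin
    push_cast
    linarith [(Nat.cast_nonneg (n - i) : (0 : ℝ) ≤ _)]
  have h5 := hC0 i
  have h6 := hD0 (n - i + L'.length)
  calc _ ≤ n.choose i * (C i * ((2 : ℝ) ^ k) ^ w i) *
        (D (n - i + L'.length) * (((2 : ℝ) ^ k) ^ (n - i + L'.length))⁻¹) := by gcongr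
    _ = n.choose i * C i * D (n - i + L'.length) *
        (((2 : ℝ) ^ k) ^ w i * (((2 : ℝ) ^ k) ^ (n - i + L'.length))⁻¹) := by ring
    _ ≤ _ := by gcongr

theorem exists_symbolDeriv_shellSum_bound (hφ : IsPhaseLPCutoff φ₀) {g : ℕ → E d → ℂ}
    (hg : ∀ k, ContDiff ℝ ∞ (g k)) {C : ℕ → ℝ} {w : ℕ → ℝ} (hw : Monotone w)
    (hC : ∀ k i x, ‖iteratedFDeriv ℝ i (g k) x‖ ≤ C i * ((2 : ℝ) ^ k) ^ w i) (α β : Fin d → ℕ) :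
    ∃ B : ℝ, ∀ x ξ : E d, ‖symbolDeriv β α (shellSum φ₀ g) (x, ξ)‖ ≤
      B * (1 + ‖x‖ + ‖ξ‖) ^ (w (multiLen β) - multiLen α) := by
  obtain ⟨L, hLβ, hL, hLeq⟩ := exists_multiDeriv_eq_listDeriv
    (fun i => ((EuclideanSpace.single i 1, 0) : E d × E d)) β
  obtain ⟨L', hLα, hL', hLeq'⟩ := exists_multiDeriv_eq_listDeriv
    (fun i => ((0, EuclideanSpace.single i 1) : E d × E d)) α
  have hL1 : ∀ v ∈ L, ‖v‖ ≤ 1 := fun v hv => by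
    obtain ⟨i, rfl⟩ := hL v hv
    simp [Prod.norm_def]
  have hL1' : ∀ v ∈ L', ‖v‖ ≤ 1 ∧ v.1 = 0 := fun v hv => by
    obtain ⟨i, rfl⟩ := hL' v hv
    simp [Prod.norm_def]
  obtain ⟨B, hB0, hB⟩ := exists_shellTerm_bound hφ hg hw hC hL1 hL1'
  rw [hLβ, hLα] at hB
  set s : ℝ := w (multiLen β) - multiLen α
  refine ⟨4 * (B * 9 ^ |s|), fun x ξ => ?_⟩
  have hX : 0 < 1 + ‖x‖ + ‖ξ‖ := by positivity
  obtain ⟨N, hN⟩ := shellSum_eventuallyEq hφ g (x, ξ)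
  have hterm := contDiff_shellTerm hφ hg
  have heq : symbolDeriv β α (shellSum φ₀ g) (x, ξ) = ∑ k ∈ Finset.range N,
      listDeriv L (listDeriv L' fun z => g k z.1 * (smallPhi φ₀ (k + 1) z : ℂ)) (x, ξ) := by
    rw [symbolDeriv, hLeq, hLeq', (listDeriv_congr (listDeriv_congr hN L') L).eq_of_nhds,
      listDeriv_sum hterm, listDeriv_sum fun k => contDiff_listDeriv (hterm k) L']
  have hzero : ∀ k, (fun z => smallPhi φ₀ (k + 1) z) =ᶠ[nhds (x, ξ)] (fun _ => 0) →
      listDeriv L (listDeriv L' fun z => g k z.1 * (smallPhi φ₀ (k + 1) z : ℂ)) (x, ξ) = 0 := by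
    intro k hk
    have h : (fun z => g k z.1 * (smallPhi φ₀ (k + 1) z : ℂ)) =ᶠ[nhds (x, ξ)] fun _ => 0 := by
      filter_upwards [hk] with y hy
      rw [hy, Complex.ofReal_zero, mul_zero]
    rw [(listDeriv_congr (listDeriv_congr h L') L).eq_of_nhds, listDeriv_zero, listDeriv_zero]
  -- Strict inequalities are open conditions, so the term vanishes near the point and its
  -- derivatives vanish at it.
  have h1 : ∀ k, 2 * ‖(x, ξ)‖ < 2 ^ k →
      listDeriv L (listDeriv L' fun z => g k z.1 * (smallPhi φ₀ (k + 1) z : ℂ)) (x, ξ) = 0 := by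
    intro k hk
    refine hzero k ?_
    filter_upwards [(continuous_const.mul continuous_norm).continuousAt.eventually_lt
      continuousAt_const hk] with y hy
    exact hφ.smallPhi_eq_zero_of_le (le_of_lt hy)
  have h2 : ∀ k, 2 ^ (k + 2) < ‖(x, ξ)‖ →
      listDeriv L (listDeriv L' fun z => g k z.1 * (smallPhi φ₀ (k + 1) z : ℂ)) (x, ξ) = 0 := by
    intro k hk
    refine hzero k ?_
    filter_upwards [continuousAt_const.eventually_lt continuous_norm.continuousAt hk] with y hy
    exact hφ.smallPhi_eq_zero_of_ge (le_of_lt hy)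
  rw [heq, mul_assoc]
  refine norm_sum_le_of_shell (N := ‖(x, ξ)‖) (by positivity) (fun k => ?_) h1 h2 _
  rcases lt_or_ge ((2 : ℝ) ^ (k + 2)) ‖(x, ξ)‖ with h | h
  · rw [h2 k h, norm_zero]; positivity
  rcases lt_or_ge (2 * ‖(x, ξ)‖) ((2 : ℝ) ^ k) with h' | h'
  · rw [h1 k h', norm_zero]; positivity
  -- On an active shell 2^k ≤ 2‖z‖ and ‖z‖ ≤ 4·2^k. Hence 1 + |x| + |ξ| ≤ 1 + 8·2^k ≤ 9·2^k, the
  -- source of the factor 9.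
  refine (hB k _).trans ?_
  rw [mul_assoc]
  refine mul_le_mul_of_nonneg_left (rpow_le_of_comparable hX (by positivity) ?_ ?_ s) hB0
  · have := norm_prod_le_add x ξ
    linarith [norm_nonneg x, norm_nonneg ξ]
  · have h3 := norm_fst_add_norm_snd_le x ξ
    have h4 : (2 : ℝ) ^ (k + 2) = 4 * 2 ^ k := by ring
    have h5 : (1 : ℝ) ≤ 2 ^ k := one_le_pow₀ one_le_two
    linarith

end DyadicShells

end

end Paradiff

/-! ### The main theorem -/

theorem mainTheorem8 {d : ℕ}
    (ψ₀ : Paradiff.E d → ℝ) (hψ : Paradiff.IsLPCutoff ψ₀)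
    (φ₀ : Paradiff.E d × Paradiff.E d → ℝ) (hφ : Paradiff.IsPhaseLPCutoff φ₀)
    (F : ℝ → ℝ) (hF : ContDiff ℝ ∞ F)
    (δ : ℝ) (hδ0 : 0 < δ) (hδ1 : δ < 1)
    (r : ℝ) (hr : 0 < r)
    (u : Paradiff.E d → ℝ) (hu : Paradiff.MemHolder r u) :
    Paradiff.MemGamma 0 1 δ (Paradiff.Msharp ψ₀ φ₀ δ F u) ∧
    (∀ α β : Fin d → ℕ,
      ((Paradiff.multiLen β : ℝ) ≤ r → ∃ C : ℝ, ∀ x ξ : Paradiff.E d,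
        ‖Paradiff.symbolDeriv β α (Paradiff.Msharp ψ₀ φ₀ δ F u) (x, ξ)‖ ≤
          C * (1 + ‖x‖ + ‖ξ‖) ^ (-(Paradiff.multiLen α : ℝ))) ∧
      (r < (Paradiff.multiLen β : ℝ) → ∃ C : ℝ, ∀ x ξ : Paradiff.E d,
        ‖Paradiff.symbolDeriv β α (Paradiff.Msharp ψ₀ φ₀ δ F u) (x, ξ)‖ ≤
          C * (1 + ‖x‖ + ‖ξ‖) ^
            (-(Paradiff.multiLen α : ℝ) + δ * ((Paradiff.multiLen β : ℝ) - r)))) ∧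
    Paradiff.MemGamma (-(δ * r)) 1 1 (Paradiff.Mflat ψ₀ φ₀ δ F u) := by
  obtain ⟨C, hC⟩ := Paradiff.exists_mSmooth_bound hψ hφ hF hr hu hδ0
  obtain ⟨D, hD⟩ := Paradiff.exists_mCoeff_sub_mSmooth_bound hψ hφ hF hr hu hδ0 hδ1
  have hw : Monotone fun i : ℕ => δ * max ((i : ℝ) - r) 0 := fun i j hij => by
    have : (i : ℝ) ≤ j := by exact_mod_cast hij
    dsimp only
    gcongr
  have hw' : Monotone fun i : ℕ => (i : ℝ) - δ * r := fun i j hij => by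
    have : (i : ℝ) ≤ j := by exact_mod_cast hij
    dsimp only
    gcongr
  have hsharp := Paradiff.exists_symbolDeriv_shellSum_bound hφ (fun k => (hC k).1) hw
    fun k => (hC k).2
  have hflat := Paradiff.exists_symbolDeriv_shellSum_bound hφ (fun k => (hD k).1) hw'
    fun k => (hD k).2
  refine ⟨⟨Paradiff.contDiff_shellSum hφ fun k => (hC k).1, fun α β => ?_⟩, fun α β => ⟨fun h => ?_,
    fun h => ?_⟩, ⟨Paradiff.contDiff_shellSum hφ fun k => (hD k).1, fun α β => ?_⟩⟩
  · obtain ⟨B, hB⟩ := hsharp α β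
    refine ⟨|B|, fun x ξ => (hB x ξ).trans ?_⟩
    have h1 : 1 ≤ 1 + ‖x‖ + ‖ξ‖ := by linarith [norm_nonneg x, norm_nonneg ξ]
    refine mul_le_mul (le_abs_self B) (Real.rpow_le_rpow_of_exponent_le h1 ?_) (by positivity)
      (abs_nonneg B)
    -- The class Γ^0_{1,δ} needs only (|β| - r)_+ ≤ |β|; the refined estimates keep the exact
    -- exponent.
    have h2 : max ((Paradiff.multiLen β : ℝ) - r) 0 ≤ Paradiff.multiLen β :=
      max_le (by linarith) (Nat.cast_nonneg _)
    have := mul_le_mul_of_nonneg_left h2 hδ0.le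
    linarith
  · obtain ⟨B, hB⟩ := hsharp α β
    rw [max_eq_right (by linarith), mul_zero, zero_sub] at hB
    exact ⟨B, hB⟩
  · obtain ⟨B, hB⟩ := hsharp α β
    rw [max_eq_left (by linarith), sub_eq_neg_add] at hB
    exact ⟨B, hB⟩
  · obtain ⟨B, hB⟩ := hflat α β
    refine ⟨B, fun x ξ => (hB x ξ).trans_eq ?_⟩
    congr 2
    ring
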